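/- Let $p$ be a prime and let $\Gamma$ be a countable residually finite group such that $\mathrm{Wh}^{\mathbb{F}_p}(\Gamma) = K_1(\mathbb{F}_p\Gamma)/\langle \mathbb{F}_p^\times\cdot\Gamma\rangle$ is a torsion group. Let $\widehat{\mathbb{Z}\Gamma} = \varprojlim_n \mathbb{Z}\Gamma/p^n\mathbb{Z}\Gamma$; its elements are written $\sum_\gamma x_\gamma\gamma$ with $x_\gamma\in\mathbb{Z}_p$, $x_\gamma \to 0$. Put $K_T(\widehat{\mathbb{Z}\Gamma}) = K_1(\widehat{\mathbb{Z}\Gamma})/\langle\pm\Gamma\rangle$ and let $\mathrm{tr}_\Gamma : M_r(\widehat{\mathbb{Z}\Gamma}) \to \mathbb{Z}_p$ be the matrix trace followed by $\sum_\gamma x_\gamma\gamma\mapsto x_e$. Then there is a unique homomorphism $\log_p\det_\Gamma : K_T(\widehat{\mathbb{Z}\Gamma})\to\mathbb{Q}_p$ whose value at the class of $u \in 1+pM_r(\widehat{\mathbb{Z}\Gamma})$ is $\mathrm{tr}_\Gamma(\log u)$ for every $r$, where $\log u = -\sum_{\nu\ge1}(1-u)^\nu/\nu$. Let $M$ be a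 $\mathbb{Z}\Gamma$-module of type $FL$, i.e. $M$ has a resolution $0\to F_d\xrightarrow{\partial}\cdots\xrightarrow{\partial} F_0\to M\to 0$ by finitely generated free $\mathbb{Z}\Gamma$-modules. Assume that $pM=M$ and that $\varprojlim_i M_{p^i}=0$, where $M_{p^i}=\ker(p^i:M\to M)$ and the transition maps $M_{p^{i+1}}\to M_{p^{i}}$ are multiplication by $p$. a) For every such resolution and every choice of bases $\mathfrak{b}_\nu$ of the $F_\nu$, the complex $\widehat{\mathbb{Z}\Gamma}\otimes_{\mathbb{Z}\Gamma}F_\bullet$ (without $M$) is acyclic with differential $\hat\partial=\mathrm{id}\otimes\partial$. Its torsion $\tau(F_\bullet,\mathfrak{b}_\bullet)\in K_T(\widehat{\mathbb{Z}\Gamma})$ is the class of the matrix of $\hat\partial+\delta : \bigoplus_{\nu\text{ odd}}\widehat{\mathbb{Z}\Gamma}\otimes F_\nu\to\bigoplus_{\nu\text{ even}}\widehat{\mathbb{Z}\Gamma}\otimes F_\nu$ with respect to the bases $1\otimes\mathfrak{b}_\nu$ in some ordering, where $\delta$ is a chain contraction. The $p$-adic $R$-torsion $\tau_p^\Gamma(M)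 := \log_p\det_\Gamma(\tau(F_\bullet,\mathfrak{b}_\bullet))\in\mathbb{Q}_p$ is thereby defined, and it does not depend on the based resolution (nor on $\delta$ or the orderings). b) Let $(\Gamma_n)$ be a sequence of normal subgroups of finite index in $\Gamma$ such that the intersection of any infinitely many of the $\Gamma_n$ is trivial. Then the groups $H_i(\Gamma_n,M)$ are finite and, for each $n$, vanish for almost all $i$; with $\chi(\Gamma_n,M)=\prod_i|H_i(\Gamma_n,M)|^{(-1)^i}\in\mathbb{Q}^\times$ we have $$\tau_p^\Gamma(M)=\lim_{n\to\infty}(\Gamma:\Gamma_n)^{-1}\log_p\chi(\Gamma_n,M)\quad\text{in }\mathbb{Q}_p,$$ where $\log_p:\mathbb{Q}_p^\times\to\mathbb{Q}_p$ is the $p$-adic logarithm with $\log_p(p)=0$. -/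

import Mathlib

namespace PadicTorsion

open scoped Topology

noncomputable section

/-! ### `K₁` of a ring -/

section KOne

variable (R : Type*) [Ring R]

/-- The square matrix of size `m ≥ n` with upper left block `A` and lower right block `1`. -/
def stabMatrix {n : ℕ} (m : ℕ) (A : Matrix (Fin n) (Fin n) R) : Matrix (Fin m) (Fin m) R :=
  fun i j =>
    if h : (i : ℕ) < n ∧ (j : ℕ) < n then A ⟨i, h.1⟩ ⟨j, h.2⟩ else if i = j then 1 else 0

theorem stabMatrix_one {n m : ℕ} : stabMatrix R m (1 : Matrix (Fin n) (Fin n) R) = 1 := by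
  ext i j
  by_cases h : (i : ℕ) < n ∧ (j : ℕ) < n
  · simp [stabMatrix, h, Matrix.one_apply, Fin.ext_iff]
  · simp only [stabMatrix, dif_neg h, Matrix.one_apply]

theorem stabMatrix_mul {n m : ℕ} (hnm : n ≤ m) (A B : Matrix (Fin n) (Fin n) R) :
    stabMatrix R m (A * B) = stabMatrix R m A * stabMatrix R m B := by
  obtain ⟨c, rfl⟩ := Nat.exists_eq_add_of_le hnm
  ext i j
  simp only [Matrix.mul_apply, Fin.sum_univ_add]
  have h1 : ∀ (x : Fin n) (y : Fin c), ¬ (x : ℕ) = n + (y : ℕ) := fun x y => by omega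
  have h2 : ∀ (x : Fin n) (y : Fin c), ¬ n + (y : ℕ) = (x : ℕ) := fun x y => by omega
  induction i using Fin.addCases <;> induction j using Fin.addCases <;>
    simp [stabMatrix, Matrix.mul_apply, Fin.ext_iff, h1, h2] <;> simp [Fin.val_inj]

/-- Stabilisation `GL_n(R) → GL_m(R)`, `A ↦ diag(A, 1)`, for `n ≤ m`. -/
def stab (n m : ℕ) (h : n ≤ m) :
    (Matrix (Fin n) (Fin n) R)ˣ →* (Matrix (Fin m) (Fin m) R)ˣ :=
  Units.map
    { toFun := stabMatrix R m
      map_one' := stabMatrix_one R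
      map_mul' := stabMatrix_mul R h }

instance stab_directedSystem :
    DirectedSystem (fun n : ℕ => (Matrix (Fin n) (Fin n) R)ˣ) (fun n m h => stab R n m h) where
  map_self n x := by
    ext i j
    simp [stab, stabMatrix]
  map_map k j i hij hjk x := by
    ext a b
    simp only [stab, stabMatrix, Units.coe_map, MonoidHom.coe_mk, OneHom.coe_mk, Fin.ext_iff]
    split_ifs <;> first | rfl | omega

/-- `GL_∞(R)`, the direct limit of the groups `GL_n(R)`. -/
abbrev GLInf : Type _ :=
  DirectLimit (fun n : ℕ => (Matrix (Fin n) (Fin n) R)ˣ) (fun n m h => stab R n m h)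

/-- `K₁(R)`, the abelianization of `GL_∞(R)`. -/
abbrev KOne : Type _ := Abelianization (GLInf R)

variable {R}

/-- The class in `K₁(R)` of an invertible matrix. -/
def KOne.mk {n : ℕ} (A : (Matrix (Fin n) (Fin n) R)ˣ) : KOne R :=
  Abelianization.of (⟦⟨n, A⟩⟧ : GLInf R)

/-- The natural map `Rˣ → K₁(R)`. -/
def KOne.ofUnit (u : Rˣ) : KOne R :=
  KOne.mk (n := 1) (Units.map (Matrix.scalar (Fin 1) : R →+* Matrix (Fin 1) (Fin 1) R).toMonoidHom u)

/-- The quotient of `K₁(R)` by the subgroup generated by the classes of the units in `S`. -/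
abbrev KOneMod (S : Set Rˣ) : Type _ := KOne R ⧸ Subgroup.closure (KOne.ofUnit '' S)

end KOne

/-- `Wh^{𝔽_p}(Γ) = K₁(𝔽_p Γ) / ⟨𝔽_pˣ · Γ⟩`. -/
abbrev WhMod (p : ℕ) (Γ : Type*) [Group Γ] : Type _ :=
  KOneMod {u : (MonoidAlgebra (ZMod p) Γ)ˣ |
    ∃ (ζ : (ZMod p)ˣ) (γ : Γ), (u : MonoidAlgebra (ZMod p) Γ) = MonoidAlgebra.single γ (ζ : ZMod p)}

/-! ### The `p`-adic completion of the integral group ring -/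

section Completion

variable (p : ℕ) (Γ : Type*) [Group Γ]

/-- Reduction `(ℤ/pⁿ)Γ → (ℤ/pᵐ)Γ` for `m ≤ n`. -/
def reduction {m n : ℕ} (h : m ≤ n) :
    MonoidAlgebra (ZMod (p ^ n)) Γ →+* MonoidAlgebra (ZMod (p ^ m)) Γ :=
  MonoidAlgebra.mapRingHom Γ (ZMod.castHom (pow_dvd_pow p h) (ZMod (p ^ m)))

/-- The inverse limit of the rings `ℤΓ / pⁿℤΓ = (ℤ/pⁿ)Γ`, as a subring of their product. -/
def completionSubring : Subring (∀ n : ℕ, MonoidAlgebra (ZMod (p ^ n)) Γ) where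
  carrier := {x | ∀ (m n : ℕ) (h : m ≤ n), reduction p Γ h (x n) = x m}
  mul_mem' hx hy m n h := by simp [hx m n h, hy m n h]
  one_mem' m n h := by simp
  add_mem' hx hy m n h := by simp [hx m n h, hy m n h]
  zero_mem' m n h := by simp
  neg_mem' hx m n h := by simp [hx m n h]

/-- The `p`-adic completion of `ℤΓ`. -/
abbrev GroupRingHat : Type _ := completionSubring p Γ

/-- The canonical map from `ℤΓ` to its `p`-adic completion. -/
def toHat : MonoidAlgebra ℤ Γ →+* GroupRingHat p Γ :=
  RingHom.codRestrict
    (RingHom.pi fun n => MonoidAlgebra.mapRingHom Γ (Int.castRingHom (ZMod (p ^ n))))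
    (completionSubring p Γ) fun x m n h => by
      change reduction p Γ h (MonoidAlgebra.mapRingHom Γ (Int.castRingHom (ZMod (p ^ n))) x)
        = MonoidAlgebra.mapRingHom Γ (Int.castRingHom (ZMod (p ^ m))) x
      ext γ
      simp [reduction]

/-- The `p`-adic topology: the topology of the inverse limit of discrete rings. -/
instance : TopologicalSpace (GroupRingHat p Γ) :=
  TopologicalSpace.induced (fun x => (x : ∀ n : ℕ, MonoidAlgebra (ZMod (p ^ n)) Γ))
    (@Pi.topologicalSpace ℕ _ fun _ => ⊥)

instance : T2Space (GroupRingHat p Γ) := by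
  let _ : ∀ n : ℕ, TopologicalSpace (MonoidAlgebra (ZMod (p ^ n)) Γ) := fun _ => ⊥
  have _ : ∀ n : ℕ, DiscreteTopology (MonoidAlgebra (ZMod (p ^ n)) Γ) := fun _ => ⟨rfl⟩
  exact T2Space.of_injective_continuous Subtype.val_injective continuous_induced_dom

variable {p Γ} in
theorem summable_hat (f : ℕ → GroupRingHat p Γ)
    (hf : ∀ n : ℕ, ∀ᶠ k in Filter.atTop, (f k).1 n = 0) : Summable f := by
  let _ : ∀ n : ℕ, TopologicalSpace (MonoidAlgebra (ZMod (p ^ n)) Γ) := fun _ => ⊥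
  have _ : ∀ n : ℕ, DiscreteTopology (MonoidAlgebra (ZMod (p ^ n)) Γ) := fun _ => ⟨rfl⟩
  have _ : ∀ n : ℕ, ContinuousAdd (MonoidAlgebra (ZMod (p ^ n)) Γ) := fun _ => inferInstance
  have hfin : ∀ n, ∃ N, ∀ k ∉ Finset.range N, (f k).1 n = 0 := by
    intro n
    obtain ⟨N, hN⟩ := Filter.eventually_atTop.1 (hf n)
    exact ⟨N, fun k hk => hN k (by simpa using hk)⟩
  choose N hN using hfin
  have hs : ∀ n, HasSum (fun k => (f k).1 n) (∑ k ∈ Finset.range (N n), (f k).1 n) :=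
    fun n => hasSum_sum_of_ne_finset_zero (hN n)
  let s : ∀ n, MonoidAlgebra (ZMod (p ^ n)) Γ := fun n => ∑ k ∈ Finset.range (N n), (f k).1 n
  have hmem : s ∈ completionSubring p Γ := by
    intro m n h
    have := (hs n).map (reduction p Γ h) continuous_of_discreteTopology
    refine this.unique ?_
    have e : (reduction p Γ h ∘ fun k => (f k).1 n) = fun k => (f k).1 m := by
      funext k; exact (f k).2 m n h
    rw [e]; exact hs m
  refine ⟨⟨s, hmem⟩, ?_⟩
  have hi : Topology.IsInducing
      (fun x : GroupRingHat p Γ => (x : ∀ n : ℕ, MonoidAlgebra (ZMod (p ^ n)) Γ)) := ⟨rfl⟩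
  have := (hi.hasSum_iff (g := (completionSubring p Γ).subtype) f ⟨s, hmem⟩ ).1 (Pi.hasSum.2 hs)
  exact this

variable [Fact p.Prime]

/-- The structure map `ℤ_p → \widehat{ℤΓ}`. -/
def scalarHat : ℤ_[p] →+* GroupRingHat p Γ :=
  RingHom.codRestrict
    (RingHom.pi fun n => (MonoidAlgebra.singleOneRingHom (R := ZMod (p ^ n)) (M := Γ)).comp
      (PadicInt.toZModPow n))
    (completionSubring p Γ) fun x m n h => by
      change reduction p Γ h (MonoidAlgebra.single 1 (PadicInt.toZModPow n x))
        = MonoidAlgebra.single 1 (PadicInt.toZModPow m x)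
      simp [reduction, PadicInt.cast_toZModPow m n h]

variable {p Γ}

theorem coeff_compat (γ : Γ) (x : GroupRingHat p Γ) (n : ℕ) :
    (p : ℤ) ^ n ∣ ((((x.1 (n + 1)).coeff γ).val : ℕ) : ℤ) - ((((x.1 n).coeff γ).val : ℕ) : ℤ) := by
  have h := x.2 n (n + 1) n.le_succ
  have h2 : ZMod.castHom (pow_dvd_pow p n.le_succ) (ZMod (p ^ n)) ((x.1 (n + 1)).coeff γ)
      = (x.1 n).coeff γ := by
    rw [← h]
    simp [reduction]
  have := (ZMod.intCast_eq_intCast_iff_dvd_sub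
    ((((x.1 n).coeff γ).val : ℕ) : ℤ) ((((x.1 (n + 1)).coeff γ).val : ℕ) : ℤ) (p ^ n)).1 (by
      rw [Int.cast_natCast, Int.cast_natCast, ZMod.natCast_zmod_val, ← h2, ZMod.castHom_apply,
        ZMod.natCast_val])
  exact_mod_cast this

/-- The coefficient `x_γ ∈ ℤ_p` at `γ` of an element `x = ∑ x_γ γ` of the completed group ring:
the `p`-adic integer whose residue modulo `pⁿ` is the coefficient at `γ` of `x` modulo `pⁿ`. -/
def coeffHat (γ : Γ) (x : GroupRingHat p Γ) : ℤ_[p] :=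
  PadicInt.ofIntSeq (fun n => ((((x.1 n).coeff γ).val : ℕ) : ℤ))
    (PadicInt.isCauSeq_padicNorm_of_pow_dvd_sub _ p (coeff_compat γ x))

theorem toZModPow_coeffHat (γ : Γ) (x : GroupRingHat p Γ) (n : ℕ) :
    PadicInt.toZModPow n (coeffHat γ x) = (x.1 n).coeff γ := by
  rw [coeffHat, PadicInt.toZModPow_ofIntSeq_of_pow_dvd_sub _ p (coeff_compat γ x)]
  simp

/-- The trace `tr_Γ : M_r(\widehat{ℤΓ}) → ℤ_p`: the usual trace of matrices followed by
`∑ x_γ γ ↦ x_e`. -/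
def trace {r : ℕ} (A : Matrix (Fin r) (Fin r) (GroupRingHat p Γ)) : ℤ_[p] :=
  coeffHat 1 (Matrix.trace A)

end Completion

/-! ### The logarithm on `1 + p M_r(\widehat{ℤΓ})` and `log_p det_Γ` -/

section LogDet

variable (p : ℕ) [Fact p.Prime]

theorem norm_logCoeff_le (k : ℕ) : ‖((-1) ^ k * p ^ (k + 1) / ((k + 1 : ℕ) : ℚ_[p]))‖ ≤ 1 := by
  have hp : 1 < p := (Fact.out : p.Prime).one_lt
  have h1 : padicValNat p (k + 1) ≤ k + 1 := by
    refine (padicValNat_le_nat_log _).trans (Nat.log_le_self _ _)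
  rw [norm_div, norm_mul, norm_pow, norm_neg, norm_one, one_pow, one_mul, norm_pow,
    Padic.norm_p, Padic.norm_eq_zpow_neg_valuation (by exact_mod_cast Nat.succ_ne_zero k), Padic.valuation_natCast,
    zpow_neg, div_inv_eq_mul, zpow_natCast, inv_pow]
  have hp0 : (0 : ℝ) < (p : ℝ) ^ (k + 1) := by positivity
  rw [inv_mul_le_iff₀ hp0, mul_one]
  exact pow_le_pow_right₀ (by exact_mod_cast hp.le) h1

/-- The `p`-adic integer `(-1)^{ν+1} p^ν / ν`, for `ν = k + 1`. -/
def logCoeff (k : ℕ) : ℤ_[p] :=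
  ⟨(-1) ^ k * p ^ (k + 1) / ((k + 1 : ℕ) : ℚ_[p]), norm_logCoeff_le p k⟩

theorem tendsto_logCoeff : Filter.Tendsto (fun k => ‖logCoeff p k‖) Filter.atTop (nhds 0) := by
  have hp : 1 < p := (Fact.out : p.Prime).one_lt
  have key : ∀ k, ‖logCoeff p k‖ ≤ ((k+1 : ℕ) : ℝ) * ((p : ℝ)⁻¹) ^ (k+1) := by
    intro k
    have hk : ((k + 1 : ℕ) : ℚ_[p]) ≠ 0 := by exact_mod_cast Nat.succ_ne_zero k
    change ‖((-1) ^ k * p ^ (k + 1) / ((k + 1 : ℕ) : ℚ_[p]))‖ ≤ _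
    rw [norm_div, norm_mul, norm_pow, norm_neg, norm_one, one_pow, one_mul, norm_pow,
      Padic.norm_p, Padic.norm_eq_zpow_neg_valuation hk, Padic.valuation_natCast,
      zpow_neg, div_inv_eq_mul, zpow_natCast, mul_comm]
    have : p ^ padicValNat p (k+1) ≤ k+1 := Nat.le_of_dvd (Nat.succ_pos k) pow_padicValNat_dvd
    gcongr
    exact_mod_cast this
  have h0 : Filter.Tendsto (fun k : ℕ => (k : ℝ) * ((p : ℝ)⁻¹) ^ k) Filter.atTop (nhds 0) :=
    tendsto_self_mul_const_pow_of_lt_one (by positivity)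
      (inv_lt_one_of_one_lt₀ (by exact_mod_cast hp))
  exact squeeze_zero (fun _ => norm_nonneg _) key ((Filter.tendsto_add_atTop_iff_nat 1).2 h0)

variable {p} {Γ : Type*} [Group Γ]

/-- The logarithmic series converges. -/
theorem summable_log {r : ℕ} (a : Matrix (Fin r) (Fin r) (GroupRingHat p Γ)) :
    Summable (fun k : ℕ => scalarHat p Γ (logCoeff p k) • a ^ (k + 1)) := by
  refine Pi.summable.2 fun i => Pi.summable.2 fun j => summable_hat _ fun n => ?_
  have hp : 1 < p := (Fact.out : p.Prime).one_lt
  have : (0:ℝ) < (p:ℝ) ^ (-(n:ℤ)) := by positivity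
  filter_upwards [(tendsto_logCoeff p).eventually (gt_mem_nhds this)] with k hk
  have h0 : PadicInt.toZModPow n (logCoeff p k) = 0 := by
    rw [← RingHom.mem_ker, PadicInt.ker_toZModPow, ← PadicInt.norm_le_pow_iff_mem_span_pow]
    exact hk.le
  have h1 : (scalarHat p Γ (logCoeff p k)).1 n = 0 := by
    change MonoidAlgebra.single 1 (PadicInt.toZModPow n (logCoeff p k)) = 0
    rw [h0]; simp
  change (scalarHat p Γ (logCoeff p k)).1 n * ((a ^ (k+1)) i j).1 n = 0
  rw [h1, zero_mul]

/-- `log u = -∑_{ν ≥ 1} (1 - u)^ν / ν` for the `1`-unit `u = 1 + p a` of `M_r(\widehat{ℤΓ})`. Here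
`-(1 - u)^ν / ν = ((-1)^{ν+1} p^ν / ν) a^ν`, and the series converges `p`-adically. -/
def logOneUnit {r : ℕ} (a : Matrix (Fin r) (Fin r) (GroupRingHat p Γ)) :
    Matrix (Fin r) (Fin r) (GroupRingHat p Γ) :=
  ∑' k : ℕ, scalarHat p Γ (logCoeff p k) • a ^ (k + 1)

variable (p Γ)

/-- `K_T(\widehat{ℤΓ}) = K₁(\widehat{ℤΓ}) / ⟨±Γ⟩`. -/
abbrev KTHat : Type _ :=
  KOneMod {u : (GroupRingHat p Γ)ˣ | ∃ γ : Γ,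
    (u : GroupRingHat p Γ) = toHat p Γ (MonoidAlgebra.single γ 1) ∨
    (u : GroupRingHat p Γ) = -toHat p Γ (MonoidAlgebra.single γ 1)}

variable {p Γ}

/-- The canonical map `GL_r(\widehat{ℤΓ}) → K_T(\widehat{ℤΓ})`. -/
def KTHat.mk {r : ℕ} (u : (Matrix (Fin r) (Fin r) (GroupRingHat p Γ))ˣ) : KTHat p Γ :=
  QuotientGroup.mk (KOne.mk u)

/-- The property that characterizes `log_p det_Γ` among the homomorphisms `K_T(\widehat{ℤΓ}) → ℚ_p`:
it sends the class of a `1`-unit `u = 1 + p a` in `GL_r(\widehat{ℤΓ})` to `tr_Γ (log u)`. -/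
def IsLogDet (φ : KTHat p Γ →* Multiplicative ℚ_[p]) : Prop :=
  ∀ (r : ℕ) (a : Matrix (Fin r) (Fin r) (GroupRingHat p Γ))
    (u : (Matrix (Fin r) (Fin r) (GroupRingHat p Γ))ˣ),
    (u : Matrix (Fin r) (Fin r) (GroupRingHat p Γ)) = 1 + (p : GroupRingHat p Γ) • a →
      φ (KTHat.mk u) = Multiplicative.ofAdd ((trace (logOneUnit a) : ℤ_[p]) : ℚ_[p])

end LogDet

/-! ### Based resolutions and their torsion -/

/-- A finite resolution `0 → F_d → ⋯ → F_0 → M → 0` by finitely generated free `R`-modules, together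
with an (ordered) basis of each `F_ν`. -/
structure BasedResolution (R : Type) [Ring R] (M : Type) [AddCommGroup M] [Module R M] where
  complex : ChainComplex (ModuleCat.{0} R) ℕ
  rank : ℕ → ℕ
  basis : ∀ n : ℕ, Module.Basis (Fin (rank n)) R (complex.X n)
  length : ℕ
  rank_eq_zero : ∀ n : ℕ, length < n → rank n = 0
  aug : complex.X 0 →ₗ[R] M
  aug_surjective : Function.Surjective aug
  exact_aug : Function.Exact (complex.d 1 0).hom aug
  exact_succ : ∀ n : ℕ, Function.Exact (complex.d (n + 2) (n + 1)).hom (complex.d (n + 1) n).hom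

/-- `M` is of type `FL`: it has a finite resolution by finitely generated free modules. (Such modules
have finite bases, so that this is the existence of a based resolution.) -/
def IsTypeFL (R : Type) [Ring R] (M : Type) [AddCommGroup M] [Module R M] : Prop :=
  Nonempty (BasedResolution R M)

namespace BasedResolution

variable {Γ : Type} [Group Γ] {M : Type} [AddCommGroup M] [Module (MonoidAlgebra ℤ Γ) M]

/-- The matrix of `∂̂ = id ⊗ ∂ : \widehat{ℤΓ} ⊗ F_i → \widehat{ℤΓ} ⊗ F_j` with respect to the bases
`1 ⊗ b_i` and `1 ⊗ b_j`. Linear maps of left modules act on row vectors: the matrix `(a_{st})` of `f`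
is given by `f (e_s) = ∑_t a_{st} e_t`. -/
def dHat (F : BasedResolution (MonoidAlgebra ℤ Γ) M) (p i j : ℕ) :
    Matrix (Fin (F.rank i)) (Fin (F.rank j)) (GroupRingHat p Γ) :=
  fun s t => toHat p Γ ((F.basis j).repr ((F.complex.d i j).hom (F.basis i s)) t)

/-- The complex `0 → \widehat{ℤΓ} ⊗ F_d → ⋯ → \widehat{ℤΓ} ⊗ F_0 → 0` is acyclic. Its terms are
identified with `\widehat{ℤΓ}^{rank}` by means of the bases `1 ⊗ b_ν`. -/
def IsAcyclicHat (F : BasedResolution (MonoidAlgebra ℤ Γ) M) (p : ℕ) : Prop :=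
  Function.Surjective (fun v => Matrix.vecMul v (F.dHat p 1 0)) ∧
    ∀ n : ℕ, Function.Exact (fun v => Matrix.vecMul v (F.dHat p (n + 2) (n + 1)))
      (fun v => Matrix.vecMul v (F.dHat p (n + 1) n))

/-- The matrices `S i j` are the components of a chain contraction `δ` of degree one of the completed
complex: `δ ∂̂ + ∂̂ δ = id`. -/
structure IsContraction (F : BasedResolution (MonoidAlgebra ℤ Γ) M) (p : ℕ)
    (S : ∀ i j : ℕ, Matrix (Fin (F.rank i)) (Fin (F.rank j)) (GroupRingHat p Γ)) : Prop where
  degree_one : ∀ i j : ℕ, i + 1 ≠ j → S i j = 0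
  zero : S 0 1 * F.dHat p 1 0 = 1
  succ : ∀ n : ℕ,
    F.dHat p (n + 1) n * S n (n + 1) + S (n + 1) (n + 2) * F.dHat p (n + 2) (n + 1) = 1

/-- The matrix of `(∂̂ + δ)_odd : \widehat{ℤΓ} ⊗ F_odd → \widehat{ℤΓ} ⊗ F_even` with respect to the
bases `1 ⊗ b_odd` and `1 ⊗ b_even`. -/
def oddMatrix (F : BasedResolution (MonoidAlgebra ℤ Γ) M) (p : ℕ)
    (S : ∀ i j : ℕ, Matrix (Fin (F.rank i)) (Fin (F.rank j)) (GroupRingHat p Γ)) :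
    Matrix (Σ k : ℕ, Fin (F.rank (2 * k + 1))) (Σ k : ℕ, Fin (F.rank (2 * k))) (GroupRingHat p Γ) :=
  fun s t => (F.dHat p (2 * s.1 + 1) (2 * t.1) + S (2 * s.1 + 1) (2 * t.1)) s.2 t.2

/-- `t` is the torsion `τ(F_•, b_•) ∈ K_T(\widehat{ℤΓ})`: the class of the invertible matrix of
`(∂̂ + δ)_odd`, for some chain contraction `δ` and some orderings of `b_odd` and `b_even`. -/
def IsTorsion (F : BasedResolution (MonoidAlgebra ℤ Γ) M) (p : ℕ) [Fact p.Prime]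
    (t : KTHat p Γ) : Prop :=
  ∃ (S : ∀ i j : ℕ, Matrix (Fin (F.rank i)) (Fin (F.rank j)) (GroupRingHat p Γ)) (r : ℕ)
    (e : (Σ k : ℕ, Fin (F.rank (2 * k + 1))) ≃ Fin r) (e' : (Σ k : ℕ, Fin (F.rank (2 * k))) ≃ Fin r)
    (u : (Matrix (Fin r) (Fin r) (GroupRingHat p Γ))ˣ),
    F.IsContraction p S ∧
      (u : Matrix (Fin r) (Fin r) (GroupRingHat p Γ)) = Matrix.reindex e e' (F.oddMatrix p S) ∧
      t = KTHat.mk u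

end BasedResolution

/-! ### The condition `lim M_{pⁱ} = 0`, homology, Euler characteristics, limits -/

/-- The inverse limit of the groups `M_{pⁱ} = ker (pⁱ : M → M)` along the transition maps
`p : M_{p^{i+1}} → M_{pⁱ}`. -/
def limTorsion (p : ℕ) (M : Type*) [AddCommGroup M] : AddSubgroup (ℕ → M) where
  carrier := {a | (∀ i : ℕ, p ^ i • a i = 0) ∧ ∀ i : ℕ, p • a (i + 1) = a i}
  add_mem' ha hb := ⟨fun i => by simp [ha.1 i, hb.1 i], fun i => by simp [ha.2 i, hb.2 i]⟩
  zero_mem' := ⟨fun i => by simp, fun i => by simp⟩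
  neg_mem' ha := ⟨fun i => by simp [ha.1 i], fun i => by simp [ha.2 i]⟩

/-- The group homology `H_i(Δ, M)` of a subgroup `Δ ≤ Γ` with coefficients in the `ℤΓ`-module `M`. -/
abbrev homologyGroup {Γ : Type} [Group Γ] (Δ : Subgroup Γ) (M : Type) [AddCommGroup M]
    [Module (MonoidAlgebra ℤ Γ) M] (i : ℕ) : ModuleCat ℤ :=
  groupHomology (Rep.of ((Representation.ofModule' (k := ℤ) (G := Γ) M).comp Δ.subtype)) i

/-- The multiplicative Euler characteristic `χ(Δ, M) = ∏_i |H_i(Δ, M)|^{(-1)^i}`. -/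
def eulerChar {Γ : Type} [Group Γ] (Δ : Subgroup Γ) (M : Type) [AddCommGroup M]
    [Module (MonoidAlgebra ℤ Γ) M] : ℚ :=
  ∏ᶠ i : ℕ, (Nat.card (homologyGroup Δ M i) : ℚ) ^ ((-1 : ℤ) ^ i)

/-- `Γ_n → e`: a sequence of normal subgroups of finite index such that the intersection of any
infinitely many of them is trivial. -/
def TendsToTrivial {Γ : Type*} [Group Γ] (Δ : ℕ → Subgroup Γ) : Prop :=
  (∀ n : ℕ, (Δ n).Normal ∧ (Δ n).FiniteIndex) ∧ ∀ I : Set ℕ, I.Infinite → ⨅ n ∈ I, Δ n = ⊥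

/-- The branch of the `p`-adic logarithm on `ℚ_pˣ` with `log_p p = 0`. The unit part
`v = x / p^{ord x}` of `x ≠ 0` satisfies `v^{p-1} ∈ 1 + pℤ_p`, so `log_p x = (p-1)⁻¹ log_p (v^{p-1})`,
where `log_p w = -∑_{ν ≥ 1} (1 - w)^ν / ν` on `1 + pℤ_p`. -/
def padicLog (p : ℕ) [Fact p.Prime] (x : ℚ_[p]) : ℚ_[p] :=
  ((p : ℚ_[p]) - 1)⁻¹ *
    -∑' k : ℕ, (1 - (x * (p : ℚ_[p]) ^ (-x.valuation)) ^ (p - 1)) ^ (k + 1) / ((k + 1 : ℕ) : ℚ_[p])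

end

end PadicTorsion

namespace PadicTorsion

open scoped Topology

noncomputable section

/-! ### The `p`-adic logarithm and determinants -/

section Log

variable {p : ℕ} [Fact p.Prime]

/-! Everything is obtained by approximation along finite quotients `G = Γ/Δ`. The completed group
ring acts on `ℤ_p[G]` through `rhoHat`, and `log_p` of the determinant of this action is a
homomorphism `logDet` from `K_T` to `ℚ_p`. The classes of `±γ` go to elements of finite order, which
a torsion-free target cannot see.

For a one-unit `u = 1 + pa`, the identity log det = tr log (`padicLog_det_one_add`) writes `logDet`
as a series in the traces of the powers of `a` on the regular representation. Such a trace is `|G|`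
times the coefficient at the identity of the image of the trace in the completed group ring of `G`.
After division by `|G|`, each term converges to the corresponding term of `tr_Γ (log u)` as the
kernels shrink, and the coefficients `logCoeff` dominate all the series at once
(`tendsto_logDet_oneUnit`).

Since `Wh^{𝔽_p}(Γ)` is torsion and one-units are exactly what reduction modulo `p` forgets, every
class in `K_T` has a nonzero power represented by a one-unit (`exists_pow_eq_oneUnit`). Hence the
normalised `logDet` converge on all of `K_T`. The limit is a homomorphism with the prescribed
values, and any homomorphism with those values equals this limit. This proves existence and
uniqueness of `log_p det_Γ`.

On the module side, the two hypotheses on `M` make multiplication by `p` bijective, so the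
resolution is exact modulo `p`. It therefore has a homotopy from the identity to `pE` with `E` a
chain map (`ExactMod.exists_homotopy`). In the completion `1 - pE` is invertible, which turns the
homotopy into a contraction and yields acyclicity and the torsion. In a finite quotient the same
homotopy shows that the homology `H` of the coinvariants satisfies `H = pH`, so it is finite by
Nakayama.

Finally, Smith normal form computes the determinant of `∂ + δ` on the coinvariants: up to sign it is
the multiplicative Euler characteristic (`det_oddPart_eq`). Dimension shifting identifies the
homology of the coinvariants with `H_i(Δ, M)`, so `logDet` of any torsion class is `log_p χ(Δ, M)`
(`logDet_isTorsion`). The limit formula follows, and with it independence of all choices, because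
`χ(Δ, M)` knows nothing about the resolution. -/

theorem coe_logCoeff (k : ℕ) :
    ((logCoeff p k : ℤ_[p]) : ℚ_[p]) = (-1) ^ k * p ^ (k + 1) / ((k + 1 : ℕ) : ℚ_[p]) := rfl

theorem summable_norm_logCoeff : Summable fun k => ‖logCoeff p k‖ := by
  have hp : 1 < p := (Fact.out : p.Prime).one_lt
  have key : ∀ k, ‖logCoeff p k‖ ≤ ((k+1 : ℕ) : ℝ) * ((p : ℝ)⁻¹) ^ (k+1) := by
    intro k
    have hk : ((k + 1 : ℕ) : ℚ_[p]) ≠ 0 := by exact_mod_cast Nat.succ_ne_zero k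
    change ‖((-1) ^ k * p ^ (k + 1) / ((k + 1 : ℕ) : ℚ_[p]))‖ ≤ _
    rw [norm_div, norm_mul, norm_pow, norm_neg, norm_one, one_pow, one_mul, norm_pow,
      Padic.norm_p, Padic.norm_eq_zpow_neg_valuation hk, Padic.valuation_natCast,
      zpow_neg, div_inv_eq_mul, zpow_natCast, mul_comm]
    have : p ^ padicValNat p (k+1) ≤ k+1 := Nat.le_of_dvd (Nat.succ_pos k) pow_padicValNat_dvd
    gcongr
    exact_mod_cast this
  have h0 : Summable (fun k : ℕ => (k : ℝ) ^ 1 * ((p : ℝ)⁻¹) ^ k) := by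
    apply summable_pow_mul_geometric_of_norm_lt_one
    rw [Real.norm_of_nonneg (by positivity)]
    exact inv_lt_one_of_one_lt₀ (by exact_mod_cast hp)
  simp only [pow_one] at h0
  exact Summable.of_nonneg_of_le (fun _ => norm_nonneg _) key ((summable_nat_add_iff 1).2 h0)

theorem tendsto_prime_pow : Filter.Tendsto (fun k : ℕ => (p : ℚ_[p]) ^ k) Filter.atTop (𝓝 0) := by
  apply tendsto_pow_atTop_nhds_zero_of_norm_lt_one
  rw [Padic.norm_p]
  exact inv_lt_one_of_one_lt₀ (by exact_mod_cast (Fact.out : p.Prime).one_lt)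

theorem norm_natCast_le_one (n : ℕ) : ‖(n : ℚ_[p])‖ ≤ 1 := by
  simpa using Padic.norm_int_le_one (p := p) (n : ℤ)

/-- Since `p ^ k - 1` tends to `-1` in `ℤ_p`, the limit is the binomial coefficient of `-1`. The
induction uses `(q + 1) C(q, j) = (j + 1) (C(q, j) + C(q, j + 1))` with `q + 1 = p ^ k`, whose left
side tends to zero. -/
theorem tendsto_choose_prime_pow (j : ℕ) :
    Filter.Tendsto (fun k : ℕ => (((p ^ k - 1).choose j : ℕ) : ℚ_[p])) Filter.atTop
      (𝓝 ((-1) ^ j)) := by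
  induction j with
  | zero => simp
  | succ j ih =>
    have hj : ((j + 1 : ℕ) : ℚ_[p]) ≠ 0 := by exact_mod_cast Nat.succ_ne_zero j
    have h1 : ∀ k : ℕ, (((p ^ k - 1).choose (j + 1) : ℕ) : ℚ_[p]) =
        (p : ℚ_[p]) ^ k * (((p ^ k - 1).choose j : ℕ) : ℚ_[p]) / ((j + 1 : ℕ) : ℚ_[p])
          - (((p ^ k - 1).choose j : ℕ) : ℚ_[p]) := by
      intro k
      have hpos : 0 < p ^ k := pow_pos (Fact.out : p.Prime).pos k
      obtain ⟨q, hq⟩ := Nat.exists_eq_succ_of_ne_zero hpos.ne'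
      have e := Nat.add_one_mul_choose_eq q j
      have hq' : (p : ℚ_[p]) ^ k = ((q + 1 : ℕ) : ℚ_[p]) := by exact_mod_cast hq
      have e' : ((q + 1 : ℕ) : ℚ_[p]) * (q.choose j : ℚ_[p])
        = ((q.choose j : ℚ_[p]) + q.choose (j + 1)) * ((j + 1 : ℕ) : ℚ_[p]) := by
        have := congrArg (fun n : ℕ => (n : ℚ_[p])) e
        simpa [Nat.choose_succ_succ] using this
      rw [hq, hq', Nat.succ_sub_one, e', mul_div_assoc, div_self hj]
      ring
    simp only [h1]
    have := ((tendsto_prime_pow (p := p)).mul ih).div_const ((j + 1 : ℕ) : ℚ_[p]) |>.sub ih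
    simpa [pow_succ] using this

/-- The coefficients of `((1 + p X) ^ {p ^ k} - 1) / p ^ k` converge to those of `log (1 + p X)`,
and they do so uniformly. -/
theorem tendsto_binomial_logCoeff (t : ℕ → ℚ_[p]) (ht : ∀ j, ‖t j‖ ≤ 1) :
    Filter.Tendsto (fun k : ℕ => (∑ j ∈ Finset.range (p ^ k),
      ((p ^ k).choose (j + 1) : ℚ_[p]) * p ^ (j + 1) * t j) / p ^ k) Filter.atTop
      (𝓝 (∑' j, ((logCoeff p j : ℤ_[p]) : ℚ_[p]) * t j)) := by
  have hp0 : (p : ℚ_[p]) ≠ 0 := by exact_mod_cast (Fact.out : p.Prime).ne_zero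
  -- Absorption: `C(p ^ k, j + 1) / p ^ k = C(p ^ k - 1, j) / (j + 1)`, so the division by `p ^ k`
  -- costs no uniformity in `k`.
  have hc : ∀ k j : ℕ, ((p ^ k).choose (j + 1) : ℚ_[p]) * p ^ (j + 1) * t j / p ^ k =
      (((p ^ k - 1).choose j : ℕ) : ℚ_[p]) * (p ^ (j + 1) / ((j + 1 : ℕ) : ℚ_[p])) * t j := by
    intro k j
    have hj : ((j + 1 : ℕ) : ℚ_[p]) ≠ 0 := by exact_mod_cast Nat.succ_ne_zero j
    have hpos : 0 < p ^ k := pow_pos (Fact.out : p.Prime).pos k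
    obtain ⟨q, hq⟩ := Nat.exists_eq_succ_of_ne_zero hpos.ne'
    have e := Nat.add_one_mul_choose_eq q j
    have hq' : (p : ℚ_[p]) ^ k = ((q + 1 : ℕ) : ℚ_[p]) := by exact_mod_cast hq
    have hq0 : ((q + 1 : ℕ) : ℚ_[p]) ≠ 0 := by exact_mod_cast Nat.succ_ne_zero q
    have e' : ((q + 1 : ℕ) : ℚ_[p]) * (q.choose j : ℚ_[p])
        = (((q + 1).choose (j + 1) : ℕ) : ℚ_[p]) * ((j + 1 : ℕ) : ℚ_[p]) := by exact_mod_cast e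
    rw [hq, hq', Nat.succ_sub_one, Nat.succ_eq_add_one]
    field_simp
    linear_combination (-1 : ℚ_[p]) * t j * e'
  have hsum : ∀ k : ℕ, (∑ j ∈ Finset.range (p ^ k),
      ((p ^ k).choose (j + 1) : ℚ_[p]) * p ^ (j + 1) * t j) / p ^ k =
      ∑' j, (((p ^ k - 1).choose j : ℕ) : ℚ_[p]) * (p ^ (j + 1) / ((j + 1 : ℕ) : ℚ_[p])) * t j := by
    intro k
    rw [Finset.sum_div, tsum_eq_sum (s := Finset.range (p ^ k))]
    · exact Finset.sum_congr rfl fun j _ => hc k j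
    · intro j hj
      rw [Finset.mem_range, not_lt] at hj
      have hpos : 0 < p ^ k := pow_pos (Fact.out : p.Prime).pos k
      rw [Nat.choose_eq_zero_of_lt (by omega)]
      simp
  simp only [hsum]
  -- Binomial coefficients and the `t j` have norm at most one, so `‖logCoeff p j‖` is a bound
  -- independent of `k`.
  refine tendsto_tsum_of_dominated_convergence (summable_norm_logCoeff (p := p)) (fun j => ?_)
    (Filter.Eventually.of_forall fun k j => ?_)
  · have := ((tendsto_choose_prime_pow (p := p) j).mul_const
      ((p : ℚ_[p]) ^ (j + 1) / ((j + 1 : ℕ) : ℚ_[p]))).mul_const (t j)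
    rw [coe_logCoeff, mul_div_assoc]
    exact this
  · rw [norm_mul, norm_mul]
    have e : ‖logCoeff p j‖ = ‖(p : ℚ_[p]) ^ (j + 1) / ((j + 1 : ℕ) : ℚ_[p])‖ := by
      rw [PadicInt.norm_def, coe_logCoeff, mul_div_assoc, norm_mul]
      simp
    rw [e]
    have h1 := norm_natCast_le_one (p := p) ((p ^ k - 1).choose j)
    have h2 := norm_nonneg ((p : ℚ_[p]) ^ (j + 1) / ((j + 1 : ℕ) : ℚ_[p]))
    calc _ ≤ 1 * ‖(p : ℚ_[p]) ^ (j + 1) / ((j + 1 : ℕ) : ℚ_[p])‖ * 1 := by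
          gcongr
          exact ht j
      _ = _ := by ring

variable {n : Type*} [Fintype n] [DecidableEq n]

/-- The divisibility of `(1 + pX) ^ {p ^ k} - 1` by `p ^ {k + 1}` is proved in the commutative ring
`ℤ_p[X]` and then evaluated at `X = B`. -/
theorem exists_one_add_smul_pow (B : Matrix n n ℤ_[p]) (k : ℕ) :
    ∃ C : Matrix n n ℤ_[p], (1 + (p : ℤ_[p]) • B) ^ p ^ k = 1 + ((p : ℤ_[p]) ^ (k + 1)) • C := by
  have h := dvd_sub_pow_of_dvd_sub (R := Polynomial ℤ_[p]) (p := p)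
    (a := 1 + (p : Polynomial ℤ_[p]) * Polynomial.X) (b := 1) ⟨Polynomial.X, by ring⟩ k
  obtain ⟨Q, hQ⟩ := h
  refine ⟨Polynomial.aeval B Q, ?_⟩
  have := congrArg (Polynomial.aeval B) hQ
  simp only [map_sub, map_pow, map_add, map_one, map_mul, Polynomial.aeval_X, one_pow,
    map_natCast] at this
  rw [sub_eq_iff_eq_add'] at this
  rw [show (p : ℤ_[p]) • B = (p : Matrix n n ℤ_[p]) * B by
    rw [← nsmul_eq_mul, ← Nat.cast_smul_eq_nsmul ℤ_[p]], this]
  rw [← Nat.cast_pow, ← Nat.cast_pow, ← nsmul_eq_mul, ← Nat.cast_smul_eq_nsmul ℤ_[p]]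

theorem one_add_smul_pow_eq (B : Matrix n n ℤ_[p]) (N : ℕ) :
    (1 + (p : ℤ_[p]) • B) ^ N =
      1 + ∑ j ∈ Finset.range N, ((N.choose (j + 1) : ℤ_[p]) * p ^ (j + 1)) • B ^ (j + 1) := by
  rw [add_comm 1 ((p : ℤ_[p]) • B), (Commute.one_right _).add_pow, Finset.sum_range_succ',
    add_comm]
  congr 1
  · simp
  · refine Finset.sum_congr rfl fun j _ => ?_
    rw [one_pow, mul_one, smul_pow, ← (Nat.cast_commute _ _).eq, ← nsmul_eq_mul,
      ← Nat.cast_smul_eq_nsmul ℤ_[p], smul_smul]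

theorem tendsto_trace_pow (B : Matrix n n ℤ_[p]) :
    Filter.Tendsto (fun k : ℕ => ((((1 + (p : ℤ_[p]) • B) ^ p ^ k - 1).trace : ℤ_[p]) : ℚ_[p])
      / p ^ k) Filter.atTop
      (𝓝 (∑' j, ((logCoeff p j : ℤ_[p]) : ℚ_[p]) * (((B ^ (j + 1)).trace : ℤ_[p]) : ℚ_[p]))) := by
  convert tendsto_binomial_logCoeff (p := p) (fun j => (((B ^ (j + 1)).trace : ℤ_[p]) : ℚ_[p]))
    (fun j => by simpa using PadicInt.norm_le_one _) using 3 with k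
  rw [one_add_smul_pow_eq, add_sub_cancel_left, Matrix.trace_sum]
  refine (map_sum (PadicInt.Coe.ringHom (p := p)) _ _).trans ?_
  refine Finset.sum_congr rfl fun j _ => ?_
  rw [Matrix.trace_smul]
  simp only [smul_eq_mul, map_mul, map_natCast, map_pow]
  rfl

theorem exists_det_one_add_smul {R : Type*} [CommRing R] (c : R) (C : Matrix n n R) :
    ∃ r : R, (1 + c • C).det = 1 + C.trace * c + r * c ^ 2 :=
  ⟨_, Matrix.det_one_add_smul c C⟩

/-- The `p ^ k`-th power of `1 + pB` is `1 + p ^ {k + 1} C`, whose determinant is `1 + p ^ {k + 1}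
tr C` up to a multiple of `p ^ {2k + 2}`. After division by `p ^ k` the error tends to zero and only
a trace is left. This gives log det = tr log without eigenvalues or matrix logarithms. -/
theorem tendsto_det_pow (B : Matrix n n ℤ_[p]) :
    Filter.Tendsto (fun k : ℕ =>
      (((1 + (p : ℤ_[p]) • B).det : ℚ_[p]) ^ p ^ k - 1) / (p : ℚ_[p]) ^ k) Filter.atTop
      (𝓝 (∑' j, ((logCoeff p j : ℤ_[p]) : ℚ_[p]) * (((B ^ (j + 1)).trace : ℤ_[p]) : ℚ_[p]))) := by
  have hp0 : (p : ℚ_[p]) ≠ 0 := by exact_mod_cast (Fact.out : p.Prime).ne_zero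
  have key : ∀ k : ℕ, ∃ r : ℤ_[p], (((1 + (p : ℤ_[p]) • B).det : ℚ_[p]) ^ p ^ k - 1)
      / (p : ℚ_[p]) ^ k = ((((1 + (p : ℤ_[p]) • B) ^ p ^ k - 1).trace : ℤ_[p]) : ℚ_[p]) / p ^ k
        + (p : ℚ_[p]) ^ k * p ^ 2 * r := by
    intro k
    obtain ⟨C, hC⟩ := exists_one_add_smul_pow B k
    have h1 : ((1 + (p : ℤ_[p]) • B).det : ℤ_[p]) ^ p ^ k =
        (1 + ((p : ℤ_[p]) ^ (k + 1)) • C).det := by rw [← Matrix.det_pow, hC]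
    obtain ⟨r, hr⟩ := exists_det_one_add_smul ((p : ℤ_[p]) ^ (k + 1)) C
    rw [hr] at h1
    refine ⟨r, ?_⟩
    rw [hC, add_sub_cancel_left, Matrix.trace_smul, ← PadicInt.coe_pow, h1]
    push_cast
    field_simp
    simp only [smul_eq_mul, PadicInt.coe_mul, PadicInt.coe_pow, PadicInt.coe_natCast]
    ring
  choose r hr using key
  simp only [hr]
  have h2 : Filter.Tendsto (fun k : ℕ => (p : ℚ_[p]) ^ k * p ^ 2 * ((r k : ℤ_[p]) : ℚ_[p]))
      Filter.atTop (𝓝 0) := by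
    have h3 : Filter.Tendsto (fun k : ℕ => (p : ℚ_[p]) ^ k * p ^ 2) Filter.atTop (𝓝 0) := by
      simpa using (tendsto_prime_pow (p := p)).mul_const ((p : ℚ_[p]) ^ 2)
    refine squeeze_zero_norm (fun k => ?_) (tendsto_zero_iff_norm_tendsto_zero.1 h3)
    rw [norm_mul]
    exact mul_le_of_le_one_right (norm_nonneg _) (by simpa using PadicInt.norm_le_one (r k))
  simpa using (tendsto_trace_pow B).add h2

/-- Fermat's little theorem in the residue field. -/
theorem exists_unitPart_pow (x : ℚ_[p]) (hx : x ≠ 0) :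
    ∃ b : ℤ_[p], (x * (p : ℚ_[p]) ^ (-x.valuation)) ^ (p - 1) = 1 + p * (b : ℚ_[p]) := by
  have hp0 : (p : ℝ) ≠ 0 := by exact_mod_cast (Fact.out : p.Prime).ne_zero
  have hn : ‖x * (p : ℚ_[p]) ^ (-x.valuation)‖ = 1 := by
    rw [norm_mul, norm_zpow, Padic.norm_p, Padic.norm_eq_zpow_neg_valuation hx, inv_zpow,
      zpow_neg, inv_inv, inv_mul_cancel₀ (zpow_ne_zero _ hp0)]
  set u : ℤ_[p]ˣ := PadicInt.mkUnits hn with hu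
  have h1 : PadicInt.toZMod ((u : ℤ_[p]) ^ (p - 1) - 1) = 0 := by
    rw [map_sub, map_pow, map_one, ZMod.pow_card_sub_one_eq_one, sub_self]
    exact ((Units.map (PadicInt.toZMod (p := p)).toMonoidHom) u).ne_zero
  rw [← RingHom.mem_ker, PadicInt.ker_toZMod, PadicInt.maximalIdeal_eq_span_p,
    Ideal.mem_span_singleton] at h1
  obtain ⟨b, hb⟩ := h1
  refine ⟨b, ?_⟩
  have := congrArg (fun z : ℤ_[p] => (z : ℚ_[p])) hb
  simp only [PadicInt.coe_sub, PadicInt.coe_pow, PadicInt.coe_one, PadicInt.coe_mul,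
    PadicInt.coe_natCast] at this
  rw [← this]
  simp [hu]

theorem tendsto_oneUnit_pow (b : ℤ_[p]) :
    Filter.Tendsto (fun k : ℕ => ((1 + p * (b : ℚ_[p])) ^ p ^ k - 1) / (p : ℚ_[p]) ^ k)
      Filter.atTop
      (𝓝 (∑' j, ((logCoeff p j : ℤ_[p]) : ℚ_[p]) * ((b ^ (j + 1) : ℤ_[p]) : ℚ_[p]))) := by
  have := tendsto_det_pow (p := p) (n := Fin 1) (Matrix.scalar (Fin 1) b)
  have e : ∀ j, ((Matrix.scalar (Fin 1) b) ^ (j + 1)).trace = b ^ (j + 1) := by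
    intro j
    rw [← map_pow]
    simp [Matrix.trace]
  simp only [e] at this
  simpa using this

/-- Describing the logarithm as a limit of difference quotients makes its additivity elementary; no
product of power series is ever formed. -/
theorem tendsto_padicLog (x : ℚ_[p]) (hx : x ≠ 0) :
    Filter.Tendsto (fun k : ℕ =>
      (((x * (p : ℚ_[p]) ^ (-x.valuation)) ^ (p - 1)) ^ p ^ k - 1) / (p : ℚ_[p]) ^ k)
      Filter.atTop (𝓝 (((p : ℚ_[p]) - 1) * padicLog p x)) := by
  obtain ⟨b, hb⟩ := exists_unitPart_pow x hx
  have h1 : ((p : ℚ_[p]) - 1) ≠ 0 := by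
    rw [sub_ne_zero]; exact_mod_cast (Fact.out : p.Prime).ne_one
  have h2 : ((p : ℚ_[p]) - 1) * padicLog p x =
      ∑' j, ((logCoeff p j : ℤ_[p]) : ℚ_[p]) * ((b ^ (j + 1) : ℤ_[p]) : ℚ_[p]) := by
    rw [padicLog, mul_inv_cancel_left₀ h1, ← tsum_neg, hb]
    refine tsum_congr fun j => ?_
    rw [coe_logCoeff]
    push_cast
    rw [show (1 - (1 + (p : ℚ_[p]) * b)) = (-1) * (p * b) by ring, mul_pow, mul_pow]
    ring
  rw [h2, hb]
  exact tendsto_oneUnit_pow b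

theorem padicLog_mul {x y : ℚ_[p]} (hx : x ≠ 0) (hy : y ≠ 0) :
    padicLog p (x * y) = padicLog p x + padicLog p y := by
  have h1 : ((p : ℚ_[p]) - 1) ≠ 0 := by
    rw [sub_ne_zero]; exact_mod_cast (Fact.out : p.Prime).ne_one
  have hp0 : (p : ℚ_[p]) ≠ 0 := by exact_mod_cast (Fact.out : p.Prime).ne_zero
  have tx := tendsto_padicLog x hx
  have ty := tendsto_padicLog y hy
  have txy := tendsto_padicLog (x * y) (mul_ne_zero hx hy)
  -- From `ab - 1 = (a - 1)(b - 1) + (a - 1) + (b - 1)`: divided by `p ^ k`, the cross term is `p ^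
  -- k` times two convergent quotients and disappears in the limit.
  have := (((tendsto_prime_pow (p := p)).mul tx).mul ty).add (tx.add ty)
  rw [zero_mul, zero_mul, zero_add, ← mul_add] at this
  refine mul_left_cancel₀ h1 (tendsto_nhds_unique txy (this.congr fun k => ?_))
  rw [Padic.valuation_mul hx hy, neg_add, zpow_add₀ hp0]
  have hk : (p : ℚ_[p]) ^ k ≠ 0 := pow_ne_zero _ hp0
  rw [show x * y * ((p : ℚ_[p]) ^ (-x.valuation) * (p : ℚ_[p]) ^ (-y.valuation))
    = (x * (p : ℚ_[p]) ^ (-x.valuation)) * (y * (p : ℚ_[p]) ^ (-y.valuation)) by ring]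
  rw [mul_pow, mul_pow]
  field_simp
  ring

theorem padicLog_one : padicLog p (1 : ℚ_[p]) = 0 := by
  have := padicLog_mul (p := p) (one_ne_zero) (one_ne_zero)
  simpa using this

theorem padicLog_neg_one : padicLog p (-1 : ℚ_[p]) = 0 := by
  have h := padicLog_mul (p := p) (x := -1) (y := -1) (by simp) (by simp)
  rw [neg_mul_neg, one_mul, padicLog_one, ← two_mul] at h
  simpa using h.symm

theorem padicLog_neg (x : ℚ_[p]) : padicLog p (-x) = padicLog p x := by
  rcases eq_or_ne x 0 with rfl | hx
  · simp
  · rw [← neg_one_mul, padicLog_mul (by simp) hx, padicLog_neg_one, zero_add]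

/-- Both sides are governed by the limit of `(w ^ {p ^ k} - 1) / p ^ k` for `w = det (1 + pB)`. As
`w` is a one-unit, its valuation is zero and its unit part is `w` itself. -/
theorem padicLog_det_one_add (B : Matrix n n ℤ_[p]) (h0 : ((1 + (p : ℤ_[p]) • B).det : ℚ_[p]) ≠ 0) :
    padicLog p ((1 + (p : ℤ_[p]) • B).det : ℚ_[p]) =
      ∑' j, ((logCoeff p j : ℤ_[p]) : ℚ_[p]) * (((B ^ (j + 1)).trace : ℤ_[p]) : ℚ_[p]) := by
  have h1 : ((p : ℚ_[p]) - 1) ≠ 0 := by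
    rw [sub_ne_zero]; exact_mod_cast (Fact.out : p.Prime).ne_one
  have hp0 : (p : ℚ_[p]) ≠ 0 := by exact_mod_cast (Fact.out : p.Prime).ne_zero
  set w : ℚ_[p] := ((1 + (p : ℤ_[p]) • B).det : ℚ_[p]) with hw
  obtain ⟨c, hc⟩ : ∃ c : ℤ_[p], w = 1 + p * (c : ℚ_[p]) := by
    obtain ⟨r, hr⟩ := exists_det_one_add_smul (p : ℤ_[p]) B
    refine ⟨B.trace + r * p, ?_⟩
    rw [hw, hr]
    push_cast
    ring
  have hv : w.valuation = 0 := by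
    have hn : ‖w‖ = 1 := by
      have hlt : ‖(p : ℚ_[p]) * c‖ < 1 := by
        rw [norm_mul, Padic.norm_p]
        have hi := inv_lt_one_of_one_lt₀
          (show (1 : ℝ) < p by exact_mod_cast (Fact.out : p.Prime).one_lt)
        have hc1 : ‖(c : ℚ_[p])‖ ≤ 1 := by simpa using PadicInt.norm_le_one c
        calc _ ≤ ((p : ℝ)⁻¹) * 1 := by gcongr
          _ < 1 := by simpa using hi
      rw [hc]
      have := Padic.add_eq_max_of_ne (p := p) (q := 1) (r := (p : ℚ_[p]) * c) (by
        rw [norm_one]; exact hlt.ne')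
      rw [this, norm_one, max_eq_left hlt.le]
    rw [Padic.norm_eq_zpow_neg_valuation h0, zpow_eq_one_iff_right₀ (by positivity)
      (by exact_mod_cast (Fact.out : p.Prime).ne_one)] at hn
    simpa using hn
  have t1 := tendsto_padicLog w h0
  rw [hv] at t1
  simp only [neg_zero, zpow_zero, mul_one] at t1
  obtain ⟨b, hb⟩ := exists_unitPart_pow w h0
  have h2 := tendsto_det_pow B
  rw [← hw] at h2
  -- Taken at `N = p - 1`, this cancels the factor `(p - 1)⁻¹` in the definition of `padicLog`.
  have hadd : ∀ N : ℕ, Filter.Tendsto (fun k : ℕ => ((w ^ N) ^ p ^ k - 1) / (p : ℚ_[p]) ^ k)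
      Filter.atTop (𝓝 (N * ∑' j, ((logCoeff p j : ℤ_[p]) : ℚ_[p]) *
        (((B ^ (j + 1)).trace : ℤ_[p]) : ℚ_[p]))) := by
    intro N
    induction N with
    | zero => simp
    | succ N ih =>
      have := (((tendsto_prime_pow (p := p)).mul ih).mul h2).add (ih.add h2)
      rw [zero_mul, zero_mul, zero_add] at this
      have e : ((N + 1 : ℕ) : ℚ_[p]) * (∑' j, ((logCoeff p j : ℤ_[p]) : ℚ_[p]) *
        (((B ^ (j + 1)).trace : ℤ_[p]) : ℚ_[p])) = N * (∑' j, ((logCoeff p j : ℤ_[p]) : ℚ_[p]) *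
        (((B ^ (j + 1)).trace : ℤ_[p]) : ℚ_[p])) + ∑' j, ((logCoeff p j : ℤ_[p]) : ℚ_[p]) *
        (((B ^ (j + 1)).trace : ℤ_[p]) : ℚ_[p]) := by push_cast; ring
      rw [e]
      refine this.congr fun k => ?_
      have hk : (p : ℚ_[p]) ^ k ≠ 0 := pow_ne_zero _ hp0
      rw [pow_succ w N, mul_pow]
      field_simp
      ring
  have h3 := tendsto_nhds_unique t1 (hadd (p - 1))
  rw [Nat.cast_sub (Fact.out : p.Prime).one_le, Nat.cast_one] at h3
  exact mul_left_cancel₀ h1 h3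

end Log

end

end PadicTorsion

namespace PadicTorsion

open scoped Topology

noncomputable section

/-! ### Homomorphisms out of `GL_∞` and `K₁` -/

section GLInf

variable {R : Type*} [Ring R]

/-- The canonical map `GL_n(R) → GL_∞(R)`. -/
def GLInf.of (n : ℕ) : (Matrix (Fin n) (Fin n) R)ˣ →* GLInf R where
  toFun A := ⟦⟨n, A⟩⟧
  map_one' := (DirectLimit.one_def (f := fun n m h => stab R n m h) n).symm
  map_mul' A B := (DirectLimit.mul_def (f := fun n m h => stab R n m h) n A B).symm

theorem GLInf.of_stab {n m : ℕ} (h : n ≤ m) (A : (Matrix (Fin n) (Fin n) R)ˣ) :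
    GLInf.of m (stab R n m h A) = GLInf.of n A :=
  (DirectLimit.eq_of_le (F := fun n => (Matrix (Fin n) (Fin n) R)ˣ)
    (f := fun n m h => stab R n m h) ⟨n, A⟩ m h).symm

theorem GLInf.exists_of (x : GLInf R) : ∃ n A, GLInf.of n A = x := by
  induction x using DirectLimit.induction with
  | _ n A => exact ⟨n, A, rfl⟩

theorem GLInf.of_eq_one {n : ℕ} {A : (Matrix (Fin n) (Fin n) R)ˣ} (h : GLInf.of n A = 1) :
    ∃ (m : ℕ) (hm : n ≤ m), stab R n m hm A = 1 :=
  (DirectLimit.exists_eq_one (G := fun n => (Matrix (Fin n) (Fin n) R)ˣ)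
    (f := fun n m h => stab R n m h) ⟨n, A⟩).1 h

/-- Homomorphisms out of `GL_∞(R)`. -/
def GLInf.lift {H : Type*} [Monoid H] (g : ∀ n, (Matrix (Fin n) (Fin n) R)ˣ →* H)
    (hg : ∀ n m h A, g m (stab R n m h A) = g n A) : GLInf R →* H where
  toFun := DirectLimit.lift _ (fun n A => g n A) (fun n m h A => (hg n m h A).symm)
  map_one' := by
    rw [DirectLimit.one_def 0, DirectLimit.lift_def, map_one]
  map_mul' x y := by
    induction x, y using DirectLimit.induction₂ with
    | _ n A B => rw [DirectLimit.mul_def, DirectLimit.lift_def, DirectLimit.lift_def,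
        DirectLimit.lift_def, map_mul]

variable {S : Type*} [Ring S]

theorem map_stabMatrix (f : R →+* S) {n : ℕ} (m : ℕ) (A : Matrix (Fin n) (Fin n) R) :
    f.mapMatrix (stabMatrix R m A) = stabMatrix S m (f.mapMatrix A) := by
  ext i j
  simp only [stabMatrix, RingHom.mapMatrix_apply, Matrix.map_apply]
  split_ifs <;> simp

/-- Functoriality of `GL_n`. -/
def mapGL (f : R →+* S) (n : ℕ) : (Matrix (Fin n) (Fin n) R)ˣ →* (Matrix (Fin n) (Fin n) S)ˣ :=
  Units.map (f.mapMatrix (m := Fin n)).toMonoidHom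

theorem mapGL_stab (f : R →+* S) {n m : ℕ} (h : n ≤ m) (A : (Matrix (Fin n) (Fin n) R)ˣ) :
    mapGL f m (stab R n m h A) = stab S n m h (mapGL f n A) :=
  Units.ext (map_stabMatrix f m _)

/-- Functoriality of `GL_∞`. -/
def GLInf.map (f : R →+* S) : GLInf R →* GLInf S :=
  GLInf.lift (fun n => (GLInf.of n).comp (mapGL f n)) fun n m h A => by
    simp only [MonoidHom.comp_apply, mapGL_stab, GLInf.of_stab]

theorem GLInf.map_of (f : R →+* S) (n : ℕ) (A : (Matrix (Fin n) (Fin n) R)ˣ) :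
    GLInf.map f (GLInf.of n A) = GLInf.of n (mapGL f n A) := rfl

theorem GLInf.map_surjective (f : R →+* S) (hf : ∀ n, Function.Surjective (mapGL f n)) :
    Function.Surjective (GLInf.map f) := by
  intro y
  obtain ⟨n, B, rfl⟩ := GLInf.exists_of y
  obtain ⟨A, rfl⟩ := hf n B
  exact ⟨GLInf.of n A, rfl⟩

/-- `1 × 1` matrices. -/
def unitGL : Rˣ →* (Matrix (Fin 1) (Fin 1) R)ˣ :=
  Units.map (Matrix.scalar (Fin 1) : R →+* Matrix (Fin 1) (Fin 1) R).toMonoidHom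

theorem KOne.ofUnit_eq (u : Rˣ) : KOne.ofUnit u = Abelianization.of (GLInf.of 1 (unitGL u)) := rfl

theorem KOne.ofUnit_mul (u v : Rˣ) : KOne.ofUnit (u * v) = KOne.ofUnit u * KOne.ofUnit v := by
  simp only [KOne.ofUnit_eq, map_mul]

theorem KOne.ofUnit_inv (u : Rˣ) : KOne.ofUnit u⁻¹ = (KOne.ofUnit u)⁻¹ := by
  simp only [KOne.ofUnit_eq, map_inv]

theorem KOne.ofUnit_pow (u : Rˣ) (n : ℕ) : KOne.ofUnit (u ^ n) = KOne.ofUnit u ^ n := by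
  simp only [KOne.ofUnit_eq, map_pow]

theorem mapGL_unitGL (f : R →+* S) (u : Rˣ) :
    mapGL f 1 (unitGL u) = unitGL (Units.map f.toMonoidHom u) := by
  ext i j
  fin_cases i; fin_cases j
  simp [mapGL, unitGL]

end GLInf

/-! ### Lifting along `\widehat{ℤΓ} → 𝔽_p Γ` -/

section Lifting

variable {p : ℕ} {Γ : Type*} [Group Γ]

/-- Reduction modulo `pⁿ`. -/
def evHat (p : ℕ) (Γ : Type*) [Group Γ] (n : ℕ) :
    GroupRingHat p Γ →+* MonoidAlgebra (ZMod (p ^ n)) Γ :=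
  (Pi.evalRingHom _ n).comp (completionSubring p Γ).subtype

theorem evHat_apply (n : ℕ) (x : GroupRingHat p Γ) : evHat p Γ n x = x.1 n := rfl

theorem evHat_ext {x y : GroupRingHat p Γ} (h : ∀ n, evHat p Γ n x = evHat p Γ n y) : x = y :=
  Subtype.ext (funext h)

theorem evHat_prime_pow (n : ℕ) : evHat p Γ n ((p : GroupRingHat p Γ) ^ n) = 0 := by
  rw [map_pow, map_natCast, ← Nat.cast_pow]
  have := map_natCast (MonoidAlgebra.singleOneRingHom (R := ZMod (p ^ n)) (M := Γ)) (p ^ n)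
  rw [← this]
  simp

/-- The limit of a sequence that is stationary modulo each `pⁿ`. -/
def limHat (s : ℕ → GroupRingHat p Γ)
    (hs : ∀ m n, m ≤ n → evHat p Γ m (s n) = evHat p Γ m (s m)) : GroupRingHat p Γ :=
  ⟨fun n => (s n).1 n, fun m n h => ((s n).2 m n h).trans (hs m n h)⟩

variable {r : ℕ}

theorem evHat_smul_pow {m n : ℕ} (h : m ≤ n) (a : Matrix (Fin r) (Fin r) (GroupRingHat p Γ)) :
    (evHat p Γ m).mapMatrix ((-((p : GroupRingHat p Γ) • a)) ^ n) = 0 := by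
  obtain ⟨c, rfl⟩ := Nat.exists_eq_add_of_le h
  have e : ∀ N : ℕ, (-((p : GroupRingHat p Γ) • a)) ^ N = (p : GroupRingHat p Γ) ^ N • (-a) ^ N := by
    intro N
    rw [← smul_neg, Nat.cast_smul_eq_nsmul, smul_pow, ← Nat.cast_pow, Nat.cast_smul_eq_nsmul]
  rw [pow_add, map_mul, e]
  suffices (evHat p Γ m).mapMatrix ((p : GroupRingHat p Γ) ^ m • (-a) ^ m) = 0 by
    rw [this, zero_mul]
  ext1 i j
  simp only [RingHom.mapMatrix_apply, Matrix.map_apply, Matrix.smul_apply, smul_eq_mul, map_mul]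
  rw [evHat_prime_pow, zero_mul, Matrix.zero_apply]

/-- Geometric series: modulo `p ^ n` only its first `n` terms survive, so the truncations glue to an
element of the inverse limit, which is a two-sided inverse. -/
theorem isUnit_one_add_smul (a : Matrix (Fin r) (Fin r) (GroupRingHat p Γ)) :
    IsUnit (1 + (p : GroupRingHat p Γ) • a) := by
  set x : Matrix (Fin r) (Fin r) (GroupRingHat p Γ) := -((p : GroupRingHat p Γ) • a) with hx
  let s : ℕ → Matrix (Fin r) (Fin r) (GroupRingHat p Γ) := fun n => ∑ k ∈ Finset.range n, x ^ k
  have hs : ∀ m n, m ≤ n → (evHat p Γ m).mapMatrix (s n) = (evHat p Γ m).mapMatrix (s m) := by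
    intro m n h
    obtain ⟨c, rfl⟩ := Nat.exists_eq_add_of_le h
    simp only [s, Finset.sum_range_add, map_add, add_eq_left]
    rw [map_sum]
    exact Finset.sum_eq_zero fun k _ => evHat_smul_pow (Nat.le_add_right m k) a
  let b : Matrix (Fin r) (Fin r) (GroupRingHat p Γ) := fun i j =>
    limHat (fun n => s n i j) fun m n h => congrFun (congrFun (hs m n h) i) j
  have hb : ∀ n, (evHat p Γ n).mapMatrix b = (evHat p Γ n).mapMatrix (s n) := fun n => rfl
  have ext : ∀ y z : Matrix (Fin r) (Fin r) (GroupRingHat p Γ),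
      (∀ n, (evHat p Γ n).mapMatrix y = (evHat p Γ n).mapMatrix z) → y = z := by
    intro y z h
    ext1 i j
    exact evHat_ext fun n => congrFun (congrFun (h n) i) j
  have hu : 1 + (p : GroupRingHat p Γ) • a = 1 - x := by rw [hx, sub_neg_eq_add]
  rw [hu]
  refine ⟨⟨1 - x, b, ext _ _ fun n => ?_, ext _ _ fun n => ?_⟩, rfl⟩
  · rw [map_mul, hb, ← map_mul]
    simp only [s]
    rw [mul_neg_geom_sum, map_sub, evHat_smul_pow le_rfl, sub_zero]
  · rw [map_mul, hb, ← map_mul]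
    simp only [s]
    rw [geom_sum_mul_neg, map_sub, evHat_smul_pow le_rfl, sub_zero]

variable [Fact p.Prime]

theorem coeffHat_ext {x y : GroupRingHat p Γ} (h : ∀ γ, coeffHat γ x = coeffHat γ y) : x = y := by
  refine evHat_ext fun n => ?_
  ext γ
  rw [evHat_apply, evHat_apply, ← toZModPow_coeffHat, ← toZModPow_coeffHat, h]

/-- The coefficient at `γ` as an additive map. -/
def coeffHatHom (γ : Γ) : GroupRingHat p Γ →+ ℤ_[p] where
  toFun := coeffHat γ
  map_zero' := PadicInt.ext_of_toZModPow.1 fun n => by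
    rw [toZModPow_coeffHat, map_zero]; rfl
  map_add' x y := PadicInt.ext_of_toZModPow.1 fun n => by
    rw [map_add, toZModPow_coeffHat, toZModPow_coeffHat, toZModPow_coeffHat]; rfl

theorem coeffHatHom_apply (γ : Γ) (x : GroupRingHat p Γ) : coeffHatHom γ x = coeffHat γ x := rfl

theorem coeffHat_natCast_mul (γ : Γ) (n : ℕ) (x : GroupRingHat p Γ) :
    coeffHat γ ((n : GroupRingHat p Γ) * x) = n * coeffHat γ x := by
  rw [← nsmul_eq_mul, ← coeffHatHom_apply, map_nsmul, nsmul_eq_mul, coeffHatHom_apply]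

/-- The element `∑ c_γ γ` for a family `c` tending to zero. -/
def ofCoeffHat (c : Γ → ℤ_[p])
    (hc : ∀ n, {γ | PadicInt.toZModPow n (c γ) ≠ 0}.Finite) : GroupRingHat p Γ :=
  ⟨fun n => MonoidAlgebra.ofCoeff
      (Finsupp.ofSupportFinite (fun γ => PadicInt.toZModPow n (c γ)) (hc n)), fun m n h => by
    ext γ
    simp only [reduction, MonoidAlgebra.coeff_mapRingHom, ZMod.castHom_apply]
    exact PadicInt.cast_toZModPow m n h (c γ)⟩

theorem coeffHat_ofCoeffHat (c : Γ → ℤ_[p])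
    (hc : ∀ n, {γ | PadicInt.toZModPow n (c γ) ≠ 0}.Finite) (γ : Γ) :
    coeffHat γ (ofCoeffHat c hc) = c γ := by
  refine PadicInt.ext_of_toZModPow.1 fun n => ?_
  rw [toZModPow_coeffHat]
  rfl

/-- Reduction `\widehat{ℤΓ} → 𝔽_p Γ`. -/
def redHat (p : ℕ) [Fact p.Prime] (Γ : Type*) [Group Γ] :
    GroupRingHat p Γ →+* MonoidAlgebra (ZMod p) Γ :=
  (MonoidAlgebra.mapRingHom Γ (ZMod.castHom (dvd_of_eq (pow_one p).symm) (ZMod p))).comp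
    (evHat p Γ 1)

theorem redHat_toHat_single (γ : Γ) (n : ℤ) :
    redHat p Γ (toHat p Γ (MonoidAlgebra.single γ n)) = MonoidAlgebra.single γ (n : ZMod p) := by
  change (MonoidAlgebra.mapRingHom Γ (ZMod.castHom (dvd_of_eq (pow_one p).symm) (ZMod p)))
    (MonoidAlgebra.mapRingHom Γ (Int.castRingHom (ZMod (p ^ 1))) _) = _
  simp

theorem redHat_surjective : Function.Surjective (redHat p Γ) := by
  intro y
  refine ⟨toHat p Γ (MonoidAlgebra.ofCoeff
    (y.coeff.mapRange (fun a => (a.val : ℤ)) (by simp))), ?_⟩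
  change (MonoidAlgebra.mapRingHom Γ (ZMod.castHom (dvd_of_eq (pow_one p).symm) (ZMod p)))
    (MonoidAlgebra.mapRingHom Γ (Int.castRingHom (ZMod (p ^ 1))) _) = _
  ext γ
  simp

/-- Division by `p` is carried out coefficient by coefficient; the point to check is that the
quotients still tend to zero. -/
theorem exists_eq_mul_of_redHat_eq_zero {x : GroupRingHat p Γ} (hx : redHat p Γ x = 0) :
    ∃ y, x = (p : GroupRingHat p Γ) * y := by
  have hp0 : (p : ℤ_[p]) ≠ 0 := by exact_mod_cast (Fact.out : p.Prime).ne_zero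
  have h1 : ∀ γ, ∃ c : ℤ_[p], coeffHat γ x = p * c := by
    intro γ
    have h2 : PadicInt.toZModPow 1 (coeffHat γ x) = 0 := by
      rw [toZModPow_coeffHat]
      have h3 := congrArg (fun z => MonoidAlgebra.coeff z γ) hx
      have h4 : ZMod.castHom (dvd_of_eq (pow_one p).symm) (ZMod p) ((x.1 1).coeff γ) = 0 := by
        simpa [redHat, evHat_apply] using h3
      have hinj : Function.Injective (ZMod.castHom (dvd_of_eq (pow_one p).symm) (ZMod p)) :=
        ((Fintype.bijective_iff_surjective_and_card _).2
          ⟨ZMod.castHom_surjective _, by simp [ZMod.card]⟩).1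
      exact (map_eq_zero_iff _ hinj).1 h4
    rw [← RingHom.mem_ker, PadicInt.ker_toZModPow, pow_one, Ideal.mem_span_singleton] at h2
    exact h2
  choose c hc using h1
  have hfin : ∀ n, {γ | PadicInt.toZModPow n (c γ) ≠ 0}.Finite := by
    intro n
    -- A quotient that is nonzero modulo `p ^ n` comes from a coefficient of `x` that is nonzero
    -- modulo `p ^ {n + 1}`, hence the shift of level.
    refine (x.1 (n + 1)).coeff.hasFiniteSupport.subset fun γ hγ h0 => hγ ?_
    rw [← toZModPow_coeffHat, hc, ← RingHom.mem_ker, PadicInt.ker_toZModPow,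
      Ideal.mem_span_singleton, pow_succ', mul_dvd_mul_iff_left hp0] at h0
    rwa [← RingHom.mem_ker, PadicInt.ker_toZModPow, Ideal.mem_span_singleton]
  refine ⟨ofCoeffHat c hfin, coeffHat_ext fun γ => ?_⟩
  rw [coeffHat_natCast_mul, coeffHat_ofCoeffHat, hc]

theorem exists_eq_one_add_smul {u : Matrix (Fin r) (Fin r) (GroupRingHat p Γ)}
    (hu : (redHat p Γ).mapMatrix u = 1) :
    ∃ a, u = 1 + (p : GroupRingHat p Γ) • a := by
  have h : ∀ i j, ∃ y, (u - 1) i j = (p : GroupRingHat p Γ) * y := fun i j =>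
    exists_eq_mul_of_redHat_eq_zero (by
      have : (redHat p Γ).mapMatrix (u - 1) = 0 := by rw [map_sub, hu, map_one, sub_self]
      exact congrFun (congrFun this i) j)
  choose a ha using h
  refine ⟨a, ?_⟩
  rw [← sub_eq_iff_eq_add']
  ext1 i j
  exact ha i j

/-- Arbitrary lifts `D` of `B` and `E` of `B⁻¹` have products `DE` and `ED` that are one-units,
hence invertible. So `D` has a right and a left inverse, and these coincide. -/
theorem mapGL_redHat_surjective (n : ℕ) : Function.Surjective (mapGL (redHat p Γ) n) := by
  intro B
  have lift : ∀ C : Matrix (Fin n) (Fin n) (MonoidAlgebra (ZMod p) Γ),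
      ∃ D, (redHat p Γ).mapMatrix D = C := fun C => by
    choose D hD using fun i j => redHat_surjective (p := p) (C i j)
    exact ⟨D, by ext1 i j; exact hD i j⟩
  obtain ⟨D, hD⟩ := lift B
  obtain ⟨E, hE⟩ := lift (B⁻¹ : (Matrix (Fin n) (Fin n) (MonoidAlgebra (ZMod p) Γ))ˣ)
  obtain ⟨a, ha⟩ := exists_eq_one_add_smul (u := D * E) (by rw [map_mul, hD, hE, Units.mul_inv])
  obtain ⟨b, hb⟩ := exists_eq_one_add_smul (u := E * D) (by rw [map_mul, hD, hE, Units.inv_mul])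
  obtain ⟨c, hc⟩ := (isUnit_one_add_smul a).exists_right_inv
  obtain ⟨d, hd⟩ := (isUnit_one_add_smul b).exists_left_inv
  rw [← ha, mul_assoc] at hc
  rw [← hb, ← mul_assoc] at hd
  have : E * c = d * E := by
    rw [← one_mul (E * c), ← hd, mul_assoc (d * E), hc, mul_one]
  exact ⟨⟨D, E * c, hc, by rw [this, hd]⟩, Units.ext hD⟩

end Lifting

/-! ### Powers of elements of `K_T` are represented by one-units -/

section OneUnits

variable {p : ℕ} [Fact p.Prime] {Γ : Type*} [Group Γ]

/-- The unit `γ` of a group ring. -/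
def groupUnit (R : Type*) [Ring R] (Γ : Type*) [Group Γ] : Γ →* (MonoidAlgebra R Γ)ˣ :=
  (Units.map (MonoidAlgebra.of R Γ)).comp toUnits.toMonoidHom

theorem coe_groupUnit (R : Type*) [Ring R] (γ : Γ) :
    (groupUnit R Γ γ : MonoidAlgebra R Γ) = MonoidAlgebra.single γ 1 := rfl

/-- The exponent `p - 1` removes the scalars from `𝔽_pˣ`. What remains is a group element, which,
unlike a general scalar, lifts to a unit that is trivial in `K_T`. -/
theorem exists_pow_eq_groupUnit {y : KOne (MonoidAlgebra (ZMod p) Γ)}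
    (hy : y ∈ Subgroup.closure (KOne.ofUnit '' {u : (MonoidAlgebra (ZMod p) Γ)ˣ |
      ∃ (ζ : (ZMod p)ˣ) (γ : Γ),
        (u : MonoidAlgebra (ZMod p) Γ) = MonoidAlgebra.single γ (ζ : ZMod p)})) :
    ∃ γ : Γ, y ^ (p - 1) = KOne.ofUnit (groupUnit (ZMod p) Γ γ) := by
  induction hy using Subgroup.closure_induction with
  | mem x hx =>
    obtain ⟨u, ⟨ζ, γ, hu⟩, rfl⟩ := hx
    refine ⟨γ ^ (p - 1), ?_⟩
    rw [← KOne.ofUnit_pow]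
    congr 1
    ext1
    rw [Units.val_pow_eq_pow_val, hu, MonoidAlgebra.single_pow, coe_groupUnit,
      ZMod.pow_card_sub_one_eq_one ζ.ne_zero]
  | one => exact ⟨1, by rw [one_pow, map_one]; simp [KOne.ofUnit_eq]⟩
  | mul x y _ _ hx hy =>
    obtain ⟨γ, hγ⟩ := hx
    obtain ⟨γ', hγ'⟩ := hy
    exact ⟨γ * γ', by rw [mul_pow, hγ, hγ', map_mul, KOne.ofUnit_mul]⟩
  | inv x _ hx =>
    obtain ⟨γ, hγ⟩ := hx
    exact ⟨γ⁻¹, by rw [inv_pow, hγ, map_inv, KOne.ofUnit_inv]⟩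

theorem KTHat.mk_eq {r : ℕ} (u : (Matrix (Fin r) (Fin r) (GroupRingHat p Γ))ˣ) :
    KTHat.mk u = QuotientGroup.mk (Abelianization.of (GLInf.of r u)) := rfl

/-- Some power of each element of `K_T(\widehat{ℤΓ})` is the class of a one-unit. -/
theorem exists_pow_eq_oneUnit (hWh : IsMulTorsion (WhMod p Γ)) (x : KTHat p Γ) :
    ∃ (N : ℕ) (r : ℕ) (a : Matrix (Fin r) (Fin r) (GroupRingHat p Γ))
      (u : (Matrix (Fin r) (Fin r) (GroupRingHat p Γ))ˣ), N ≠ 0 ∧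
      (u : Matrix (Fin r) (Fin r) (GroupRingHat p Γ)) = 1 + (p : GroupRingHat p Γ) • a ∧
      x ^ N = KTHat.mk u := by
  obtain ⟨y, rfl⟩ := QuotientGroup.mk_surjective x
  obtain ⟨g, rfl⟩ : ∃ g, Abelianization.of g = y := QuotientGroup.mk_surjective y
  have hp := (Fact.out : p.Prime).one_lt
  obtain ⟨N, hN, hNx⟩ := (hWh (QuotientGroup.mk
    (Abelianization.of (GLInf.map (redHat p Γ) g)))).exists_pow_eq_one
  rw [← QuotientGroup.mk_pow, QuotientGroup.eq_one_iff] at hNx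
  obtain ⟨γ, hγ⟩ := exists_pow_eq_groupUnit hNx
  -- The lift of `γ` to the completion: its class in `K_T` is trivial, so dividing `g ^ M` by it
  -- does not change the class while making the reduction trivial in `K₁`.
  let c : (GroupRingHat p Γ)ˣ := Units.map (toHat p Γ).toMonoidHom (groupUnit ℤ Γ γ)
  have hc : GLInf.map (redHat p Γ) (GLInf.of 1 (unitGL c)) =
      GLInf.of 1 (unitGL (groupUnit (ZMod p) Γ γ)) := by
    rw [GLInf.map_of, mapGL_unitGL]
    congr 2
    ext1
    change redHat p Γ (toHat p Γ (MonoidAlgebra.single γ 1)) = MonoidAlgebra.single γ 1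
    rw [redHat_toHat_single, Int.cast_one]
  rw [KOne.ofUnit_eq, ← hc, ← pow_mul, ← map_pow, ← map_pow] at hγ
  set M := N * (p - 1)
  have hcomm : GLInf.map (redHat p Γ) (g ^ M * (GLInf.of 1 (unitGL c))⁻¹) ∈
      commutator (GLInf (MonoidAlgebra (ZMod p) Γ)) := by
    rw [← Abelianization.ker_of, MonoidHom.mem_ker, map_mul, map_mul, map_inv, map_inv, hγ,
      mul_inv_cancel]
  -- Since `GL_∞` surjects under reduction, the commutator that trivialises the reduction lifts to a
  -- commutator upstairs.
  have hmap : commutator (GLInf (MonoidAlgebra (ZMod p) Γ)) =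
      (commutator (GLInf (GroupRingHat p Γ))).map (GLInf.map (redHat p Γ)) := by
    rw [commutator_def, commutator_def, Subgroup.map_commutator, Subgroup.map_top_of_surjective _
      (GLInf.map_surjective _ mapGL_redHat_surjective)]
  rw [hmap] at hcomm
  obtain ⟨d, hd, hdg⟩ := hcomm
  obtain ⟨n, V, hV⟩ := GLInf.exists_of (d⁻¹ * (g ^ M * (GLInf.of 1 (unitGL c))⁻¹))
  have h1 : GLInf.of n (mapGL (redHat p Γ) n V) = 1 := by
    rw [← GLInf.map_of, hV, map_mul, map_inv, hdg, inv_mul_cancel]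
  -- Being trivial in the direct limit means being the identity matrix after stabilisation, so the
  -- stabilised lift is a genuine one-unit.
  obtain ⟨m, hm, h2⟩ := GLInf.of_eq_one h1
  rw [← mapGL_stab] at h2
  obtain ⟨a, ha⟩ := exists_eq_one_add_smul (congrArg Units.val h2)
  refine ⟨M, m, a, stab _ n m hm V, Nat.mul_ne_zero hN.ne' (by omega), ha, ?_⟩
  rw [KTHat.mk_eq, GLInf.of_stab, hV, ← QuotientGroup.mk_pow, ← map_pow]
  have h3 : (Abelianization.of d) = 1 := by rwa [← MonoidHom.mem_ker, Abelianization.ker_of]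
  rw [map_mul, map_mul, map_inv, map_inv, h3, inv_one, one_mul, QuotientGroup.mk_mul]
  have h4 : (QuotientGroup.mk (Abelianization.of (GLInf.of 1 (unitGL c)))⁻¹ : KTHat p Γ) = 1 := by
    rw [QuotientGroup.eq_one_iff]
    exact inv_mem (Subgroup.subset_closure ⟨c, ⟨γ, Or.inl rfl⟩, rfl⟩)
  rw [h4, mul_one]

end OneUnits

end

end PadicTorsion

namespace PadicTorsion

open scoped Topology

noncomputable section

/-! ### Regular representations of finite quotients -/

section Regular

variable (R : Type*) [CommRing R] (G : Type*) [Group G] [Fintype G] [DecidableEq G]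

/-- The matrix `(g, h) ↦ x_{g⁻¹h}` of the right multiplication by `x` on the group ring of a finite
group, acting on row vectors. -/
def regMat : MonoidAlgebra R G →+* Matrix G G R :=
  (MonoidAlgebra.lift R (Matrix G G R) G
    { toFun := fun k => Matrix.of fun g h => if g * k = h then 1 else 0
      map_one' := by ext g h; simp [Matrix.one_apply]
      map_mul' := fun k l => by
        ext g h
        simp only [Matrix.mul_apply, Matrix.of_apply]
        rw [Finset.sum_eq_single (g * k) (fun b _ hb => by simp [Ne.symm hb]) (by simp)]
        simp [mul_assoc] }).toRingHom

theorem regMat_apply (x : MonoidAlgebra R G) (g h : G) : regMat R G x g h = x.coeff (g⁻¹ * h) := by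
  induction x using MonoidAlgebra.induction_linear with
  | zero => simp
  | add x y hx hy => simp [hx, hy]
  | single k r =>
    simp only [regMat, AlgHom.toRingHom_eq_coe, RingHom.coe_coe, MonoidAlgebra.lift_single,
      MonoidHom.coe_mk, OneHom.coe_mk, Matrix.smul_apply, Matrix.of_apply, smul_eq_mul,
      MonoidAlgebra.coeff_single, Finsupp.single_apply, eq_inv_mul_iff_mul_eq]
    simp

variable {R G}

theorem regMat_map {S : Type*} [CommRing S] (f : R →+* S) (x : MonoidAlgebra R G) :
    regMat S G (MonoidAlgebra.mapRingHom G f x) = (regMat R G x).map f := by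
  ext g h
  simp [regMat_apply]

end Regular

section RhoHat

variable {p : ℕ} {Γ : Type*} [Group Γ] {G : Type*} [Group G]

/-- Functoriality of the completed group ring. -/
def mapHat (p : ℕ) (π : Γ →* G) : GroupRingHat p Γ →+* GroupRingHat p G :=
  RingHom.codRestrict
    (RingHom.pi fun n => (MonoidAlgebra.mapDomainRingHom (ZMod (p ^ n)) π).comp (evHat p Γ n))
    (completionSubring p G) fun x m n h => by
      change reduction p G h (MonoidAlgebra.mapDomainRingHom _ π (x.1 n)) =
        MonoidAlgebra.mapDomainRingHom _ π (x.1 m)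
      rw [← x.2 m n h]
      exact RingHom.congr_fun (MonoidAlgebra.mapRingHom_comp_mapDomainRingHom _ _) _

theorem mapHat_val (π : Γ →* G) (x : GroupRingHat p Γ) (n : ℕ) :
    (mapHat p π x).1 n = MonoidAlgebra.mapDomainRingHom (ZMod (p ^ n)) π (x.1 n) := rfl

variable [Fact p.Prime] [Fintype G] [DecidableEq G]

theorem toZModPow_coeffHat_mapHat (π : Γ →* G) (x : GroupRingHat p Γ) (g h : G) (n : ℕ) :
    PadicInt.toZModPow n (coeffHat (g⁻¹ * h) (mapHat p π x)) =
      regMat (ZMod (p ^ n)) G (MonoidAlgebra.mapDomainRingHom (ZMod (p ^ n)) π (x.1 n)) g h := by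
  rw [toZModPow_coeffHat, regMat_apply, mapHat_val]

/-- The representation of the completed group ring of `Γ` on the regular representation of a finite
quotient `G` of `Γ`. -/
def rhoHat (p : ℕ) [Fact p.Prime] (π : Γ →* G) : GroupRingHat p Γ →+* Matrix G G ℤ_[p] where
  toFun x := Matrix.of fun g h => coeffHat (g⁻¹ * h) (mapHat p π x)
  map_one' := by
    ext1 g h
    refine PadicInt.ext_of_toZModPow.1 fun n => ?_
    rw [Matrix.of_apply, toZModPow_coeffHat_mapHat,
      show (1 : GroupRingHat p Γ).1 n = 1 from rfl, map_one, map_one]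
    simp only [Matrix.one_apply]
    split_ifs <;> simp
  map_zero' := by
    ext1 g h
    refine PadicInt.ext_of_toZModPow.1 fun n => ?_
    rw [Matrix.of_apply, toZModPow_coeffHat_mapHat,
      show (0 : GroupRingHat p Γ).1 n = 0 from rfl, map_zero, map_zero]
    simp
  map_add' x y := by
    ext1 g h
    refine PadicInt.ext_of_toZModPow.1 fun n => ?_
    rw [Matrix.add_apply, Matrix.of_apply, Matrix.of_apply, Matrix.of_apply, map_add (PadicInt.toZModPow n),
      toZModPow_coeffHat_mapHat,
      toZModPow_coeffHat_mapHat, toZModPow_coeffHat_mapHat,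
      show (x + y).1 n = x.1 n + y.1 n from rfl, map_add, map_add, Matrix.add_apply]
  map_mul' x y := by
    ext1 g h
    refine PadicInt.ext_of_toZModPow.1 fun n => ?_
    simp only [Matrix.mul_apply, Matrix.of_apply, map_sum, map_mul (PadicInt.toZModPow n)]
    simp only [toZModPow_coeffHat_mapHat]
    rw [show (x * y).1 n = x.1 n * y.1 n from rfl, map_mul, map_mul, Matrix.mul_apply]

theorem rhoHat_apply (π : Γ →* G) (x : GroupRingHat p Γ) (g h : G) :
    rhoHat p π x g h = coeffHat (g⁻¹ * h) (mapHat p π x) := rfl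

/-- The link to integral homology: on differentials coming from `ℤΓ` the `p`-adic matrices are
integer matrices. -/
theorem rhoHat_toHat (π : Γ →* G) (x : MonoidAlgebra ℤ Γ) :
    rhoHat p π (toHat p Γ x) =
      (regMat ℤ G (MonoidAlgebra.mapDomainRingHom ℤ π x)).map (Int.castRingHom ℤ_[p]) := by
  ext1 g h
  refine PadicInt.ext_of_toZModPow.1 fun n => ?_
  rw [rhoHat_apply, toZModPow_coeffHat_mapHat]
  have : MonoidAlgebra.mapDomainRingHom (ZMod (p ^ n)) π ((toHat p Γ x).1 n) =
      MonoidAlgebra.mapRingHom G (Int.castRingHom (ZMod (p ^ n)))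
        (MonoidAlgebra.mapDomainRingHom ℤ π x) :=
    (RingHom.congr_fun (MonoidAlgebra.mapRingHom_comp_mapDomainRingHom
      (Int.castRingHom (ZMod (p ^ n))) π) x).symm
  rw [this, regMat_map]
  simp

/-- The matrix over `S` with blocks the images of the entries of a matrix over `R`. -/
def blockMap {R S : Type*} [Ring R] [CommRing S] (f : R →+* Matrix G G S) {m n : Type*}
    (A : Matrix m n R) : Matrix (m × G) (n × G) S :=
  Matrix.of fun i j => f (A i.1 j.1) i.2 j.2

section BlockMap

variable {R S : Type*} [Ring R] [CommRing S] (f : R →+* Matrix G G S) {l m n : Type*}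

theorem blockMap_apply (A : Matrix m n R) (i : m × G) (j : n × G) :
    blockMap f A i j = f (A i.1 j.1) i.2 j.2 := rfl

theorem blockMap_mul [Fintype m] (A : Matrix l m R) (B : Matrix m n R) :
    blockMap f (A * B) = blockMap f A * blockMap f B := by
  ext i j
  simp only [blockMap_apply, Matrix.mul_apply, map_sum, map_mul, Fintype.sum_prod_type,
    Matrix.sum_apply]

theorem blockMap_one [DecidableEq m] : blockMap f (1 : Matrix m m R) = 1 := by
  ext ⟨i, g⟩ ⟨j, h⟩
  by_cases hij : i = j
  · subst hij
    simp [blockMap_apply, Matrix.one_apply]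
  · simp [blockMap_apply, Matrix.one_apply, hij]

theorem blockMap_zero : blockMap f (0 : Matrix m n R) = 0 := by
  ext i j; simp [blockMap_apply]

theorem blockMap_add (A B : Matrix m n R) : blockMap f (A + B) = blockMap f A + blockMap f B := by
  ext i j; simp [blockMap_apply]

theorem blockMap_natCast_smul (c : ℕ) (A : Matrix m n R) :
    blockMap f ((c : R) • A) = (c : S) • blockMap f A := by
  ext i j
  simp [blockMap_apply, ← nsmul_eq_mul]

theorem blockMap_sub (A B : Matrix m n R) : blockMap f (A - B) = blockMap f A - blockMap f B := by
  ext i j; simp [blockMap_apply]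

/-- `blockMap` on square matrices. -/
def blockHom (m : Type*) [Fintype m] [DecidableEq m] :
    Matrix m m R →+* Matrix (m × G) (m × G) S where
  toFun := blockMap f
  map_one' := blockMap_one f
  map_mul' := blockMap_mul f
  map_zero' := blockMap_zero f
  map_add' := blockMap_add f

theorem blockHom_apply [Fintype m] [DecidableEq m] (A : Matrix m m R) :
    blockHom f m A = blockMap f A := rfl

theorem det_blockMap_stabMatrix {a b : ℕ} (h : a ≤ b) (A : Matrix (Fin a) (Fin a) R) :
    (blockMap f (stabMatrix R b A)).det = (blockMap f A).det := by
  obtain ⟨c, rfl⟩ := Nat.exists_eq_add_of_le h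
  let e : (Fin a × G) ⊕ (Fin c × G) ≃ Fin (a + c) × G :=
    (Equiv.sumProdDistrib _ _ _).symm.trans (Equiv.prodCongr finSumFinEquiv (Equiv.refl G))
  have h1 : ∀ (x : Fin a) (y : Fin c), ¬ (x : ℕ) = a + (y : ℕ) := fun x y => by omega
  have h2 : ∀ (x : Fin a) (y : Fin c), ¬ a + (y : ℕ) = (x : ℕ) := fun x y => by omega
  have : (blockMap f (stabMatrix R (a + c) A)).submatrix e e =
      Matrix.fromBlocks (blockMap f A) 0 0 1 := by
    ext (⟨i, g⟩ | ⟨i, g⟩) (⟨j, h⟩ | ⟨j, h⟩)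
    · simp [e, blockMap_apply, stabMatrix]
    · simp [e, blockMap_apply, stabMatrix, Fin.ext_iff, h1]
    · simp [e, blockMap_apply, stabMatrix, Fin.ext_iff, h2]
    · simp only [e, blockMap_apply, stabMatrix, Matrix.submatrix_apply]
      by_cases hij : i = j
      · subst hij; simp [Matrix.one_apply]
      · simp [Matrix.one_apply, hij]
  rw [← Matrix.det_submatrix_equiv_self e, this, Matrix.det_fromBlocks_zero₂₁, Matrix.det_one,
    mul_one]

end BlockMap

/-! ### The logarithm of the determinant on the regular representation of a finite quotient -/

/-- All diagonal entries of the regular representation of an element equal its coefficient at the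
identity. -/
theorem trace_blockMap_rhoHat (π : Γ →* G) {r : ℕ}
    (A : Matrix (Fin r) (Fin r) (GroupRingHat p Γ)) :
    (blockMap (rhoHat p π) A).trace = Fintype.card G * coeffHat 1 (mapHat p π A.trace) := by
  simp only [Matrix.trace, Matrix.diag_apply, blockMap_apply, Fintype.sum_prod_type, rhoHat_apply,
    inv_mul_cancel, Finset.sum_const, Finset.card_univ, nsmul_eq_mul, map_sum]
  rw [← coeffHatHom_apply, map_sum, Finset.mul_sum]
  rfl

theorem coe_det_ne_zero {n : Type*} [Fintype n] [DecidableEq n] {A : Matrix n n ℤ_[p]}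
    (hA : IsUnit A) : ((A.det : ℤ_[p]) : ℚ_[p]) ≠ 0 := by
  have h := ((Matrix.isUnit_iff_isUnit_det A).1 hA).ne_zero
  exact fun h0 => h (Subtype.ext h0)

/-- `u ↦ log_p det` of `u` on the regular representation of `G`, on `GL_r`. -/
def logDetGL (π : Γ →* G) (r : ℕ) :
    (Matrix (Fin r) (Fin r) (GroupRingHat p Γ))ˣ →* Multiplicative ℚ_[p] where
  toFun u := Multiplicative.ofAdd
    (padicLog p ((blockMap (rhoHat p π) (u : Matrix (Fin r) (Fin r) _)).det : ℤ_[p]))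
  map_one' := by
    rw [Units.val_one, blockMap_one, Matrix.det_one, PadicInt.coe_one, padicLog_one, ofAdd_zero]
  map_mul' u v := by
    rw [Units.val_mul, blockMap_mul, Matrix.det_mul, PadicInt.coe_mul, padicLog_mul, ofAdd_add]
    · exact coe_det_ne_zero (u.isUnit.map (blockHom (rhoHat p π) (Fin r)))
    · exact coe_det_ne_zero (v.isUnit.map (blockHom (rhoHat p π) (Fin r)))

/-- `u ↦ log_p det` of `u` on the regular representation of `G`, on `GL_∞`. -/
def logDetGLInf (π : Γ →* G) : GLInf (GroupRingHat p Γ) →* Multiplicative ℚ_[p] :=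
  GLInf.lift (logDetGL π) fun n m h A => by
    change Multiplicative.ofAdd (padicLog p
      ((blockMap (rhoHat p π) (stabMatrix _ m (A : Matrix (Fin n) (Fin n) _))).det : ℤ_[p])) = _
    rw [det_blockMap_stabMatrix _ h]
    rfl

/-- The element `±γ` acts on the regular representation with order dividing `2 |G|`, and `ℚ_p` has
no torsion. -/
theorem logDetGL_unitGL (π : Γ →* G) (u : (GroupRingHat p Γ)ˣ) (γ : Γ)
    (hu : (u : GroupRingHat p Γ) = toHat p Γ (MonoidAlgebra.single γ 1) ∨
      (u : GroupRingHat p Γ) = -toHat p Γ (MonoidAlgebra.single γ 1)) :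
    logDetGL π 1 (unitGL u) = 1 := by
  have h1 : rhoHat p π ((u : GroupRingHat p Γ) ^ (Fintype.card G * 2)) = 1 := by
    have h2 : (u : GroupRingHat p Γ) ^ (Fintype.card G * 2) =
        toHat p Γ (MonoidAlgebra.single (γ ^ (Fintype.card G * 2)) 1) := by
      rcases hu with hu | hu
      · rw [hu, ← map_pow, MonoidAlgebra.single_pow, one_pow]
      · rw [hu, Even.neg_pow (by simp), ← map_pow, MonoidAlgebra.single_pow, one_pow]
    have h3 : MonoidAlgebra.mapDomainRingHom ℤ π
        (MonoidAlgebra.single (γ ^ (Fintype.card G * 2)) 1) = 1 := by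
      simp [MonoidAlgebra.one_def, pow_mul]
    rw [h2, rhoHat_toHat, h3, map_one, Matrix.map_one _ (map_zero _) (map_one _)]
  have h4 : (logDetGL π 1 (unitGL u)) ^ (Fintype.card G * 2) = 1 := by
    rw [← map_pow, ← map_pow]
    have : ((unitGL (u ^ (Fintype.card G * 2)) :
        (Matrix (Fin 1) (Fin 1) (GroupRingHat p Γ))ˣ) : Matrix (Fin 1) (Fin 1) _) =
        Matrix.scalar (Fin 1) ((u : GroupRingHat p Γ) ^ (Fintype.card G * 2)) := by
      simp only [unitGL, RingHom.toMonoidHom_eq_coe, map_pow, Units.val_pow_eq_pow_val,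
        Units.coe_map, MonoidHom.coe_coe]
    change Multiplicative.ofAdd (padicLog p ((blockMap (rhoHat p π) _).det : ℤ_[p])) = 1
    rw [this]
    have e : blockMap (rhoHat p π) (Matrix.scalar (Fin 1)
        ((u : GroupRingHat p Γ) ^ (Fintype.card G * 2))) = 1 := by
      ext ⟨i, g⟩ ⟨j, h⟩
      fin_cases i; fin_cases j
      simp only [blockMap_apply, Matrix.scalar_apply, Matrix.diagonal_apply_eq, h1, Fin.zero_eta]
      simp [Matrix.one_apply]
    rw [e, Matrix.det_one, PadicInt.coe_one, padicLog_one, ofAdd_zero]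
  have h5 := congrArg Multiplicative.toAdd h4
  rw [toAdd_pow, toAdd_one, nsmul_eq_mul] at h5
  have h6 : ((Fintype.card G * 2 : ℕ) : ℚ_[p]) ≠ 0 := by
    exact_mod_cast Nat.mul_ne_zero Fintype.card_ne_zero two_ne_zero
  exact Multiplicative.toAdd.injective ((mul_eq_zero.1 h5).resolve_left h6)

/-- `log_p det` on the regular representation of `G`, on `K_T`. -/
def logDet (π : Γ →* G) : KTHat p Γ →* Multiplicative ℚ_[p] :=
  QuotientGroup.lift _ (Abelianization.lift (logDetGLInf π))
    ((Subgroup.closure_le _).2 (by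
      rintro _ ⟨u, ⟨γ, hu⟩, rfl⟩
      exact logDetGL_unitGL π u γ hu))

theorem logDet_mk (π : Γ →* G) {r : ℕ} (u : (Matrix (Fin r) (Fin r) (GroupRingHat p Γ))ˣ) :
    logDet π (KTHat.mk u) = Multiplicative.ofAdd
      (padicLog p ((blockMap (rhoHat p π) (u : Matrix (Fin r) (Fin r) _)).det : ℤ_[p])) := rfl

/-- The factor `|G|` from the trace cancels the normalisation. The result depends on `G` only
through coefficients at the identity, which is what allows a passage to the limit. -/
theorem toAdd_logDet_oneUnit (π : Γ →* G) {r : ℕ} (a : Matrix (Fin r) (Fin r) (GroupRingHat p Γ))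
    (u : (Matrix (Fin r) (Fin r) (GroupRingHat p Γ))ˣ)
    (hu : (u : Matrix (Fin r) (Fin r) (GroupRingHat p Γ)) = 1 + (p : GroupRingHat p Γ) • a) :
    ((Fintype.card G : ℕ) : ℚ_[p])⁻¹ * (logDet π (KTHat.mk u)).toAdd =
      ∑' j, ((logCoeff p j : ℤ_[p]) : ℚ_[p]) *
        ((coeffHat 1 (mapHat p π (a ^ (j + 1)).trace) : ℤ_[p]) : ℚ_[p]) := by
  have hG : ((Fintype.card G : ℕ) : ℚ_[p]) ≠ 0 := by exact_mod_cast Fintype.card_ne_zero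
  have h1 : blockMap (rhoHat p π) (u : Matrix (Fin r) (Fin r) (GroupRingHat p Γ)) =
      1 + (p : ℤ_[p]) • blockMap (rhoHat p π) a := by
    rw [hu, blockMap_add, blockMap_one, blockMap_natCast_smul]
  have h2 := coe_det_ne_zero (u.isUnit.map (blockHom (rhoHat p π) (Fin r)))
  rw [blockHom_apply, h1] at h2
  rw [logDet_mk, toAdd_ofAdd, h1, padicLog_det_one_add _ h2, ← tsum_mul_left]
  refine tsum_congr fun j => ?_
  rw [← blockHom_apply, ← map_pow, blockHom_apply, trace_blockMap_rhoHat]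
  push_cast
  field_simp

end RhoHat

/-! ### The approximation of `tr_Γ (log u)` -/

section Approximation

variable {p : ℕ} [Fact p.Prime] {Γ : Type*} [Group Γ]

theorem continuous_coeffHat (γ : Γ) : Continuous (coeffHat γ : GroupRingHat p Γ → ℤ_[p]) := by
  let _ : ∀ n : ℕ, TopologicalSpace (MonoidAlgebra (ZMod (p ^ n)) Γ) := fun _ => ⊥
  have _ : ∀ n : ℕ, DiscreteTopology (MonoidAlgebra (ZMod (p ^ n)) Γ) := fun _ => ⟨rfl⟩
  rw [Metric.continuous_iff']
  intro x ε hε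
  obtain ⟨n, hn⟩ := PadicInt.exists_pow_neg_lt p hε
  have hc : Continuous (fun y : GroupRingHat p Γ => y.1 n) :=
    (continuous_apply n).comp continuous_induced_dom
  have ho : {y : GroupRingHat p Γ | y.1 n = x.1 n} ∈ 𝓝 x :=
    (hc.isOpen_preimage _ (isOpen_discrete {x.1 n})).mem_nhds rfl
  filter_upwards [ho] with y hy
  refine lt_of_le_of_lt ?_ hn
  rw [dist_eq_norm, PadicInt.norm_le_pow_iff_mem_span_pow, ← PadicInt.ker_toZModPow,
    RingHom.mem_ker, map_sub, toZModPow_coeffHat, toZModPow_coeffHat, hy, sub_self]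

theorem coeffHat_scalarHat_mul (γ : Γ) (c : ℤ_[p]) (x : GroupRingHat p Γ) :
    coeffHat γ (scalarHat p Γ c * x) = c * coeffHat γ x := by
  refine PadicInt.ext_of_toZModPow.1 fun n => ?_
  rw [map_mul, toZModPow_coeffHat, toZModPow_coeffHat]
  change (MonoidAlgebra.single 1 (PadicInt.toZModPow n c) * x.1 n).coeff γ = _
  simp

/-- The trace and the coefficient at the identity are continuous and additive, so they may be
applied to the logarithmic series term by term. -/
theorem trace_logOneUnit {r : ℕ} (a : Matrix (Fin r) (Fin r) (GroupRingHat p Γ)) :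
    ((trace (logOneUnit a) : ℤ_[p]) : ℚ_[p]) = ∑' j, ((logCoeff p j : ℤ_[p]) : ℚ_[p]) *
        ((coeffHat 1 (a ^ (j + 1)).trace : ℤ_[p]) : ℚ_[p]) := by
  have h := (summable_log a).hasSum
  let T : Matrix (Fin r) (Fin r) (GroupRingHat p Γ) →+ ℚ_[p] :=
    ((PadicInt.Coe.ringHom (p := p)).toAddMonoidHom.comp (coeffHatHom 1)).comp
      (Matrix.traceAddMonoidHom (Fin r) (GroupRingHat p Γ))
  have hT : ∀ A, T A = ((coeffHat 1 A.trace : ℤ_[p]) : ℚ_[p]) := fun A => rfl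
  have hTs : ∀ A, T A = ∑ i, ((coeffHat 1 (A i i) : ℤ_[p]) : ℚ_[p]) := fun A => by
    change ((PadicInt.Coe.ringHom (p := p)).toAddMonoidHom.comp (coeffHatHom 1)) (A.trace) = _
    rw [Matrix.trace, map_sum]
    rfl
  have hcont : Continuous T := by
    have : (T : Matrix (Fin r) (Fin r) (GroupRingHat p Γ) → ℚ_[p]) =
        fun A => ∑ i, ((coeffHat 1 (A i i) : ℤ_[p]) : ℚ_[p]) := funext hTs
    rw [this]
    refine continuous_finsetSum _ fun i _ => ?_
    exact continuous_subtype_val.comp ((continuous_coeffHat 1).comp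
      ((continuous_apply i).comp (continuous_apply i)))
  have h2 := h.map T hcont
  rw [trace, logOneUnit, ← hT, ← h2.tsum_eq]
  refine tsum_congr fun j => ?_
  rw [Function.comp_apply, hT, Matrix.trace_smul, smul_eq_mul, coeffHat_scalarHat_mul,
    PadicInt.coe_mul]

/-- An element lying in infinitely many of the subgroups would lie in their intersection. Only this
pointwise consequence is used later. -/
theorem TendsToTrivial.eventually_notMem {Δ : ℕ → Subgroup Γ} (hΔ : TendsToTrivial Δ) {γ : Γ}
    (hγ : γ ≠ 1) : ∀ᶠ n in Filter.atTop, γ ∉ Δ n := by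
  by_contra h
  have hinf : {n | γ ∈ Δ n}.Infinite := by
    rw [← Nat.frequently_atTop_iff_infinite]
    simpa [Filter.Frequently] using h
  have h1 := hΔ.2 _ hinf
  exact hγ (Subgroup.mem_bot.1 (h1 ▸ by simp [Subgroup.mem_iInf]))

theorem mapDomain_coeff_one {R G : Type*} [Ring R] [Group G] (π : Γ →* G) (x : MonoidAlgebra R Γ)
    (h : ∀ γ ∈ x.coeff.support, π γ = 1 → γ = 1) :
    (MonoidAlgebra.mapDomainRingHom R π x).coeff 1 = x.coeff 1 := by
  classical
  change (Finsupp.mapDomain π x.coeff) 1 = x.coeff 1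
  rw [Finsupp.mapDomain, Finsupp.sum, Finsupp.finsetSum_apply]
  simp only [Finsupp.single_apply]
  rw [Finset.sum_congr rfl (g := fun γ => if γ = 1 then x.coeff γ else 0) fun γ hγ => by
    by_cases h1 : γ = 1
    · simp [h1]
    · rw [if_neg (mt (h γ hγ) h1), if_neg h1]]
  simp +contextual

/-- Modulo `p ^ k` the support is finite, and each of its nontrivial elements eventually leaves the
kernel. From then on nothing but the identity itself contributes to the coefficient at the identity.
-/
theorem tendsto_coeffHat_mapHat {G : ℕ → Type*} [∀ n, Group (G n)] (π : ∀ n, Γ →* G n)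
    (hπ : ∀ γ : Γ, γ ≠ 1 → ∀ᶠ n in Filter.atTop, π n γ ≠ 1) (x : GroupRingHat p Γ) :
    Filter.Tendsto (fun n => ((coeffHat 1 (mapHat p (π n) x) : ℤ_[p]) : ℚ_[p])) Filter.atTop
      (𝓝 ((coeffHat 1 x : ℤ_[p]) : ℚ_[p])) := by
  suffices h : Filter.Tendsto (fun n => coeffHat 1 (mapHat p (π n) x)) Filter.atTop
      (𝓝 (coeffHat 1 x)) from (continuous_subtype_val.tendsto (coeffHat 1 x)).comp h
  rw [Metric.tendsto_nhds]
  intro ε hε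
  obtain ⟨k, hk⟩ := PadicInt.exists_pow_neg_lt p hε
  have : ∀ᶠ n in Filter.atTop, ∀ γ ∈ (x.1 k).coeff.support, γ ≠ 1 → π n γ ≠ 1 := by
    rw [Filter.eventually_all_finset]
    intro γ _
    by_cases hγ : γ = 1
    · simp [hγ]
    · filter_upwards [hπ γ hγ] with n hn _ using hn
  filter_upwards [this] with n hn
  refine lt_of_le_of_lt ?_ hk
  rw [dist_eq_norm, PadicInt.norm_le_pow_iff_mem_span_pow, ← PadicInt.ker_toZModPow,
    RingHom.mem_ker, map_sub, toZModPow_coeffHat, toZModPow_coeffHat, mapHat_val,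
    mapDomain_coeff_one, sub_self]
  intro γ hγ h1
  by_contra h2
  exact hn γ hγ h2 h1

/-- Termwise convergence, with `‖logCoeff p j‖` as a summable bound independent of the quotient. -/
theorem tendsto_logDet_oneUnit {G : ℕ → Type*} [∀ n, Group (G n)] [∀ n, Fintype (G n)]
    [∀ n, DecidableEq (G n)] (π : ∀ n, Γ →* G n)
    (hπ : ∀ γ : Γ, γ ≠ 1 → ∀ᶠ n in Filter.atTop, π n γ ≠ 1) {r : ℕ}
    (a : Matrix (Fin r) (Fin r) (GroupRingHat p Γ))
    (u : (Matrix (Fin r) (Fin r) (GroupRingHat p Γ))ˣ)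
    (hu : (u : Matrix (Fin r) (Fin r) (GroupRingHat p Γ)) = 1 + (p : GroupRingHat p Γ) • a) :
    Filter.Tendsto (fun n => ((Fintype.card (G n) : ℕ) : ℚ_[p])⁻¹ *
      (logDet (π n) (KTHat.mk u)).toAdd) Filter.atTop
      (𝓝 ((trace (logOneUnit a) : ℤ_[p]) : ℚ_[p])) := by
  simp only [toAdd_logDet_oneUnit _ a u hu, trace_logOneUnit]
  refine tendsto_tsum_of_dominated_convergence (summable_norm_logCoeff (p := p)) (fun j => ?_)
    (Filter.Eventually.of_forall fun n j => ?_)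
  · exact (tendsto_coeffHat_mapHat π hπ _).const_mul _
  · rw [norm_mul]
    refine (mul_le_of_le_one_right (norm_nonneg _) ?_).trans_eq ?_
    · simpa using PadicInt.norm_le_one _
    · simp

/-- The renormalized logarithms of the determinants on the finite quotients converge on `K_T`. -/
theorem tendsto_logDet (hWh : IsMulTorsion (WhMod p Γ)) {φ : KTHat p Γ →* Multiplicative ℚ_[p]}
    (hφ : IsLogDet φ) {G : ℕ → Type*} [∀ n, Group (G n)] [∀ n, Fintype (G n)]
    [∀ n, DecidableEq (G n)] (π : ∀ n, Γ →* G n)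
    (hπ : ∀ γ : Γ, γ ≠ 1 → ∀ᶠ n in Filter.atTop, π n γ ≠ 1) (x : KTHat p Γ) :
    Filter.Tendsto (fun n => ((Fintype.card (G n) : ℕ) : ℚ_[p])⁻¹ * (logDet (π n) x).toAdd)
      Filter.atTop (𝓝 (φ x).toAdd) := by
  obtain ⟨N, r, a, u, hN, hu, hx⟩ := exists_pow_eq_oneUnit hWh x
  have hN' : (N : ℚ_[p]) ≠ 0 := by exact_mod_cast hN
  have h1 := (tendsto_logDet_oneUnit π hπ a u hu).const_mul (N : ℚ_[p])⁻¹
  -- Because `ℚ_p` is uniquely divisible, the value of `φ` at `x` is forced by its value at the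
  -- one-unit `x ^ N`.
  have h2 : (φ x).toAdd = (N : ℚ_[p])⁻¹ * ((trace (logOneUnit a) : ℤ_[p]) : ℚ_[p]) := by
    have := hφ r a u hu
    rw [← hx, map_pow] at this
    have h3 := congrArg Multiplicative.toAdd this
    rw [toAdd_pow, toAdd_ofAdd, nsmul_eq_mul] at h3
    rw [← h3, inv_mul_cancel_left₀ hN']
  rw [h2]
  refine h1.congr fun n => ?_
  rw [← hx, map_pow, toAdd_pow, nsmul_eq_mul]
  field_simp

/-- A pointwise limit of homomorphisms is a homomorphism, which gives existence. Any competitor is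
computed by the same limit, which gives uniqueness. -/
theorem existsUnique_isLogDet (hWh : IsMulTorsion (WhMod p Γ)) {G : ℕ → Type*} [∀ n, Group (G n)]
    [∀ n, Fintype (G n)] [∀ n, DecidableEq (G n)] (π : ∀ n, Γ →* G n)
    (hπ : ∀ γ : Γ, γ ≠ 1 → ∀ᶠ n in Filter.atTop, π n γ ≠ 1) :
    ∃! φ : KTHat p Γ →* Multiplicative ℚ_[p], IsLogDet φ := by
  have hlim : ∀ x : KTHat p Γ, ∃ l, Filter.Tendsto (fun n =>
      ((Fintype.card (G n) : ℕ) : ℚ_[p])⁻¹ * (logDet (π n) x).toAdd) Filter.atTop (𝓝 l) := by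
    intro x
    obtain ⟨N, r, a, u, hN, hu, hx⟩ := exists_pow_eq_oneUnit hWh x
    have hN' : (N : ℚ_[p]) ≠ 0 := by exact_mod_cast hN
    refine ⟨_, ((tendsto_logDet_oneUnit π hπ a u hu).const_mul (N : ℚ_[p])⁻¹).congr fun n => ?_⟩
    rw [← hx, map_pow, toAdd_pow, nsmul_eq_mul]
    field_simp
  choose l hl using hlim
  let φ : KTHat p Γ →* Multiplicative ℚ_[p] :=
    { toFun := fun x => Multiplicative.ofAdd (l x)
      map_one' := by
        have : l 1 = 0 := tendsto_nhds_unique (hl 1) (by simp)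
        rw [this, ofAdd_zero]
      map_mul' := fun x y => by
        have : l (x * y) = l x + l y := tendsto_nhds_unique (hl (x * y)) (by
          refine ((hl x).add (hl y)).congr fun n => ?_
          rw [map_mul, toAdd_mul, mul_add])
        rw [this, ofAdd_add] }
  have hφ : IsLogDet φ := fun r a u hu =>
    congrArg Multiplicative.ofAdd
      (tendsto_nhds_unique (hl _) (tendsto_logDet_oneUnit π hπ a u hu))
  refine ⟨φ, hφ, fun ψ hψ => ?_⟩
  refine MonoidHom.ext fun x => ?_
  exact Multiplicative.toAdd.injective (tendsto_nhds_unique (tendsto_logDet hWh hψ π hπ x)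
    (tendsto_logDet hWh hφ π hπ x))

end Approximation

end

end PadicTorsion

namespace PadicTorsion

open scoped Topology

noncomputable section

/-! ### Contractible complexes of matrices -/

section Total

theorem finite_sigma {ι : ℕ → Type*} [∀ n, Finite (ι n)] {d : ℕ} (h : ∀ n, d < n → IsEmpty (ι n)) :
    Finite (Σ n, ι n) := by
  refine Finite.of_injective (β := Σ n : Fin (d + 1), ι n)
    (fun x => ⟨⟨x.1, ?_⟩, x.2⟩) ?_
  · by_contra hx
    exact (h x.1 (by omega)).false x.2
  · rintro ⟨i, s⟩ ⟨j, t⟩ hst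
    simp only [Sigma.mk.injEq, Fin.mk.injEq] at hst
    obtain ⟨rfl, h2⟩ := hst
    simpa using h2

/-- The indices of odd and of even degree. -/
def oddEvenEquiv (ι : ℕ → Type*) :
    (Σ k : ℕ, ι (2 * k + 1)) ⊕ (Σ k : ℕ, ι (2 * k)) ≃ Σ n, ι n :=
  Equiv.ofBijective (Sum.elim (fun x => ⟨2 * x.1 + 1, x.2⟩) (fun x => ⟨2 * x.1, x.2⟩)) <| by
    constructor
    · rintro (⟨i, s⟩ | ⟨i, s⟩) (⟨j, t⟩ | ⟨j, t⟩) h <;>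
        simp only [Sum.elim_inl, Sum.elim_inr, Sigma.mk.injEq] at h
      · obtain rfl : i = j := by omega
        simpa using h
      · omega
      · omega
      · obtain rfl : i = j := by omega
        simpa using h
    · rintro ⟨n, s⟩
      obtain ⟨k, rfl | rfl⟩ := Nat.even_or_odd' n
      · exact ⟨Sum.inr ⟨k, s⟩, rfl⟩
      · exact ⟨Sum.inl ⟨k, s⟩, rfl⟩

variable {A : Type*} [Ring A] {ι : ℕ → Type*} [∀ n, Fintype (ι n)] [∀ n, DecidableEq (ι n)]

/-- The total matrix of a family of matrices between the terms of a graded module. -/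
def totalMatrix (D : ∀ i j, Matrix (ι i) (ι j) A) : Matrix (Σ n, ι n) (Σ n, ι n) A :=
  Matrix.of fun x y => D x.1 y.1 x.2 y.2

theorem sum_sigma_eq [Fintype (Σ n, ι n)] (k : ℕ) (f : (Σ n, ι n) → A)
    (hf : ∀ x, x.1 ≠ k → f x = 0) : ∑ x, f x = ∑ t : ι k, f ⟨k, t⟩ := by
  refine (Fintype.sum_of_injective (Sigma.mk k) sigma_mk_injective _ _ (fun x hx => hf x ?_)
    fun _ => rfl).symm
  rintro rfl
  exact hx ⟨x.2, rfl⟩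

theorem totalMatrix_mul_apply [Fintype (Σ n, ι n)] (k : ℕ) (D E : ∀ i j, Matrix (ι i) (ι j) A)
    (x y : Σ n, ι n) (h : ∀ j, j ≠ k → D x.1 j = 0 ∨ E j y.1 = 0) :
    (totalMatrix D * totalMatrix E) x y = (D x.1 k * E k y.1) x.2 y.2 := by
  rw [Matrix.mul_apply, Matrix.mul_apply, sum_sigma_eq k]
  · rfl
  · intro z hz
    rcases h z.1 hz with h | h <;> simp [totalMatrix, h]

variable (D S : ∀ i j, Matrix (ι i) (ι j) A)

/-- Families of matrices `D`, `S` of degree `-1` and `1` with `D ∘ D = 0` and `D S + S D = 1`. -/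
structure MatContraction : Prop where
  degree_neg : ∀ i j, j + 1 ≠ i → D i j = 0
  degree_one : ∀ i j, i + 1 ≠ j → S i j = 0
  sq : ∀ n, D (n + 2) (n + 1) * D (n + 1) n = 0
  zero : S 0 1 * D 1 0 = 1
  succ : ∀ n, D (n + 1) n * S n (n + 1) + S (n + 1) (n + 2) * D (n + 2) (n + 1) = 1

variable {D S}

theorem MatContraction.total_sq [Fintype (Σ n, ι n)] (h : MatContraction D S) :
    totalMatrix D * totalMatrix D = 0 := by
  ext ⟨i, s⟩ ⟨j, t⟩
  rw [totalMatrix_mul_apply (j + 1) _ _ _ _ fun k hk => Or.inr (h.degree_neg _ _ (Ne.symm hk))]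
  by_cases hi : i = j + 2
  · subst hi
    simp [h.sq]
  · simp [h.degree_neg i (j + 1) (by omega)]

theorem MatContraction.total_add [Fintype (Σ n, ι n)] (h : MatContraction D S) :
    totalMatrix D * totalMatrix S + totalMatrix S * totalMatrix D = 1 := by
  ext ⟨i, s⟩ ⟨j, t⟩
  rw [Matrix.add_apply,
    totalMatrix_mul_apply (i + 1) S D _ _ fun k hk => Or.inl (h.degree_one _ _ (Ne.symm hk))]
  cases i with
  | zero =>
    have h1 : (totalMatrix D * totalMatrix S) ⟨0, s⟩ ⟨j, t⟩ = 0 := by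
      rw [totalMatrix_mul_apply 0 _ _ _ _ fun k hk => Or.inl (h.degree_neg _ _ (by simp))]
      simp [h.degree_neg 0 0]
    rw [h1, zero_add]
    by_cases hj : j = 0
    · subst hj
      simp [h.zero, Matrix.one_apply]
    · rw [h.degree_neg (0 + 1) j (by omega)]
      simp [Matrix.one_apply, Ne.symm hj]
  | succ n =>
    rw [totalMatrix_mul_apply n D S _ _ fun k hk => Or.inl (h.degree_neg _ _ (by simpa using hk))]
    by_cases hj : j = n + 1
    · subst hj
      change (D (n + 1) n * S n (n + 1) + S (n + 1) (n + 2) * D (n + 2) (n + 1)) s t = _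
      rw [h.succ]
      simp [Matrix.one_apply]
    · rw [h.degree_one n j (Ne.symm hj), h.degree_neg (n + 1 + 1) j (by omega)]
      have : ¬ (⟨n + 1, s⟩ : Σ n, ι n) = ⟨j, t⟩ := fun e => hj (congrArg Sigma.fst e).symm
      simp [Matrix.one_apply, this]

theorem MatContraction.total_pow [Fintype (Σ n, ι n)] (h : MatContraction D S) (N : ℕ)
    (x y : Σ n, ι n) (hxy : y.1 ≠ x.1 + N) : (totalMatrix S ^ N) x y = 0 := by
  induction N generalizing y with
  | zero => rw [pow_zero, Matrix.one_apply_ne]; rintro rfl; exact hxy rfl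
  | succ N ih =>
    rw [pow_succ, Matrix.mul_apply]
    refine Finset.sum_eq_zero fun z _ => ?_
    by_cases hz : z.1 = x.1 + N
    · rw [totalMatrix, Matrix.of_apply, h.degree_one _ _ (by omega)]
      simp
    · rw [ih z hz, zero_mul]

theorem MatContraction.isNilpotent [Fintype (Σ n, ι n)] (h : MatContraction D S) :
    IsNilpotent (totalMatrix S) := by
  obtain ⟨d, hd⟩ := (Set.finite_range (fun x : Σ n, ι n => x.1)).bddAbove
  refine ⟨d + 1, ?_⟩
  ext x y
  refine h.total_pow _ x y ?_
  have := hd ⟨y, rfl⟩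
  simp only at this
  omega

/-- The relations give `(D + S)² = 1 + S²`, and `S` is nilpotent because it raises the degree in a
complex with finitely many basis elements. -/
theorem MatContraction.isUnit_total [Fintype (Σ n, ι n)] (h : MatContraction D S) :
    IsUnit (totalMatrix D + totalMatrix S) := by
  have h1 : (totalMatrix D + totalMatrix S) ^ 2 = 1 + totalMatrix S ^ 2 := by
    rw [pow_two, add_mul, mul_add, mul_add, h.total_sq, zero_add, ← add_assoc, h.total_add, pow_two]
  have h2 : IsUnit ((totalMatrix D + totalMatrix S) ^ 2) := by
    rw [h1]
    exact (h.isNilpotent.pow_of_pos two_ne_zero).isUnit_one_add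
  exact (isUnit_pow_iff two_ne_zero).1 h2

/-- The matrix of `D + S` from the odd to the even part. -/
def oddPart (D S : ∀ i j, Matrix (ι i) (ι j) A) :
    Matrix (Σ k : ℕ, ι (2 * k + 1)) (Σ k : ℕ, ι (2 * k)) A :=
  fun s t => (D (2 * s.1 + 1) (2 * t.1) + S (2 * s.1 + 1) (2 * t.1)) s.2 t.2

/-- Both `D` and `S` change the parity of the degree, so `D + S` is block antidiagonal and a block
of its inverse inverts the odd part. The index sets stay distinct here; that they have equal size is
a separate fact. -/
theorem MatContraction.exists_inv_oddPart [Fintype (Σ n, ι n)] [Fintype (Σ k : ℕ, ι (2 * k + 1))]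
    [Fintype (Σ k : ℕ, ι (2 * k))] (h : MatContraction D S) :
    ∃ W : Matrix (Σ k : ℕ, ι (2 * k)) (Σ k : ℕ, ι (2 * k + 1)) A, oddPart D S * W = 1 ∧ W * oddPart D S = 1 := by
  obtain ⟨u, hu⟩ := h.isUnit_total
  set e := oddEvenEquiv ι
  set T := (u : Matrix (Σ n, ι n) (Σ n, ι n) A).submatrix e e with hT
  set W := ((u⁻¹ : (Matrix (Σ n, ι n) (Σ n, ι n) A)ˣ) : Matrix (Σ n, ι n) (Σ n, ι n) A).submatrix
    e e with hW
  have h1 : T * W = 1 := by rw [hT, hW, Matrix.submatrix_mul_equiv, u.mul_inv, Matrix.submatrix_one_equiv]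
  have h2 : W * T = 1 := by rw [hT, hW, Matrix.submatrix_mul_equiv, u.inv_mul, Matrix.submatrix_one_equiv]
  have hTb : T = Matrix.fromBlocks 0 (oddPart D S) T.toBlocks₂₁ 0 := by
    rw [← Matrix.fromBlocks_toBlocks T]
    congr 1
    · ext ⟨k, s⟩ ⟨l, t⟩
      change (u : Matrix (Σ n, ι n) (Σ n, ι n) A) ⟨2 * k + 1, s⟩ ⟨2 * l + 1, t⟩ = 0
      rw [hu]
      change (D (2 * k + 1) (2 * l + 1) + S (2 * k + 1) (2 * l + 1)) s t = 0
      rw [h.degree_neg _ _ (by omega), h.degree_one _ _ (by omega)]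
      simp
    · ext ⟨k, s⟩ ⟨l, t⟩
      change (u : Matrix (Σ n, ι n) (Σ n, ι n) A) ⟨2 * k + 1, s⟩ ⟨2 * l, t⟩ = _
      rw [hu]
      rfl
    · ext ⟨k, s⟩ ⟨l, t⟩
      change (u : Matrix (Σ n, ι n) (Σ n, ι n) A) ⟨2 * k, s⟩ ⟨2 * l, t⟩ = 0
      rw [hu]
      change (D (2 * k) (2 * l) + S (2 * k) (2 * l)) s t = 0
      rw [h.degree_neg _ _ (by omega), h.degree_one _ _ (by omega)]
      simp
  rw [hTb, ← Matrix.fromBlocks_toBlocks W, Matrix.fromBlocks_multiply,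
    ← Matrix.fromBlocks_one] at h1 h2
  refine ⟨W.toBlocks₂₁, ?_, ?_⟩
  · simpa using (Matrix.fromBlocks_inj.1 h1).1
  · simpa using (Matrix.fromBlocks_inj.1 h2).2.2.2

end Total

/-! ### Contractions of complexes that are exact modulo `p` -/

section Lift

/-- Dependent choice carrying an invariant, used to build a homotopy one degree at a time. -/
theorem exists_seq_rel {α : ℕ → Type*} {P : ∀ n, α n → Prop} {Q : ∀ n, α n → α (n + 1) → Prop}
    {a : α 0} (ha : P 0 a) (h : ∀ n x, P n x → ∃ y, P (n + 1) y ∧ Q n x y) :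
    ∃ f : ∀ n, α n, f 0 = a ∧ (∀ n, P n (f n)) ∧ ∀ n, Q n (f n) (f (n + 1)) := by
  choose g hg using h
  let f : ∀ n, {x : α n // P n x} := fun n =>
    Nat.rec ⟨a, ha⟩ (fun n x => ⟨g n x.1 x.2, (hg n x.1 x.2).1⟩) n
  exact ⟨fun n => (f n).1, rfl, fun n => (f n).2, fun n => (hg n (f n).1 (f n).2).2⟩

variable {R : Type*} [Ring R] (p : ℕ) {r : ℕ → ℕ}
  (D : ∀ i j, Matrix (Fin (r i)) (Fin (r j)) R)

/-- Exactness modulo `p`. -/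
structure ExactMod : Prop where
  sq : ∀ n, D (n + 2) (n + 1) * D (n + 1) n = 0
  zero : ∀ v, ∃ z w, v = Matrix.vecMul z (D 1 0) + p • w
  succ : ∀ n v y, Matrix.vecMul v (D (n + 1) n) = p • y →
    ∃ z w, v = Matrix.vecMul z (D (n + 2) (n + 1)) + p • w

variable {p D}

theorem matrix_mul_row {l m n : Type*} [Fintype m] (A : Matrix l m R) (B : Matrix m n R) (i : l) :
    (A * B) i = Matrix.vecMul (A i) B := rfl

/-- A complex of free modules that is exact modulo `p` is contractible up to a homotopy
`1 - p E`. -/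
theorem ExactMod.exists_homotopy (hp : ∀ x : R, p • x = 0 → x = 0) (h : ExactMod p D) :
    ∃ (S : ∀ n, Matrix (Fin (r n)) (Fin (r (n + 1))) R) (E : ∀ n, Matrix (Fin (r n)) (Fin (r n)) R),
      S 0 * D 1 0 = 1 - p • E 0 ∧
      (∀ n, D (n + 1) n * S n + S (n + 1) * D (n + 2) (n + 1) = 1 - p • E (n + 1)) ∧
      ∀ n, E (n + 1) * D (n + 1) n = D (n + 1) n * E n := by
  have hpm : ∀ {m n : ℕ} (X Y : Matrix (Fin m) (Fin n) R), p • X = p • Y → X = Y := by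
    intro m n X Y hXY
    ext i j
    rw [← sub_eq_zero]
    refine hp _ ?_
    have := congrFun (congrFun hXY i) j
    rw [Matrix.smul_apply, Matrix.smul_apply] at this
    rw [smul_sub, this, sub_self]
  choose z₀ w₀ h₀ using fun i => h.zero ((1 : Matrix (Fin (r 0)) (Fin (r 0)) R) i)
  have h₀' : Matrix.of z₀ * D 1 0 = 1 - p • Matrix.of w₀ := by
    rw [eq_sub_iff_add_eq]
    funext i
    exact (h₀ i).symm
  obtain ⟨f, hf0, hfP, hfQ⟩ := exists_seq_rel
    (α := fun n => Matrix (Fin (r n)) (Fin (r (n + 1))) R × Matrix (Fin (r n)) (Fin (r n)) R)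
    -- The invariant says that the rows of `1 - D S` are cycles modulo `p`. Exactness modulo `p`
    -- then writes them as boundaries plus `p` times a remainder, which supplies the next `S` and
    -- `E`.
    (P := fun n x => D (n + 1) n * (1 - x.1 * D (n + 1) n) = p • (D (n + 1) n * x.2))
    (Q := fun n x y => D (n + 1) n * x.1 + y.1 * D (n + 2) (n + 1) = 1 - p • y.2 ∧
      y.2 * D (n + 1) n = D (n + 1) n * x.2)
    (a := (Matrix.of z₀, Matrix.of w₀))
    (by
      change D 1 0 * (1 - Matrix.of z₀ * D 1 0) = p • (D 1 0 * Matrix.of w₀)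
      rw [h₀', sub_sub_cancel, Matrix.mul_smul])
    (by
      rintro n ⟨S, E⟩ hP
      simp only at hP ⊢
      have hV : (1 - D (n + 1) n * S) * D (n + 1) n = p • (D (n + 1) n * E) := by
        rw [← hP, Matrix.sub_mul, Matrix.mul_sub, Matrix.one_mul, Matrix.mul_one, Matrix.mul_assoc]
      choose z w hzw using fun i => h.succ n
        ((1 - D (n + 1) n * S : Matrix (Fin (r (n + 1))) (Fin (r (n + 1))) R) i) ((D (n + 1) n * E) i)
        (by rw [← matrix_mul_row, hV]; rfl)
      have hzw' : 1 - D (n + 1) n * S = Matrix.of z * D (n + 2) (n + 1) + p • Matrix.of w := by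
        funext i
        exact hzw i
      have hrel : D (n + 1) n * S + Matrix.of z * D (n + 2) (n + 1) = 1 - p • Matrix.of w := by
        rw [eq_sub_iff_add_eq, add_assoc, ← hzw']
        abel
      refine ⟨(Matrix.of z, Matrix.of w), ?_, hrel, ?_⟩
      · have : 1 - Matrix.of z * D (n + 2) (n + 1) = D (n + 1) n * S + p • Matrix.of w := by
          rw [sub_eq_iff_eq_add, add_right_comm, hrel]; abel
        rw [this, Matrix.mul_add, ← Matrix.mul_assoc, h.sq, Matrix.zero_mul, zero_add,
          Matrix.mul_smul]
      -- That `E` is a chain map holds after multiplication by `p`, and there is no `p`-torsion.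
      · refine hpm _ _ ?_
        rw [← hV, hzw', Matrix.add_mul, Matrix.mul_assoc, h.sq, Matrix.mul_zero, zero_add,
          Matrix.smul_mul])
  refine ⟨fun n => (f n).1, fun n => (f n).2, ?_, fun n => (hfQ n).1, fun n => (hfQ n).2⟩
  simp only [hf0]
  exact h₀'

end Lift

section ContractionHat

variable {p : ℕ} [Fact p.Prime] {Γ : Type} [Group Γ] {r : ℕ → ℕ}

theorem _root_.MonoidAlgebra.eq_zero_of_nsmul_eq_zero {Γ : Type*} [Group Γ] {q : ℕ} (hq : q ≠ 0)
    {x : MonoidAlgebra ℤ Γ} (hx : q • x = 0) : x = 0 := by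
  ext γ
  have h : q • x.coeff γ = 0 := congrArg (fun y => MonoidAlgebra.coeff y γ) hx
  simpa [hq] using h

theorem natCast_smul_matrix {R S : Type*} [Ring R] [Ring S] (f : R →+* S) {m n : Type*} (q : ℕ)
    (A : Matrix m n R) : (q • A).map f = (q : S) • A.map f := by
  ext i j
  simp

/-- Over the completion `1 - pE` is an invertible chain map. Composing the homotopy with its
inverse, which also commutes with the differential, replaces `1 - pE` by `1`. -/
theorem ExactMod.exists_contraction {D : ∀ i j, Matrix (Fin (r i)) (Fin (r j)) (MonoidAlgebra ℤ Γ)}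
    (hD : ∀ i j, j + 1 ≠ i → D i j = 0) (h : ExactMod p D) :
    ∃ S : ∀ i j, Matrix (Fin (r i)) (Fin (r j)) (GroupRingHat p Γ),
      MatContraction (fun i j => (D i j).map (toHat p Γ)) S := by
  obtain ⟨S, E, h0, hs, hc⟩ := h.exists_homotopy fun x hx => MonoidAlgebra.eq_zero_of_nsmul_eq_zero
    (Fact.out : p.Prime).ne_zero hx
  set F := toHat p Γ
  choose u hu using fun n => isUnit_one_add_smul (-(E n).map F)
  have hu' : ∀ n, (u n : Matrix (Fin (r n)) (Fin (r n)) (GroupRingHat p Γ)) =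
      1 - (p : GroupRingHat p Γ) • (E n).map F := fun n => by rw [hu, smul_neg, sub_eq_add_neg]
  have hmap1 : ∀ n, (1 : Matrix (Fin (r n)) (Fin (r n)) (MonoidAlgebra ℤ Γ)).map F = 1 :=
    fun n => Matrix.map_one _ (map_zero _) (map_one _)
  have h0' : (S 0).map F * (D 1 0).map F = (u 0).val := by
    rw [← Matrix.map_mul, h0, Matrix.map_sub _ (map_sub F), natCast_smul_matrix, hmap1, hu']
  have hs' : ∀ n, (D (n + 1) n).map F * (S n).map F +
      (S (n + 1)).map F * (D (n + 2) (n + 1)).map F = (u (n + 1)).val := fun n => by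
    rw [← Matrix.map_mul, ← Matrix.map_mul, ← Matrix.map_add _ (map_add F), hs,
      Matrix.map_sub _ (map_sub F), natCast_smul_matrix, hmap1, hu']
  have hc' : ∀ n, (u (n + 1)).val * (D (n + 1) n).map F =
      (D (n + 1) n).map F * (u n).val := fun n => by
    have := congrArg (fun X => (p : GroupRingHat p Γ) • X.map F) (hc n)
    simp only [Matrix.map_mul] at this
    rw [hu', hu', Matrix.sub_mul, Matrix.mul_sub, Matrix.one_mul, Matrix.mul_one, Matrix.smul_mul,
      this, Nat.cast_smul_eq_nsmul, Nat.cast_smul_eq_nsmul, Matrix.mul_smul]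
  let v : ∀ n, Matrix (Fin (r n)) (Fin (r n)) (GroupRingHat p Γ) := fun n => ((u n)⁻¹).val
  have hv : ∀ n, v n * (u n).val = 1 := fun n => (u n).inv_mul
  have hc'' : ∀ n, v (n + 1) * (D (n + 1) n).map F = (D (n + 1) n).map F * v n := fun n => by
    calc v (n + 1) * (D (n + 1) n).map F
        = v (n + 1) * ((D (n + 1) n).map F * ((u n).val * v n)) := by
          rw [show (u n).val * v n = 1 from (u n).mul_inv,
            Matrix.mul_one]
      _ = v (n + 1) * (u (n + 1)).val * (D (n + 1) n).map F * v n := by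
          rw [← Matrix.mul_assoc _ _ (v n), ← hc']; simp only [Matrix.mul_assoc]
      _ = _ := by rw [hv, Matrix.one_mul]
  let S' : ∀ i j, Matrix (Fin (r i)) (Fin (r j)) (GroupRingHat p Γ) := fun i j =>
    if hij : i + 1 = j then (v i * (S i).map F).submatrix id (Fin.cast (by rw [hij])) else 0
  have hS' : ∀ n, S' n (n + 1) = v n * (S n).map F := fun n => by
    simp only [S', dif_pos]
    rfl
  refine ⟨S', fun i j hij => ?_, fun i j hij => dif_neg hij, fun n => ?_, ?_, fun n => ?_⟩
  · rw [hD i j hij, Matrix.map_zero _ (map_zero F)]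
  · rw [← Matrix.map_mul, h.sq, Matrix.map_zero _ (map_zero F)]
  · rw [hS', Matrix.mul_assoc, h0', hv]
  · rw [hS', hS', ← Matrix.mul_assoc, ← hc'', Matrix.mul_assoc, Matrix.mul_assoc, ← Matrix.mul_add,
      hs', hv]

end ContractionHat

/-! ### Acyclicity of the completed resolution -/

namespace BasedResolution

variable {p : ℕ} {Γ : Type} [Group Γ] {M : Type} [AddCommGroup M]
  [Module (MonoidAlgebra ℤ Γ) M] (F : BasedResolution (MonoidAlgebra ℤ Γ) M)

/-- The matrices of the differentials. -/
def dMat (i j : ℕ) : Matrix (Fin (F.rank i)) (Fin (F.rank j)) (MonoidAlgebra ℤ Γ) :=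
  fun s t => (F.basis j).repr ((F.complex.d i j).hom (F.basis i s)) t

theorem dHat_eq (i j : ℕ) : F.dHat p i j = (F.dMat i j).map (toHat p Γ) := rfl

theorem repr_d (i j : ℕ) (x : F.complex.X i) :
    ⇑((F.basis j).repr ((F.complex.d i j).hom x)) =
      Matrix.vecMul ((F.basis i).repr x) (F.dMat i j) := by
  funext t
  refine (congrArg (fun y => (F.basis j).repr ((F.complex.d i j).hom y) t)
    ((F.basis i).sum_repr x).symm).trans ?_
  simp only [map_sum, map_smul]
  simp [Matrix.vecMul, dotProduct, dMat]

theorem dMat_eq_zero (i j : ℕ) (h : j + 1 ≠ i) : F.dMat i j = 0 := by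
  ext s t
  simp [dMat, F.complex.shape i j h]

theorem dMat_sq (n : ℕ) : F.dMat (n + 2) (n + 1) * F.dMat (n + 1) n = 0 := by
  ext1 s t
  have h := (F.exact_succ n).apply_apply_eq_zero (F.basis (n + 2) s)
  have h2 := F.repr_d (n + 1) n ((F.complex.d (n + 2) (n + 1)).hom (F.basis (n + 2) s))
  rw [h] at h2
  have h3 : (F.dMat (n + 2) (n + 1) * F.dMat (n + 1) n) s t = _ := (congrFun h2 t).symm
  rw [h3]
  simp

/-- Repeated division by `p` extends an element killed by `p` to a compatible sequence `0, m, m/p,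
…` in the inverse limit, which is zero. -/
theorem mul_injective [Fact p.Prime] (hpM : ∀ m : M, ∃ m' : M, p • m' = m)
    (hlim : limTorsion p M = ⊥) (m : M) (hm : p • m = 0) : m = 0 := by
  choose f hf using hpM
  let a : ℕ → M := fun n => Nat.rec 0 (fun k _ => f^[k] m) n
  have ha : a ∈ limTorsion p M := by
    have h1 : ∀ i, p • a (i + 1) = a i := by
      intro i
      cases i with
      | zero => exact hm
      | succ i =>
        change p • f^[i + 1] m = f^[i] m
        rw [Function.iterate_succ_apply', hf]
    refine ⟨fun i => ?_, h1⟩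
    induction i with
    | zero => simp [a]
    | succ i ih => rw [pow_succ, mul_smul, h1, ih]
  rw [hlim, AddSubgroup.mem_bot] at ha
  exact congrFun ha 1

/-- The complex modulo `p` computes `Tor^ℤ(M, 𝔽_p)`. Degree zero vanishes because `p` is surjective
on `M`, degree one because it is injective, and higher degrees because free modules are
torsion-free. Concretely, if `∂x = py` then `y = ∂z`, and `x - pz` is a boundary. -/
theorem exactMod (hpM : ∀ m : M, ∃ m' : M, p • m' = m) (hp : p ≠ 0)
    (hinj : ∀ m : M, p • m = 0 → m = 0) : ExactMod p F.dMat := by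
  have vec : ∀ n (v : Fin (F.rank n) → MonoidAlgebra ℤ Γ), ∃ x, ⇑((F.basis n).repr x) = v :=
    fun n v => ⟨(F.basis n).equivFun.symm v, by
      rw [← Module.Basis.equivFun_apply, LinearEquiv.apply_symm_apply]⟩
  have inj : ∀ n {x y : F.complex.X n}, ⇑((F.basis n).repr x) = (F.basis n).repr y → x = y :=
    fun n x y h => (F.basis n).repr.injective (DFunLike.coe_injective h)
  have tf : ∀ n (x : F.complex.X n), p • x = 0 → x = 0 := by
    intro n x hx
    apply (F.basis n).repr.injective
    ext1 t
    have h := congrArg (fun y => (F.basis n).repr y t) hx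
    rw [map_zero]
    refine MonoidAlgebra.eq_zero_of_nsmul_eq_zero hp (Eq.trans ?_ (h.trans (by rw [map_zero]; rfl)))
    rw [map_nsmul]
    rfl
  have hdd : ∀ n (x : F.complex.X (n + 2)),
      (F.complex.d (n + 1) n).hom ((F.complex.d (n + 2) (n + 1)).hom x) = 0 :=
    fun n x => (F.exact_succ n).apply_apply_eq_zero x
  have key : ∀ n (x : F.complex.X (n + 1)) y, (F.complex.d (n + 1) n).hom x = p • y →
      (∃ z, (F.complex.d (n + 1) n).hom z = y) →
      ∃ z w, (F.basis (n + 1)).repr x =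
        Matrix.vecMul z (F.dMat (n + 2) (n + 1)) + p • w := by
    rintro n x y hxy ⟨z, rfl⟩
    have : (F.complex.d (n + 1) n).hom (x - p • z) = 0 := by rw [map_sub, map_nsmul, hxy, sub_self]
    obtain ⟨w, hw⟩ := (F.exact_succ n _).1 this
    refine ⟨(F.basis (n + 2)).repr w, (F.basis (n + 1)).repr z, ?_⟩
    rw [← F.repr_d, hw, map_sub, map_nsmul]
    ext t
    simp
  refine ⟨F.dMat_sq, fun v => ?_, fun n v y hvy => ?_⟩
  · obtain ⟨x, rfl⟩ := vec 0 v
    obtain ⟨m, hm⟩ := hpM (F.aug x)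
    obtain ⟨y, rfl⟩ := F.aug_surjective m
    have : F.aug (x - p • y) = 0 := by rw [map_sub, map_nsmul, hm, sub_self]
    obtain ⟨z, hz⟩ := (F.exact_aug _).1 this
    refine ⟨(F.basis 1).repr z, (F.basis 0).repr y, ?_⟩
    rw [← F.repr_d, hz, map_sub, map_nsmul]
    ext t
    simp
  · obtain ⟨x, rfl⟩ := vec (n + 1) v
    obtain ⟨y, rfl⟩ := vec n y
    rw [← F.repr_d] at hvy
    have hxy : (F.complex.d (n + 1) n).hom x = p • y := inj n (by
      rw [hvy, map_nsmul]; rfl)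
    refine key n x y hxy ?_
    cases n with
    | zero =>
      refine (F.exact_aug y).1 (hinj _ ?_)
      rw [← map_nsmul, ← hxy]
      exact F.exact_aug.apply_apply_eq_zero x
    | succ n =>
      refine (F.exact_succ n y).1 (tf n _ ?_)
      rw [← map_nsmul, ← hxy, hdd]

variable [Fact p.Prime] {S : ∀ i j, Matrix (Fin (F.rank i)) (Fin (F.rank j)) (GroupRingHat p Γ)}

theorem matContraction_iff : MatContraction (F.dHat p) S ↔ F.IsContraction p S := by
  refine ⟨fun h => ⟨h.degree_one, h.zero, h.succ⟩, fun h => ⟨fun i j hij => ?_, h.degree_one,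
    fun n => ?_, h.zero, h.succ⟩⟩
  · rw [dHat_eq, dMat_eq_zero _ _ _ hij, Matrix.map_zero _ (map_zero _)]
  · rw [dHat_eq, dHat_eq, ← Matrix.map_mul, dMat_sq, Matrix.map_zero _ (map_zero _)]

theorem isAcyclicHat (h : F.IsContraction p S) : F.IsAcyclicHat p := by
  have h' := F.matContraction_iff.2 h
  refine ⟨fun v => ⟨Matrix.vecMul v (S 0 1), ?_⟩, fun n v => ⟨fun hv => ⟨Matrix.vecMul v (S (n + 1) (n + 2)), ?_⟩, ?_⟩⟩
  · simp only [Matrix.vecMul_vecMul, h.zero, Matrix.vecMul_one]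
  · have := congrArg (Matrix.vecMul v) (h.succ n)
    rw [Matrix.vecMul_add, ← Matrix.vecMul_vecMul,
      show Matrix.vecMul v (F.dHat p (n + 1) n) = 0 from hv, Matrix.zero_vecMul, zero_add,
      Matrix.vecMul_one] at this
    simp only [Matrix.vecMul_vecMul, this]
  · rintro ⟨w, rfl⟩
    simp only [Matrix.vecMul_vecMul, h'.sq, Matrix.vecMul_zero]

theorem exists_isTorsion (h : F.IsContraction p S) : ∃ t, F.IsTorsion p t := by
  have h' := F.matContraction_iff.2 h
  have hfin : ∀ n, F.length < n → IsEmpty (Fin (F.rank n)) := fun n hn => by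
    rw [F.rank_eq_zero n hn]; infer_instance
  have f0 : Finite (Σ n, Fin (F.rank n)) := finite_sigma hfin
  have f1 : Finite (Σ k, Fin (F.rank (2 * k + 1))) :=
    finite_sigma (ι := fun k => Fin (F.rank (2 * k + 1))) (d := F.length) fun n hn => hfin _ (by omega)
  have f2 : Finite (Σ k, Fin (F.rank (2 * k))) :=
    finite_sigma (ι := fun k => Fin (F.rank (2 * k))) (d := F.length) fun n hn => hfin _ (by omega)
  have := Fintype.ofFinite (Σ n, Fin (F.rank n))
  have := Fintype.ofFinite (Σ k, Fin (F.rank (2 * k + 1)))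
  have := Fintype.ofFinite (Σ k, Fin (F.rank (2 * k)))
  obtain ⟨W, hW1, hW2⟩ := h'.exists_inv_oddPart
  -- Invariance of rank is checked over `ℤ_p`, to which the completion maps through the trivial
  -- quotient of `Γ`.
  have hcard : Fintype.card (Σ k, Fin (F.rank (2 * k + 1))) =
      Fintype.card (Σ k, Fin (F.rank (2 * k))) := by
    let f := rhoHat p (1 : Γ →* Unit)
    have e1 : blockMap f (oddPart (F.dHat p) S) * blockMap f W = 1 := by
      rw [← blockMap_mul, hW1, blockMap_one]
    have e2 : blockMap f W * blockMap f (oddPart (F.dHat p) S) = 1 := by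
      rw [← blockMap_mul, hW2, blockMap_one]
    have := Matrix.square_of_invertible _ _ e1 e2
    simpa using this
  let e := Fintype.equivFin (Σ k, Fin (F.rank (2 * k + 1)))
  let e' := (Fintype.equivFin (Σ k, Fin (F.rank (2 * k)))).trans (finCongr hcard.symm)
  refine ⟨_, S, _, e, e', ⟨Matrix.reindex e e' (F.oddMatrix p S), Matrix.reindex e' e W, ?_, ?_⟩, h,
    rfl, rfl⟩
  · simp only [Matrix.reindex_apply, Matrix.submatrix_mul_equiv]
    exact (congrArg (fun X => Matrix.submatrix X e.symm e.symm) hW1).trans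
      (Matrix.submatrix_one_equiv _)
  · simp only [Matrix.reindex_apply, Matrix.submatrix_mul_equiv]
    exact (congrArg (fun X => Matrix.submatrix X e'.symm e'.symm) hW2).trans
      (Matrix.submatrix_one_equiv _)

end BasedResolution

end

end PadicTorsion

namespace PadicTorsion

open scoped Topology

noncomputable section

/-! ### Determinants and homology of integral complexes -/

section TriangularDet

/-- The determinant of a matrix that is triangular with diagonal blocks along a grading. -/
theorem det_of_graded_triangular {m K : Type*} [Fintype m] [DecidableEq m] [CommRing K]
    (M : Matrix m m K) (b : m → ℕ) (h : ∀ i j, i ≠ j → M i j ≠ 0 → b i < b j) :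
    M.det = ∏ i, M i i := by
  rw [Matrix.det_apply, Finset.sum_eq_single 1]
  · simp
  · intro σ _ hσ
    suffices h0 : ∃ i, M (σ i) i = 0 by
      obtain ⟨i, hi⟩ := h0
      have h1 : ∏ i, M (σ i) i = 0 := Finset.prod_eq_zero (Finset.mem_univ i) hi
      rw [h1, smul_zero]
    by_contra! h0
    -- A permutation with nonzero contribution never raises `b`, yet it preserves the sum of `b`; a
    -- single moved index would make that sum strictly smaller.
    have hle : ∀ i, b (σ i) ≤ b i := fun i => by
      by_cases hi : σ i = i
      · rw [hi]
      · exact (h _ _ hi (h0 i)).le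
    refine hσ (Equiv.ext fun i => ?_)
    by_contra hi
    exact (Finset.sum_lt_sum (fun i _ => hle i) ⟨i, Finset.mem_univ _, h _ _ hi (h0 i)⟩).ne
      (Equiv.sum_comp σ b)
  · simp

end TriangularDet

/-! ### Determinant of a complex in Smith normal form -/

section NormalForm

/-- The index set in the preceding degree. -/
def prevIdx (h : ℕ → ℕ) : ℕ → Type
  | 0 => Empty
  | n + 1 => Fin (h n)

instance (h : ℕ → ℕ) (n : ℕ) : Fintype (prevIdx h n) := by
  cases n <;> (unfold prevIdx; infer_instance)

instance (h : ℕ → ℕ) (n : ℕ) : DecidableEq (prevIdx h n) := by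
  cases n <;> (unfold prevIdx; infer_instance)

/-- Index set of a basis that consists of a basis of the cycles and of lifts of a basis of the
boundaries. -/
abbrev splitIdx (h : ℕ → ℕ) (n : ℕ) : Type := Fin (h n) ⊕ prevIdx h n

/-- The pairing of the basis elements of odd degree with those of even degree. -/
def pairing (h : ℕ → ℕ) : (Σ k, splitIdx h (2 * k + 1)) ≃ Σ k, splitIdx h (2 * k) where
  toFun
    | ⟨k, Sum.inl a⟩ => ⟨k + 1, Sum.inr a⟩
    | ⟨k, Sum.inr a⟩ => ⟨k, Sum.inl a⟩
  invFun
    | ⟨k, Sum.inl a⟩ => ⟨k, Sum.inr a⟩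
    | ⟨k + 1, Sum.inr a⟩ => ⟨k, Sum.inl a⟩
  left_inv := by rintro ⟨k, a | a⟩ <;> rfl
  right_inv := by
    rintro ⟨k, a | a⟩
    · rfl
    · cases k with
      | zero => exact a.elim
      | succ k => rfl

variable {K : Type*} [Field K] {h : ℕ → ℕ}
  {D S : ∀ i j, Matrix (splitIdx h i) (splitIdx h j) K} {a : ∀ n, Fin (h n) → K}

/-- In bases adapted to cycles and lifted boundaries, the pairing puts the elementary divisors `a n`
of the differentials on the diagonal: those with `n` even through `D`, those with `n` odd inverted
through `S`. The entries of `S` left undetermined only raise the grading, so the determinant ignores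
them. -/
theorem det_oddPart_of_normalForm [Fintype (Σ k, splitIdx h (2 * k + 1))]
    (hDS : MatContraction D S)
    (hl : ∀ n i y, D (n + 1) n (Sum.inl i) y = 0)
    (hr : ∀ n (i : Fin (h n)) y, D (n + 1) n (Sum.inr i) y =
      Sum.elim (fun j => if i = j then a n i else 0) (fun _ => 0) y)
    (ha : ∀ n i, a n i ≠ 0) (N : ℕ) (hN : ∀ n, N ≤ n → IsEmpty (splitIdx h n)) :
    ((oddPart D S).submatrix id (pairing h)).det =
      ∏ n ∈ Finset.range (2 * N), (∏ i, a n i) ^ ((-1 : ℤ) ^ n) := by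
  -- On cycles the homotopy relation reduces to `S D = 1`, which forces this block of `S` to invert
  -- the diagonal block of `D`.
  have hS : ∀ n (i j : Fin (h (n + 1))),
      S (n + 1) (n + 2) (Sum.inl i) (Sum.inr j) = if i = j then (a (n + 1) i)⁻¹ else 0 := by
    intro n i j
    have h1 := congrFun (congrFun (hDS.succ n) (Sum.inl i)) (Sum.inl j)
    rw [Matrix.add_apply, Matrix.mul_apply, Finset.sum_eq_zero (fun y _ => by rw [hl, zero_mul]),
      zero_add, Matrix.mul_apply, Fintype.sum_sum_type,
      Finset.sum_eq_zero (fun y _ => by rw [hl, mul_zero]), zero_add] at h1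
    have h2 : ∑ c : Fin (h (n + 1)), S (n + 1) (n + 2) (Sum.inl i) (Sum.inr c) *
        D (n + 2) (n + 1) (Sum.inr c) (Sum.inl j) =
        (1 : Matrix (splitIdx h (n + 1)) (splitIdx h (n + 1)) K) (Sum.inl i) (Sum.inl j) := h1
    rw [Finset.sum_eq_single j (fun c _ hc => by rw [hr]; simp [hc]) (by simp), hr] at h2
    simp only [Sum.elim_inl, if_true, Matrix.one_apply, Sum.inl.injEq] at h2
    rw [← mul_left_inj' (ha (n + 1) j), h2]
    split_ifs with hij
    · rw [hij, inv_mul_cancel₀ (ha _ _)]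
    · rw [zero_mul]
  -- Each index is graded by the degree `n` of its diagonal entry `a n`.
  rw [det_of_graded_triangular _ (fun x => Sum.elim (fun _ => 2 * x.1 + 1) (fun _ => 2 * x.1) x.2)]
  · have hodd : Finset.univ = (Finset.range N).sigma
        (fun k => (Finset.univ : Finset (splitIdx h (2 * k + 1)))) := by
      ext ⟨k, x⟩
      simp only [Finset.mem_univ, Finset.mem_sigma, Finset.mem_range, and_true, true_iff]
      by_contra hk
      exact (hN (2 * k + 1) (by omega)).false x
    rw [hodd, Finset.prod_sigma]
    have hfac : ∀ k, ∏ x : splitIdx h (2 * k + 1), (oddPart D S).submatrix id (pairing h)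
        ⟨k, x⟩ ⟨k, x⟩ = (∏ i, a (2 * k) i) * (∏ i, a (2 * k + 1) i)⁻¹ := by
      intro k
      rw [Fintype.prod_sum_type, mul_comm]
      congr 1
      · refine Finset.prod_congr rfl fun (i : Fin (h (2 * k))) _ => ?_
        change (D (2 * k + 1) (2 * k) + S (2 * k + 1) (2 * k)) (Sum.inr i) (Sum.inl i) = _
        rw [hDS.degree_one _ _ (by omega), add_zero, hr]
        simp
      · rw [← Finset.prod_inv_distrib]
        refine Finset.prod_congr rfl fun i _ => ?_
        change (D (2 * k + 1) (2 * (k + 1)) + S (2 * k + 1) (2 * (k + 1))) (Sum.inl i) (Sum.inr i) = _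
        rw [hDS.degree_neg _ _ (by omega), zero_add]
        exact (hS (2 * k) i i).trans (if_pos rfl)
    simp only [hfac]
    clear hodd hN hfac
    induction N with
    | zero => simp
    | succ N ih =>
      rw [Finset.prod_range_succ, ih, Nat.mul_succ, Finset.prod_range_succ, Finset.prod_range_succ]
      simp [pow_succ, mul_assoc]
  · rintro ⟨k, i | i⟩ ⟨l, j | j⟩ hij hne
    · change (D (2 * k + 1) (2 * (l + 1)) + S (2 * k + 1) (2 * (l + 1))) (Sum.inl i) (Sum.inr j) ≠ 0
        at hne
      by_cases hk : l = k
      · subst hk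
        rw [hDS.degree_neg _ _ (by omega), zero_add] at hne
        refine absurd ((hS (2 * l) i j).trans (if_neg ?_)) hne
        rintro rfl
        exact hij rfl
      · rw [hDS.degree_one _ _ (by omega), add_zero] at hne
        by_cases hk' : k = l + 1
        · subst hk'
          exact absurd (hl _ _ _) hne
        · rw [hDS.degree_neg _ _ (by omega)] at hne
          exact absurd rfl hne
    · change (D (2 * k + 1) (2 * l) + S (2 * k + 1) (2 * l)) (Sum.inl i) (Sum.inl j) ≠ 0 at hne
      by_cases hk : l = k + 1
      · subst hk
        change 2 * k + 1 < 2 * (k + 1)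
        omega
      · rw [hDS.degree_one _ _ (by omega), add_zero] at hne
        by_cases hk' : k = l
        · subst hk'
          exact absurd (hl _ _ _) hne
        · rw [hDS.degree_neg _ _ (by omega)] at hne
          exact absurd rfl hne
    · change (D (2 * k + 1) (2 * (l + 1)) + S (2 * k + 1) (2 * (l + 1))) (Sum.inr i) (Sum.inr j) ≠ 0
        at hne
      by_cases hk : l = k
      · subst hk
        change 2 * l < 2 * l + 1
        omega
      · rw [hDS.degree_one _ _ (by omega), add_zero] at hne
        by_cases hk' : k = l + 1
        · subst hk'
          exact absurd (hr _ _ _) hne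
        · rw [hDS.degree_neg _ _ (by omega)] at hne
          exact absurd rfl hne
    · change (D (2 * k + 1) (2 * l) + S (2 * k + 1) (2 * l)) (Sum.inr i) (Sum.inl j) ≠ 0 at hne
      by_cases hk : l = k + 1
      · subst hk
        change 2 * k < 2 * (k + 1)
        omega
      · rw [hDS.degree_one _ _ (by omega), add_zero] at hne
        by_cases hk' : k = l
        · subst hk'
          refine absurd ((hr (2 * k) i (Sum.inl j)).trans (if_neg ?_)) hne
          rintro rfl
          exact hij rfl
        · rw [hDS.degree_neg _ _ (by omega)] at hne
          exact absurd rfl hne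

end NormalForm

/-! ### Change of bases in a complex -/

section BaseChange

variable {A : Type*} [CommRing A] {ι κ : ℕ → Type*} [∀ n, Fintype (ι n)] [∀ n, DecidableEq (ι n)]
  [∀ n, Fintype (κ n)] [∀ n, DecidableEq (κ n)]

/-- A family of matrices as a block diagonal matrix. -/
def sigmaDiag (X : ∀ n, Matrix (κ n) (ι n) A) : Matrix (Σ n, κ n) (Σ n, ι n) A :=
  fun x y => if h : x.1 = y.1 then X y.1 (h ▸ x.2) y.2 else 0

theorem sigmaDiag_same (X : ∀ n, Matrix (κ n) (ι n) A) (n : ℕ) (s : κ n) (t : ι n) :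
    sigmaDiag X ⟨n, s⟩ ⟨n, t⟩ = X n s t := by simp [sigmaDiag]

theorem sigmaDiag_ne (X : ∀ n, Matrix (κ n) (ι n) A) {x y} (h : x.1 ≠ y.1) :
    sigmaDiag X x y = 0 := by simp [sigmaDiag, h]

theorem sigmaDiag_map {B : Type*} [CommRing B] (f : A →+* B) (X : ∀ n, Matrix (κ n) (ι n) A) :
    (sigmaDiag X).map f = sigmaDiag fun n => (X n).map f := by
  ext ⟨n, s⟩ ⟨m, t⟩
  by_cases h : n = m
  · subst h
    simp [sigmaDiag_same]
  · simp [sigmaDiag, h]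

theorem sigmaDiag_mul_apply [Fintype (Σ n, ι n)] {J : Type*} (X : ∀ n, Matrix (κ n) (ι n) A)
    (T : Matrix (Σ n, ι n) J A) (n : ℕ) (s : κ n) (y : J) :
    (sigmaDiag X * T) ⟨n, s⟩ y = ∑ t, X n s t * T ⟨n, t⟩ y := by
  rw [Matrix.mul_apply, sum_sigma_eq n]
  · simp only [sigmaDiag_same]
  · intro x hx
    rw [sigmaDiag_ne _ (Ne.symm hx), zero_mul]

theorem mul_sigmaDiag_apply [Fintype (Σ n, κ n)] {J : Type*} (X : ∀ n, Matrix (κ n) (ι n) A)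
    (T : Matrix J (Σ n, κ n) A) (n : ℕ) (t : ι n) (y : J) :
    (T * sigmaDiag X) y ⟨n, t⟩ = ∑ s, T y ⟨n, s⟩ * X n s t := by
  rw [Matrix.mul_apply, sum_sigma_eq n]
  · simp only [sigmaDiag_same]
  · intro x hx
    rw [sigmaDiag_ne _ hx, mul_zero]

theorem sigmaDiag_mul_eq_one [Fintype (Σ n, ι n)] {X : ∀ n, Matrix (κ n) (ι n) A}
    {Y : ∀ n, Matrix (ι n) (κ n) A} (h : ∀ n, X n * Y n = 1) : sigmaDiag X * sigmaDiag Y = 1 := by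
  ext ⟨n, s⟩ ⟨m, t⟩
  rw [sigmaDiag_mul_apply]
  by_cases hnm : n = m
  · subst hnm
    simp only [sigmaDiag_same, ← Matrix.mul_apply, h]
    simp [Matrix.one_apply]
  · have : ¬ (⟨n, s⟩ : Σ n, κ n) = ⟨m, t⟩ := fun e => hnm (congrArg Sigma.fst e)
    simp [sigmaDiag, hnm, Matrix.one_apply, this]

variable {D S : ∀ i j, Matrix (ι i) (ι j) A} {X : ∀ n, Matrix (κ n) (ι n) A}
  {Y : ∀ n, Matrix (ι n) (κ n) A}

theorem MatContraction.conj (h : MatContraction D S) (hXY : ∀ n, X n * Y n = 1)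
    (hYX : ∀ n, Y n * X n = 1) :
    MatContraction (fun i j => X i * D i j * Y j) (fun i j => X i * S i j * Y j) := by
  have key : ∀ i j k (P : Matrix (ι i) (ι j) A) (Q : Matrix (ι j) (ι k) A),
      X i * P * Y j * (X j * Q * Y k) = X i * (P * Q) * Y k := by
    intro i j k P Q
    calc X i * P * Y j * (X j * Q * Y k) = X i * P * (Y j * X j) * Q * Y k := by
          simp only [Matrix.mul_assoc]
      _ = _ := by rw [hYX, Matrix.mul_one, Matrix.mul_assoc (X i)]
  refine ⟨fun i j hij => ?_, fun i j hij => ?_, fun n => ?_, ?_, fun n => ?_⟩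
  · simp only [h.degree_neg i j hij, Matrix.mul_zero, Matrix.zero_mul]
  · simp only [h.degree_one i j hij, Matrix.mul_zero, Matrix.zero_mul]
  · simp only [key, h.sq, Matrix.mul_zero, Matrix.zero_mul]
  · simp only [key, h.zero, Matrix.mul_one, hXY]
  · simp only [key, ← Matrix.mul_add, ← Matrix.add_mul, h.succ, Matrix.mul_one, hXY]

theorem oddPart_conj [Fintype (Σ k, ι (2 * k + 1))] [Fintype (Σ k, ι (2 * k))] :
    oddPart (fun i j => X i * D i j * Y j) (fun i j => X i * S i j * Y j) =
      sigmaDiag (fun k => X (2 * k + 1)) * oddPart D S * sigmaDiag (fun k => Y (2 * k)) := by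
  ext ⟨k, s⟩ ⟨l, t⟩
  rw [mul_sigmaDiag_apply (ι := fun k => κ (2 * k)) (κ := fun k => ι (2 * k))]
  simp only [sigmaDiag_mul_apply (ι := fun k => ι (2 * k + 1)) (κ := fun k => κ (2 * k + 1))]
  change (X (2 * k + 1) * D (2 * k + 1) (2 * l) * Y (2 * l) +
    X (2 * k + 1) * S (2 * k + 1) (2 * l) * Y (2 * l)) s t = _
  rw [← Matrix.add_mul, ← Matrix.mul_add]
  rfl

theorem reindex_mul_reindex {l m n l' m' n' : Type*} [Fintype m] [Fintype m'] (P : Matrix l m A)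
    (Q : Matrix m n A) (e : l ≃ l') (f : m ≃ m') (g : n ≃ n') :
    Matrix.reindex e g (P * Q) = Matrix.reindex e f P * Matrix.reindex f g Q := by
  simp only [Matrix.reindex_apply, Matrix.submatrix_mul_equiv]

/-- An integral matrix with an integral inverse has a unit as determinant. Integral base changes and
reorderings therefore affect the determinant of the complex by a sign only. -/
theorem det_reindex_of_inv {m n J : Type*} [Fintype m] [Fintype n] [DecidableEq m] [DecidableEq n]
    [Fintype J] [DecidableEq J] {P : Matrix m n ℤ} {Q : Matrix n m ℤ} (h : P * Q = 1)
    (e : m ≃ J) (f : n ≃ J) :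
    (Matrix.reindex e f P).det = 1 ∨ (Matrix.reindex e f P).det = -1 := by
  have h1 : Matrix.reindex e f P * Matrix.reindex f e Q = 1 := by
    rw [← reindex_mul_reindex, h]
    simp
  have h2 := congrArg Matrix.det h1
  rw [Matrix.det_mul, Matrix.det_one] at h2
  exact Int.isUnit_iff.1 (IsUnit.of_mul_eq_one _ h2)

end BaseChange

/-! ### Smith normal form and homology of integral complexes -/

section IntegralComplex

variable {ι : ℕ → Type*} [∀ n, Fintype (ι n)] [∀ n, DecidableEq (ι n)]

/-- The cycles of a complex given by matrices. -/
def cycles (D : ∀ i j, Matrix (ι i) (ι j) ℤ) (n : ℕ) : Submodule ℤ (ι n → ℤ) :=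
  LinearMap.ker (D n (n - 1)).vecMulLinear

/-- The boundaries of a complex given by matrices. -/
def boundaries (D : ∀ i j, Matrix (ι i) (ι j) ℤ) (n : ℕ) : Submodule ℤ (ι n → ℤ) :=
  LinearMap.range (D (n + 1) n).vecMulLinear

/-- The homology of a complex given by matrices. -/
abbrev matHomology (D : ∀ i j, Matrix (ι i) (ι j) ℤ) (n : ℕ) : Type _ :=
  cycles D n ⧸ (boundaries D n).submoduleOf (cycles D n)

variable {D : ∀ i j, Matrix (ι i) (ι j) ℤ}

theorem mem_cycles {n : ℕ} {x : ι n → ℤ} :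
    x ∈ cycles D n ↔ Matrix.vecMul x (D n (n - 1)) = 0 := by
  rw [cycles, LinearMap.mem_ker, Matrix.vecMulLinear_apply]

theorem mem_boundaries {n : ℕ} {x : ι n → ℤ} :
    x ∈ boundaries D n ↔ ∃ y, Matrix.vecMul y (D (n + 1) n) = x := Iff.rfl

theorem boundaries_le_cycles (hneg : ∀ i j, j + 1 ≠ i → D i j = 0)
    (hsq : ∀ n, D (n + 2) (n + 1) * D (n + 1) n = 0) (n : ℕ) : boundaries D n ≤ cycles D n := by
  rintro _ ⟨y, rfl⟩
  rw [mem_cycles, Matrix.vecMulLinear_apply, Matrix.vecMul_vecMul]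
  cases n with
  -- Here `0 - 1 = 0` and `D 0 0` vanishes for degree reasons, so every chain of degree zero is a
  -- cycle.
  | zero => rw [hneg 0 (0 - 1) (by omega), Matrix.mul_zero, Matrix.vecMul_zero]
  | succ n => exact (congrArg (Matrix.vecMul y) (hsq n)).trans (Matrix.vecMul_zero _)

/-- Adapted bases of a finite free `ℤ`-module and of a submodule of finite index. -/
theorem exists_adapted_bases {J : Type*} [Finite J] {Z B : Submodule ℤ (J → ℤ)} (hBZ : B ≤ Z)
    [hfin : Finite (Z ⧸ B.submoduleOf Z)] :
    ∃ (h : ℕ) (β : Module.Basis (Fin h) ℤ Z) (a : Fin h → ℤ) (γ : Module.Basis (Fin h) ℤ B),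
      (∀ i, (γ i : J → ℤ) = a i • (β i : J → ℤ)) ∧ (∀ i, a i ≠ 0) ∧
      (∏ i, a i).natAbs = Nat.card (Z ⧸ B.submoduleOf Z) := by
  obtain ⟨h, β⟩ := Submodule.basisOfPid (Pi.basisFun ℤ J) Z
  have := Module.Free.of_basis β
  have := Module.Finite.of_basis β
  have hr := (Submodule.finiteQuotient_iff (B.submoduleOf Z)).1 hfin
  refine ⟨h, Submodule.smithNormalFormTopBasis β hr, Submodule.smithNormalFormCoeffs β hr,
    (Submodule.smithNormalFormBotBasis β hr).map (Submodule.submoduleOfEquivOfLe hBZ), fun i => ?_,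
    Submodule.smithNormalFormCoeffs_ne_zero β hr, ?_⟩
  · exact congrArg Subtype.val (Submodule.smithNormalFormBotBasis_def β hr i)
  · rw [Nat.card_congr (Submodule.quotientEquivPiZMod _ β hr).toEquiv, Nat.card_pi]
    simp_rw [Nat.card_zmod]
    exact map_prod Int.natAbsHom _ _

/-- A basis of the kernel of a linear map and lifts of a basis of the range form a basis. -/
theorem exists_basis_of_ker_range {R V W I J : Type*} [Ring R] [AddCommGroup V] [Module R V]
    [AddCommGroup W] [Module R W] [Fintype I] [Fintype J] (f : V →ₗ[R] W)
    (β : Module.Basis I R (LinearMap.ker f)) (γ : Module.Basis J R (LinearMap.range f)) :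
    ∃ c : Module.Basis (I ⊕ J) R V, (∀ i, c (Sum.inl i) = β i) ∧ ∀ j, f (c (Sum.inr j)) = γ j := by
  choose σ hσ using fun j => (γ j).2
  have hβ : ∀ i, f (β i) = 0 := fun i => (β i).2
  let v : I ⊕ J → V := Sum.elim (fun i => β i) σ
  have hfv : ∀ g : I ⊕ J → R, f (∑ x, g x • v x) = ∑ j, g (Sum.inr j) • (γ j : W) := fun g => by
    simp [v, hβ, hσ]
  have hli : LinearIndependent R v := by
    rw [Fintype.linearIndependent_iff]
    intro g hg
    have h1 : ∀ j, g (Sum.inr j) = 0 := by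
      refine Fintype.linearIndependent_iff.1 γ.linearIndependent _ (Subtype.ext ?_)
      have := hfv g
      rw [hg, map_zero] at this
      simpa using this.symm
    have h2 : ∀ i, g (Sum.inl i) = 0 := by
      refine Fintype.linearIndependent_iff.1 β.linearIndependent (fun i => g (Sum.inl i))
        (Subtype.ext ?_)
      simpa [h1, v] using hg
    rintro (i | j)
    exacts [h2 i, h1 j]
  have hsp : ⊤ ≤ Submodule.span R (Set.range v) := by
    rintro x -
    let y : LinearMap.range f := ⟨f x, x, rfl⟩
    have hy : x - ∑ j, γ.repr y j • σ j ∈ LinearMap.ker f := by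
      rw [LinearMap.mem_ker, map_sub, sub_eq_zero, map_sum]
      have := congrArg Subtype.val (γ.sum_repr y)
      rw [Submodule.coe_sum] at this
      simp only [map_smul, hσ]
      exact this.symm
    have h1 := congrArg Subtype.val (β.sum_repr ⟨_, hy⟩)
    rw [Submodule.coe_sum] at h1
    rw [← sub_add_cancel x (∑ j, γ.repr y j • σ j)]
    refine add_mem ?_ (sum_mem fun j _ => Submodule.smul_mem _ _ (Submodule.subset_span
      ⟨Sum.inr j, rfl⟩))
    simp only at h1
    rw [← h1]
    exact sum_mem fun i _ => Submodule.smul_mem _ _ (Submodule.subset_span ⟨Sum.inl i, rfl⟩)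
  refine ⟨Module.Basis.mk hli hsp, fun i => ?_, fun j => ?_⟩
  · rw [Module.Basis.mk_apply]; rfl
  · rw [Module.Basis.mk_apply]; exact hσ j

/-- Bases in which the differentials of an integral complex with finite homology are diagonal. -/
theorem exists_diagonalization (hneg : ∀ i j, j + 1 ≠ i → D i j = 0)
    (hsq : ∀ n, D (n + 2) (n + 1) * D (n + 1) n = 0) (hfin : ∀ n, Finite (matHomology D n)) :
    ∃ (h : ℕ → ℕ) (a : ∀ n, Fin (h n) → ℤ) (X : ∀ n, Matrix (splitIdx h n) (ι n) ℤ)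
      (Y : ∀ n, Matrix (ι n) (splitIdx h n) ℤ),
      (∀ n, X n * Y n = 1) ∧ (∀ n, Y n * X n = 1) ∧ (∀ n i, a n i ≠ 0) ∧
      (∀ n, (∏ i, a n i).natAbs = Nat.card (matHomology D n)) ∧
      (∀ n i y, (X (n + 1) * D (n + 1) n * Y n) (Sum.inl i) y = 0) ∧
      (∀ n (i : Fin (h n)) y, (X (n + 1) * D (n + 1) n * Y n) (Sum.inr i) y =
        Sum.elim (fun j => if i = j then a n i else 0) (fun _ => 0) y) := by
  choose h β a γ hγ ha hcard using fun n =>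
    exists_adapted_bases (boundaries_le_cycles hneg hsq n) (hfin := hfin n)
  -- The cycle basis in each degree is extended by lifts of the boundaries `a • β` one degree below;
  -- degree zero has nothing to lift.
  have hb : ∀ n, ∃ c : Module.Basis (splitIdx h n) ℤ (ι n → ℤ),
      (∀ i, c (Sum.inl i) = β n i) ∧ match n, c with
        | 0, _ => True
        | n + 1, c => ∀ j : Fin (h n), Matrix.vecMul (c (Sum.inr j)) (D (n + 1) n) =
            a n j • (β n j : ι n → ℤ) := by
    rintro (_ | n)
    · have hD : (D 0 (0 - 1)).vecMulLinear = 0 := by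
        ext x
        simp [hneg 0 (0 - 1)]
      have hs : Subsingleton (LinearMap.range (D 0 (0 - 1)).vecMulLinear) := by
        rw [hD, LinearMap.range_zero]
        infer_instance
      obtain ⟨c, hc, -⟩ := exists_basis_of_ker_range _ (β 0)
        (Module.Basis.empty (LinearMap.range (D 0 (0 - 1)).vecMulLinear) (ι := Empty))
      exact ⟨c, hc, trivial⟩
    · obtain ⟨c, hc, hc'⟩ := exists_basis_of_ker_range (D (n + 1) n).vecMulLinear (β (n + 1)) (γ n)
      exact ⟨c, hc, fun j => (hc' j).trans (hγ n j)⟩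
  choose c hc hc' using hb
  have hY : ∀ n (v : ι n → ℤ), Matrix.vecMul v
      (Matrix.of fun t => ⇑((c n).repr (Pi.single t 1))) = (c n).repr v := by
    intro n v
    have hv : v = ∑ t, v t • (Pi.single t 1 : ι n → ℤ) := by
      ext t
      simp [Finset.sum_apply, Pi.single_apply]
    conv_rhs => rw [hv, map_sum]
    ext x
    simp only [map_smul, Finsupp.finsetSum_apply, Finsupp.smul_apply, smul_eq_mul, Matrix.vecMul,
      dotProduct, Matrix.of_apply]
  refine ⟨h, a, fun n => Matrix.of fun x => c n x,
    fun n => Matrix.of fun t => (c n).repr (Pi.single t 1), fun n => ?_, fun n => ?_, ha, hcard,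
    fun n i y => ?_, fun n i y => ?_⟩
  · ext x y
    rw [matrix_mul_row]
    change Matrix.vecMul (c n x) _ y = _
    rw [hY]
    simp [Matrix.one_apply, Finsupp.single_apply]
  · ext t u
    have := congrFun ((c n).sum_repr (Pi.single t 1)) u
    rw [Finset.sum_apply] at this
    rw [Matrix.mul_apply, Matrix.one_apply]
    simp only [Pi.smul_apply, Pi.single_apply, smul_eq_mul] at this
    simp only [Matrix.of_apply, this, eq_comm]
  · rw [matrix_mul_row, matrix_mul_row]
    change Matrix.vecMul (Matrix.vecMul (c (n + 1) (Sum.inl i)) _) _ y = _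
    rw [hc, show Matrix.vecMul (β (n + 1) i : ι (n + 1) → ℤ) (D (n + 1) n) = 0 from
      mem_cycles.1 (β (n + 1) i).2, Matrix.zero_vecMul]
    rfl
  · rw [matrix_mul_row, matrix_mul_row]
    change Matrix.vecMul (Matrix.vecMul (c (n + 1) (Sum.inr i)) _) _ y = _
    rw [show Matrix.vecMul (c (n + 1) (Sum.inr i)) (D (n + 1) n) = a n i • (β n i : ι n → ℤ) from
      hc' (n + 1) i, hY, ← hc, map_smul, Module.Basis.repr_self]
    rcases y with j | j <;> simp [Finsupp.single_apply]

/-- The determinant of the odd part of a rationally contractible integral complex is, up to sign,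
the multiplicative Euler characteristic of its homology. -/
theorem det_oddPart_eq (K : Type*) [Field K] [CharZero K]
    [Fintype (Σ k, ι (2 * k + 1))] [Fintype (Σ k, ι (2 * k))]
    {S : ∀ i j, Matrix (ι i) (ι j) K}
    (hDS : MatContraction (fun i j => (D i j).map (Int.castRingHom K)) S)
    (hneg : ∀ i j, j + 1 ≠ i → D i j = 0)
    (hsq : ∀ n, D (n + 2) (n + 1) * D (n + 1) n = 0) (hfin : ∀ n, Finite (matHomology D n))
    {N : ℕ} (hN : ∀ n, N ≤ n → IsEmpty (ι n)) {J : Type*} [Fintype J] [DecidableEq J]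
    (e : (Σ k, ι (2 * k + 1)) ≃ J) (e' : (Σ k, ι (2 * k)) ≃ J) :
    let χ : K := ∏ n ∈ Finset.range (2 * N), (Nat.card (matHomology D n) : K) ^ ((-1 : ℤ) ^ n)
    let δ := (Matrix.reindex e e' (oddPart (fun i j => (D i j).map (Int.castRingHom K)) S)).det
    δ = χ ∨ δ = -χ := by
  obtain ⟨h, a, X, Y, hXY, hYX, ha, hcard, hl, hr⟩ := exists_diagonalization hneg hsq hfin
  intro χ δ
  -- Squaring discards all signs, from base changes, orderings and the elementary divisors alike.
  rw [← sq_eq_sq_iff_eq_or_eq_neg]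
  set f := Int.castRingHom K
  have hemp : ∀ n, N ≤ n → IsEmpty (splitIdx h n) := fun n hn => ⟨fun x => by
    have := hN n hn
    have h1 := congrFun (congrFun (hXY n) x) x
    rw [Matrix.mul_apply, Finset.univ_eq_empty, Finset.sum_empty, Matrix.one_apply_eq] at h1
    exact zero_ne_one h1⟩
  have : Finite (Σ k, splitIdx h (2 * k + 1)) := finite_sigma (ι := fun k => splitIdx h (2 * k + 1))
    (d := N) fun n hn => hemp _ (by omega)
  have := Fintype.ofFinite (Σ k, splitIdx h (2 * k + 1))
  have := Fintype.ofEquiv _ (pairing h)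
  have hXYK : ∀ n, (X n).map f * (Y n).map f = 1 := fun n => by
    rw [← Matrix.map_mul, hXY, Matrix.map_one _ (map_zero f) (map_one f)]
  have hYXK : ∀ n, (Y n).map f * (X n).map f = 1 := fun n => by
    rw [← Matrix.map_mul, hYX, Matrix.map_one _ (map_zero f) (map_one f)]
  have hconj : ∀ i j, (X i).map f * (D i j).map f * (Y j).map f = (X i * D i j * Y j).map f :=
    fun i j => by rw [Matrix.map_mul, Matrix.map_mul]
  have hdet := det_oddPart_of_normalForm (h := h) (a := fun n i => f (a n i)) (hDS.conj hXYK hYXK)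
    (fun n i y => by rw [hconj, Matrix.map_apply, hl, map_zero])
    (fun n i y => by
      rw [hconj, Matrix.map_apply, hr]
      rcases y with j | j <;> simp [apply_ite f])
    (fun n i => by simpa [f] using ha n i) N hemp
  have hXo := sigmaDiag_mul_eq_one (ι := fun k => ι (2 * k + 1))
    (κ := fun k => splitIdx h (2 * k + 1)) (fun k => hXY (2 * k + 1))
  have hYo := sigmaDiag_mul_eq_one (ι := fun k => splitIdx h (2 * k + 1))
    (κ := fun k => ι (2 * k + 1)) (fun k => hYX (2 * k + 1))
  have hYe := sigmaDiag_mul_eq_one (ι := fun k => splitIdx h (2 * k))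
    (κ := fun k => ι (2 * k)) (fun k => hYX (2 * k))
  -- The two odd index sets have equal size because an invertible base change relates them. The even
  -- ordering `f₁` is then taken through `pairing`, so that the reindexed matrix is the triangular
  -- one.
  let e₁ : (Σ k, splitIdx h (2 * k + 1)) ≃ J :=
    (Fintype.equivOfCardEq (Matrix.square_of_invertible _ _ hXo hYo)).trans e
  let f₁ : (Σ k, splitIdx h (2 * k)) ≃ J := (pairing h).symm.trans e₁
  have hre : Matrix.reindex e₁ f₁ (oddPart
      (fun i j => (X i).map f * (D i j).map f * (Y j).map f)
      (fun i j => (X i).map f * S i j * (Y j).map f)) = _ := congrArg (Matrix.reindex e₁ f₁) oddPart_conj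
  rw [reindex_mul_reindex _ _ e₁ e' f₁, reindex_mul_reindex _ _ e₁ e e'] at hre
  have hone : ∀ P : Matrix J J ℤ, P.det = 1 ∨ P.det = -1 → (P.map f).det ^ 2 = 1 := by
    intro P hP
    have : (P.map f).det = f P.det := (f.map_det P).symm
    rw [this]
    rcases hP with hP | hP <;> simp [hP]
  have h1 := congrArg (fun P => Matrix.det P ^ 2) hre
  simp only [Matrix.det_mul, mul_pow] at h1
  have g1 : (Matrix.reindex e₁ e (sigmaDiag fun k => (X (2 * k + 1)).map f)).det ^ 2 = 1 := by
    rw [← sigmaDiag_map f (fun k => X (2 * k + 1))]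
    exact hone _ (det_reindex_of_inv hXo e₁ e)
  have g2 : (Matrix.reindex e' f₁ (sigmaDiag fun k => (Y (2 * k)).map f)).det ^ 2 = 1 := by
    rw [← sigmaDiag_map f (fun k => Y (2 * k))]
    exact hone _ (det_reindex_of_inv hYe e' f₁)
  rw [g1, g2, one_mul, mul_one] at h1
  refine h1.symm.trans ?_
  rw [← Matrix.det_submatrix_equiv_self e₁.symm] at hdet
  have h2 : (Matrix.reindex e₁ f₁ (oddPart
      (fun i j => (X i).map f * (D i j).map f * (Y j).map f)
      (fun i j => (X i).map f * S i j * (Y j).map f))).det =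
      ∏ n ∈ Finset.range (2 * N), (∏ i, f (a n i)) ^ ((-1 : ℤ) ^ n) := hdet
  rw [h2, ← Finset.prod_pow, ← Finset.prod_pow]
  refine Finset.prod_congr rfl fun n _ => ?_
  rw [← zpow_natCast, ← zpow_natCast, zpow_comm, zpow_comm _ _ ((2 : ℕ) : ℤ)]
  congr 1
  rw [← map_prod, zpow_natCast, zpow_natCast, ← hcard, ← map_pow]
  rw [map_pow, map_prod, ← Int.cast_natCast, ← Int.cast_pow, Int.natAbs_sq,
    Int.cast_pow, Int.cast_prod]
  rfl

end IntegralComplex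

end

end PadicTorsion

namespace PadicTorsion

open scoped Topology

noncomputable section

/-! ### Homology of induced representations -/

section Vanishing

open CategoryTheory

universe u

variable {k G : Type u} [CommRing k] [Group G] {A : Rep.{u} k G}

theorem contractNth_zero_cons {α : Type*} {n : ℕ} (op : α → α → α) (a : α) (g : Fin (n + 1) → α) :
    Fin.contractNth 0 op (Fin.cons a g : Fin (n + 2) → α) =
      (Fin.cons (op a (g 0)) fun i => g i.succ : Fin (n + 1) → α) := by
  funext i
  refine Fin.cases ?_ (fun i => ?_) i
  · rw [Fin.contractNth_apply_of_eq _ _ _ _ rfl]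
    rfl
  · rw [Fin.contractNth_apply_of_gt _ _ _ _ (by simp)]
    rfl

theorem contractNth_succ_cons {α : Type*} {n : ℕ} (op : α → α → α) (a : α) (g : Fin (n + 1) → α)
    (j : Fin (n + 1)) :
    Fin.contractNth j.succ op (Fin.cons a g : Fin (n + 2) → α) =
      (Fin.cons a (Fin.contractNth j op g) : Fin (n + 1) → α) := by
  funext i
  refine Fin.cases ?_ (fun i => ?_) i
  · rw [Fin.contractNth_apply_of_lt _ _ _ _ (by simp)]
    rfl
  · rw [Fin.cons_succ]
    rcases lt_trichotomy (i : ℕ) j with h | h | h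
    · rw [Fin.contractNth_apply_of_lt _ _ _ _ h, Fin.contractNth_apply_of_lt _ _ _ _ (by simpa)]
      rfl
    · rw [Fin.contractNth_apply_of_eq _ _ _ _ h, Fin.contractNth_apply_of_eq _ _ _ _ (by simpa)]
      rfl
    · rw [Fin.contractNth_apply_of_gt _ _ _ _ h, Fin.contractNth_apply_of_gt _ _ _ _ (by simpa)]
      rfl

/-- Prolongation of chains by a new first entry. -/
def consChain (A : Rep.{u} k G) {n : ℕ} (g : Fin n → G) :
    (G →₀ A) →ₗ[k] ((Fin (n + 1) → G) →₀ A) :=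
  Finsupp.lsum k fun δ => Finsupp.lsingle (Fin.cons δ⁻¹ g : Fin (n + 1) → G)

theorem consChain_single {n : ℕ} (g : Fin n → G) (δ : G) (a : A) :
    consChain A g (Finsupp.single δ a) = Finsupp.single (Fin.cons δ⁻¹ g : Fin (n + 1) → G) a := by
  simp [consChain]

/-- The first face makes the new entry `δ⁻¹` act, and the inverse in `Representation`-chains turns
this into the action of `δ`. The other faces involve the old entries, so prolongation is almost a
contracting homotopy of the bar complex. -/
theorem d_consChain {n : ℕ} (g : Fin (n + 1) → G) (u : G →₀ A) :
    groupHomology.inhomogeneousChains.d A (n + 1) (consChain A g u) =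
      Finsupp.single g (Finsupp.lsum k (fun δ => A.ρ δ) u) -
        (consChain A (fun i => g i.succ) (u.mapDomain ((g 0)⁻¹ * ·)) +
          ∑ j : Fin (n + 1), (-1 : k) ^ ((j : ℕ) + 1) • consChain A (Fin.contractNth j (· * ·) g) u) := by
  induction u using Finsupp.induction_linear with
  | zero => simp
  | add u v hu hv =>
    rw [map_add, map_add, hu, hv, map_add, Finsupp.mapDomain_add, map_add, Finsupp.single_add]
    simp only [map_add, smul_add, Finset.sum_add_distrib]
    abel
  | single δ a =>
    rw [consChain_single, groupHomology.inhomogeneousChains.d_single, Fin.sum_univ_succ,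
      Finsupp.mapDomain_single, consChain_single, contractNth_zero_cons]
    simp only [contractNth_succ_cons, consChain_single, Fin.cons_succ, Fin.cons_zero, inv_inv,
      Fin.val_zero, Fin.val_succ, pow_succ, mul_neg, mul_one, neg_smul, neg_neg, mul_inv_rev,
      Finset.sum_neg_distrib, pow_zero, one_smul, Finsupp.lsum_single]
    abel

/-- The map `E` exhibits `A` as an equivariant retract of an induced module. Prolonging the chain
`(g, x)` by the components of `E x` contracts the inhomogeneous complex in positive degrees. -/
theorem isZero_groupHomology_of_induced (E : A →ₗ[k] (G →₀ A))
    (hE : ∀ x, Finsupp.lsum k (fun δ => A.ρ δ) (E x) = x)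
    (hE' : ∀ g x, E (A.ρ g x) = (E x).mapDomain (g * ·)) (n : ℕ) :
    Limits.IsZero (groupHomology A (n + 1)) := by
  let H : ∀ n, ((Fin n → G) →₀ A) →ₗ[k] ((Fin (n + 1) → G) →₀ A) := fun n =>
    Finsupp.lsum k fun g => consChain A g ∘ₗ E
  have hH : ∀ n (g : Fin n → G) x, H n (Finsupp.single g x) = consChain A g (E x) := fun n g x => by
    simp [H]
  have key : ∀ c : (Fin (n + 1) → G) →₀ A,
      groupHomology.inhomogeneousChains.d A (n + 1) (H (n + 1) c) +
        H n (groupHomology.inhomogeneousChains.d A n c) = c := by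
    intro c
    induction c using Finsupp.induction_linear with
    | zero => simp
    | add c c' h h' =>
      conv_rhs => rw [← h, ← h']
      simp only [map_add]
      abel
    | single g x =>
      rw [hH, d_consChain, hE, groupHomology.inhomogeneousChains.d_single, map_add, hH, hE', map_sum]
      simp only [map_smul, hH]
      abel
  refine (HomologicalComplex.exactAt_iff_isZero_homology _ _).1 ?_
  rw [HomologicalComplex.exactAt_iff' _ (n + 2) (n + 1) n (by simp) (by simp),
    ShortComplex.moduleCat_exact_iff]
  intro c hc
  refine ⟨H (n + 1) c, ?_⟩
  have hc' : groupHomology.inhomogeneousChains.d A n c = 0 := by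
    rw [← groupHomology.inhomogeneousChains.d_def]; exact hc
  have := key c
  rw [hc', map_zero, add_zero, ← groupHomology.inhomogeneousChains.d_def] at this
  exact this

end Vanishing

theorem rep_exact {k G : Type} [CommRing k] [Group G] {X : CategoryTheory.ShortComplex (Rep.{0} k G)}
    (h : ∀ y, X.g.hom y = 0 → ∃ x, X.f.hom x = y) : X.Exact := by
  rw [← CategoryTheory.ShortComplex.exact_map_iff_of_faithful _
    (CategoryTheory.forget₂ (Rep.{0} k G) (ModuleCat.{0} k)),
    CategoryTheory.ShortComplex.moduleCat_exact_iff]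
  exact h

theorem addMonoidHom_ext_of_basis {Γ : Type*} [Group Γ] {X N : Type*} [AddCommGroup X]
    [Module (MonoidAlgebra ℤ Γ) X] [AddCommGroup N] {I : Type*} [Fintype I]
    (b : Module.Basis I (MonoidAlgebra ℤ Γ) X) {f g : X →+ N}
    (h : ∀ (i : I) (γ : Γ) (n : ℤ), f (MonoidAlgebra.single γ n • b i) = g (MonoidAlgebra.single γ n • b i)) :
    f = g := by
  ext x
  rw [← b.sum_repr x, map_sum, map_sum]
  refine Finset.sum_congr rfl fun i _ => ?_
  exact DFunLike.congr_fun (MonoidAlgebra.addMonoidHom_ext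
    (f := f.comp ((smulAddHom (MonoidAlgebra ℤ Γ) X).flip (b i)))
    (g := g.comp ((smulAddHom (MonoidAlgebra ℤ Γ) X).flip (b i))) fun γ n => h i γ n) (b.repr x i)

/-! ### Free modules over the group ring restricted to a normal subgroup -/

section Restriction

open CategoryTheory

variable {Γ : Type} [Group Γ] (Δ : Subgroup Γ)

/-- The restriction to a subgroup `Δ` of a module over the group ring. -/
abbrev resRep (X : Type) [AddCommGroup X] [Module (MonoidAlgebra ℤ Γ) X] : Rep.{0} ℤ Δ :=
  Rep.of ((Representation.ofModule' (k := ℤ) (G := Γ) X).comp Δ.subtype)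

variable {X Y Z : Type} [AddCommGroup X] [Module (MonoidAlgebra ℤ Γ) X] [AddCommGroup Y]
  [Module (MonoidAlgebra ℤ Γ) Y] [AddCommGroup Z] [Module (MonoidAlgebra ℤ Γ) Z]

theorem resRep_ρ (δ : Δ) (x : X) :
    (resRep Δ X).ρ δ x = (MonoidAlgebra.single (δ : Γ) (1 : ℤ) • x : X) := rfl

/-- A linear map as a map of representations of a subgroup. -/
def resHom (f : X →ₗ[MonoidAlgebra ℤ Γ] Y) : resRep Δ X ⟶ resRep Δ Y :=
  Rep.ofHom ⟨f.toAddMonoidHom.toIntLinearMap, fun δ => by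
    ext x
    exact f.map_smul (MonoidAlgebra.single (δ : Γ) (1 : ℤ)) x⟩

theorem shortExact_resHom {f : X →ₗ[MonoidAlgebra ℤ Γ] Y} {g : Y →ₗ[MonoidAlgebra ℤ Γ] Z}
    (hf : Function.Injective f) (hfg : Function.Exact f g) (hg : Function.Surjective g) :
    (ShortComplex.mk (resHom Δ f) (resHom Δ g)
      (by ext x; exact hfg.apply_apply_eq_zero x)).ShortExact where
  exact := rep_exact fun y hy => (hfg y).1 hy
  mono_f := (Rep.mono_iff_injective _).2 hf
  epi_g := (Rep.epi_iff_surjective _).2 hg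

variable {Δ}

/-- A free `ℤΓ`-module is free, hence induced, over `ℤΔ`: coset representatives split off the
`Δ`-part of each `γ`. -/
theorem isZero_homologyGroup_of_basis [Δ.Normal] {I : Type} [Fintype I]
    (b : Module.Basis I (MonoidAlgebra ℤ Γ) X) (n : ℕ) :
    Limits.IsZero (homologyGroup Δ X (n + 1)) := by
  classical
  -- The factor in `γ = s(γ) · (representative of the coset)`. Normality puts `s γ` in `Δ` and makes
  -- `s` equivariant for left multiplication by `Δ`.
  let s : Γ → Δ := fun γ => ⟨γ * ((γ : Γ ⧸ Δ).out)⁻¹, by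
    rw [← QuotientGroup.eq_one_iff, QuotientGroup.mk_mul, QuotientGroup.mk_inv,
      QuotientGroup.out_eq', mul_inv_cancel]⟩
  have hs : ∀ (δ : Δ) (γ : Γ), s (δ * γ) = δ * s γ := by
    intro δ γ
    have : ((δ * γ : Γ) : Γ ⧸ Δ) = γ := by
      rw [QuotientGroup.mk_mul, (QuotientGroup.eq_one_iff _).2 δ.2, one_mul]
    ext
    simp only [s, this, Subgroup.coe_mul, mul_assoc]
  let e : I → MonoidAlgebra ℤ Γ →+ (Δ →₀ X) := fun i =>
    (Finsupp.liftAddHom fun γ => AddMonoidHom.mk' (fun n : ℤ =>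
      (Finsupp.single (s γ) (MonoidAlgebra.single (((s γ)⁻¹ : Δ) * γ : Γ) n • b i) : Δ →₀ X))
      (fun m n => by rw [MonoidAlgebra.single_add, add_smul, Finsupp.single_add])).comp
      (MonoidAlgebra.coeffAddEquiv).toAddMonoidHom
  let E : X →+ (Δ →₀ X) := ∑ i, (e i).comp
    ((Finsupp.applyAddHom i).comp b.repr.toLinearMap.toAddMonoidHom)
  have hE : ∀ (i : I) (γ : Γ) (n : ℤ), E (MonoidAlgebra.single γ n • b i) = Finsupp.single (s γ)
      (MonoidAlgebra.single (((s γ)⁻¹ : Δ) * γ : Γ) n • b i) := by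
    intro i γ n
    have h1 : ∀ j, (e j) (b.repr (MonoidAlgebra.single γ n • b i) j) =
        if j = i then e i (MonoidAlgebra.single γ n) else 0 := by
      intro j
      rw [map_smul, Module.Basis.repr_self, Finsupp.smul_apply, Finsupp.single_apply]
      by_cases hj : i = j
      · subst hj; simp
      · simp [hj, Ne.symm hj]
    have h2 : E (MonoidAlgebra.single γ n • b i) =
        ∑ j, (e j) (b.repr (MonoidAlgebra.single γ n • b i) j) := by
      simp only [E, AddMonoidHom.finsetSum_apply]
      rfl
    rw [h2, Finset.sum_congr rfl fun j _ => h1 j, Finset.sum_ite_eq' Finset.univ i]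
    simp [e]
  refine isZero_groupHomology_of_induced (A := resRep Δ X) E.toIntLinearMap ?_ ?_ n
  · intro x
    refine DFunLike.congr_fun (addMonoidHom_ext_of_basis b
      (f := (Finsupp.lsum ℤ (fun δ => (resRep Δ X).ρ δ)).toAddMonoidHom.comp E)
      (g := AddMonoidHom.id X) fun i γ n => ?_) x
    change Finsupp.lsum ℤ (fun δ => (resRep Δ X).ρ δ) (E (MonoidAlgebra.single γ n • b i)) = _
    rw [hE, Finsupp.lsum_single, resRep_ρ, smul_smul, MonoidAlgebra.single_mul_single]
    simp
  · intro δ x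
    refine DFunLike.congr_fun (addMonoidHom_ext_of_basis b
      (f := E.comp ((resRep Δ X).ρ δ).toAddMonoidHom)
      (g := (Finsupp.mapDomain.addMonoidHom (δ * ·)).comp E) fun i γ n => ?_) x
    change E (MonoidAlgebra.single (δ : Γ) (1 : ℤ) • MonoidAlgebra.single γ n • b i) =
      (E (MonoidAlgebra.single γ n • b i)).mapDomain (δ * ·)
    rw [smul_smul, MonoidAlgebra.single_mul_single, one_mul, hE, hE, hs, Finsupp.mapDomain_single]
    simp [mul_assoc]

/-! ### Dimension shifting -/

section DimensionShift

/-- The connecting map embeds `H₁` of the quotient into the coinvariants of the subobject, because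
`H₁` of the middle term vanishes; exactness describes its image as a kernel. -/
theorem exists_groupHomology_one {k G : Type} [CommRing k] [Group G]
    {X : ShortComplex (Rep.{0} k G)} (hX : X.ShortExact)
    (h₂ : Limits.IsZero (groupHomology X.X₂ 1)) :
    ∃ ψ : groupHomology X.X₃ 1 → X.X₁.ρ.Coinvariants, Function.Injective ψ ∧
      ∀ x : X.X₁, (∃ c, ψ c = Representation.Coinvariants.mk X.X₁.ρ x) ↔
        Representation.Coinvariants.mk X.X₂.ρ (X.f.hom x) = 0 := by
  let δ := groupHomology.δ hX 1 0 rfl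
  have hδ : Mono δ := groupHomology.mono_δ_of_isZero hX 0 h₂
  have hm : Mono (δ ≫ (groupHomology.H0Iso X.X₁).hom) := mono_comp _ _
  refine ⟨(δ ≫ (groupHomology.H0Iso X.X₁).hom).hom, (ModuleCat.mono_iff_injective _).1 hm,
    fun x => ?_⟩
  let m := groupHomology.map (MonoidHom.id G) X.f 0
  have hcomm : ∀ a, (groupHomology.H0Iso X.X₂).hom.hom (m.hom a) =
      Representation.Coinvariants.map _ _ X.f.hom ((groupHomology.H0Iso X.X₁).hom.hom a) :=
    fun a => congrArg (fun φ => φ.hom a) (groupHomology.map_id_comp_H0Iso_hom X.f)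
  obtain ⟨a, ha⟩ := (groupHomology.H0Iso X.X₁).toLinearEquiv.surjective
    (Representation.Coinvariants.mk X.X₁.ρ x)
  change (groupHomology.H0Iso X.X₁).hom.hom a = _ at ha
  rw [← Representation.Coinvariants.map_mk, ← ha, ← hcomm]
  constructor
  · rintro ⟨c, hc⟩
    have hc' : δ.hom c = a := (groupHomology.H0Iso X.X₁).toLinearEquiv.injective hc
    have h0 : δ ≫ m = 0 := (groupHomology.mapShortComplex₁ hX (i := 1) (j := 0) rfl).zero
    have h1 : m.hom (δ.hom c) = 0 := congrArg (fun φ => φ.hom c) h0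
    rw [← hc', h1, map_zero]
  · intro h
    have h0 : m.hom a = 0 := (groupHomology.H0Iso X.X₂).toLinearEquiv.injective
      (h.trans (map_zero (groupHomology.H0Iso X.X₂).toLinearEquiv).symm)
    obtain ⟨c, hc⟩ : ∃ c, δ.hom c = a := (ShortComplex.moduleCat_exact_iff _).1
      (groupHomology.mapShortComplex₁_exact hX (i := 1) (j := 0) rfl) a h0
    exact ⟨c, congrArg (groupHomology.H0Iso X.X₁).hom.hom hc⟩

variable {f : X →ₗ[MonoidAlgebra ℤ Γ] Y} {g : Y →ₗ[MonoidAlgebra ℤ Γ] Z}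

/-- Dimension shifting in degrees at least `2`. -/
theorem nonempty_homologyGroup_equiv (hf : Function.Injective f) (hfg : Function.Exact f g)
    (hg : Function.Surjective g) (hY : ∀ n, Limits.IsZero (homologyGroup Δ Y (n + 1))) (n : ℕ) :
    Nonempty (homologyGroup Δ Z (n + 2) ≃+ homologyGroup Δ X (n + 1)) := by
  have := groupHomology.isIso_δ_of_isZero (shortExact_resHom Δ hf hfg hg) (n + 1) (hY (n + 1)) (hY n)
  exact ⟨(asIso (groupHomology.δ (shortExact_resHom Δ hf hfg hg) (n + 2) (n + 1)
    rfl)).toLinearEquiv.toAddEquiv⟩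

/-- Dimension shifting in degree `1`. -/
theorem exists_homologyGroup_one (hf : Function.Injective f) (hfg : Function.Exact f g)
    (hg : Function.Surjective g) (hY : Limits.IsZero (homologyGroup Δ Y 1)) :
    ∃ ψ : homologyGroup Δ Z 1 → (resRep Δ X).ρ.Coinvariants, Function.Injective ψ ∧
      ∀ x : X, (∃ c, ψ c = Representation.Coinvariants.mk (resRep Δ X).ρ x) ↔
        Representation.Coinvariants.mk (resRep Δ Y).ρ (f x) = 0 :=
  exists_groupHomology_one (shortExact_resHom Δ hf hfg hg) hY

end DimensionShift

/-! ### Coinvariants of free modules in coordinates -/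

section Projection

variable [Δ.Normal] {I : Type} (Δ)

/-- The coordinates of the image of an element of a free module in the coinvariants under `Δ`. -/
def coord (b : Module.Basis I (MonoidAlgebra ℤ Γ) X) : X →+ (I × (Γ ⧸ Δ) → ℤ) where
  toFun x i := (MonoidAlgebra.mapDomainRingHom ℤ (QuotientGroup.mk' Δ) (b.repr x i.1)).coeff i.2
  map_zero' := by ext; simp
  map_add' x y := by ext; simp [Finsupp.mapDomain_add]

theorem coord_apply (b : Module.Basis I (MonoidAlgebra ℤ Γ) X) (x : X) (i : I) (g : Γ ⧸ Δ) :
    coord Δ b x (i, g) =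
      (MonoidAlgebra.mapDomainRingHom ℤ (QuotientGroup.mk' Δ) (b.repr x i)).coeff g := rfl

variable [Fintype I]

theorem coord_single [DecidableEq I] [DecidableEq (Γ ⧸ Δ)] (b : Module.Basis I (MonoidAlgebra ℤ Γ) X)
    (i : I) (γ : Γ) (n : ℤ) :
    coord Δ b (MonoidAlgebra.single γ n • b i) = Pi.single (i, (γ : Γ ⧸ Δ)) n := by
  ext ⟨j, g⟩
  rw [coord_apply, map_smul, Module.Basis.repr_self, Finsupp.smul_apply, Finsupp.single_apply]
  by_cases hj : i = j
  · subst hj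
    simp [Pi.single_apply, Finsupp.single_apply, eq_comm]
  · simp [hj, Ne.symm hj]

variable [Finite (Γ ⧸ Δ)]

/-- The coinvariants of a free module are a free module over `ℤ[Γ/Δ]`, and `coord` realises the
identification. -/
theorem coord_eq_zero_iff (b : Module.Basis I (MonoidAlgebra ℤ Γ) X) (x : X) :
    coord Δ b x = 0 ↔ Representation.Coinvariants.mk (resRep Δ X).ρ x = 0 := by
  classical
  have := Fintype.ofFinite (Γ ⧸ Δ)
  constructor
  · intro hx
    let mk' := (Representation.Coinvariants.mk (resRep Δ X).ρ).toAddMonoidHom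
    -- The candidate inverse sends a coordinate vector to the class built from coset
    -- representatives; which representative is chosen does not matter in the coinvariants.
    let Λ : (I × (Γ ⧸ Δ) → ℤ) →+ (resRep Δ X).ρ.Coinvariants :=
      AddMonoidHom.mk' (fun v => ∑ i, v i •
        mk' (MonoidAlgebra.single i.2.out (1 : ℤ) • b i.1)) fun v w => by
        simp [add_smul, Finset.sum_add_distrib]
    have hΛ : Λ.comp (coord Δ b) = mk' := by
      refine addMonoidHom_ext_of_basis b fun i γ n => ?_
      change Λ (coord Δ b (MonoidAlgebra.single γ n • b i)) = _
      rw [coord_single]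
      change ∑ j, (Pi.single (i, (γ : Γ ⧸ Δ)) n : I × (Γ ⧸ Δ) → ℤ) j •
        mk' (MonoidAlgebra.single j.2.out (1 : ℤ) • b j.1) = _
      rw [Finset.sum_eq_single (i, (γ : Γ ⧸ Δ)) (fun j _ hj => by simp [hj])
        (by simp), Pi.single_eq_same]
      have hδ : γ * ((γ : Γ ⧸ Δ).out)⁻¹ ∈ Δ := by
        rw [← QuotientGroup.eq_one_iff, QuotientGroup.mk_mul, QuotientGroup.mk_inv,
          QuotientGroup.out_eq', mul_inv_cancel]
      have h1 := Representation.Coinvariants.mk_self_apply (resRep Δ X).ρ ⟨_, hδ⟩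
        (MonoidAlgebra.single (γ : Γ ⧸ Δ).out (1 : ℤ) • b i)
      rw [resRep_ρ, smul_smul, MonoidAlgebra.single_mul_single, inv_mul_cancel_right, one_mul] at h1
      change n • Representation.Coinvariants.mk (resRep Δ X).ρ _ =
        Representation.Coinvariants.mk (resRep Δ X).ρ _
      rw [← h1, ← map_smul, ← smul_assoc, MonoidAlgebra.smul_single, smul_eq_mul, mul_one]
    have := DFunLike.congr_fun hΛ x
    rw [AddMonoidHom.comp_apply, hx, map_zero] at this
    exact this.symm
  · intro hx
    have h := Representation.Coinvariants.lift_mk (resRep Δ X).ρ (coord Δ b).toIntLinearMap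
      (fun δ => LinearMap.toAddMonoidHom_injective (addMonoidHom_ext_of_basis b fun i γ n => by
        change coord Δ b (MonoidAlgebra.single (δ : Γ) (1 : ℤ) • MonoidAlgebra.single γ n • b i) =
          coord Δ b (MonoidAlgebra.single γ n • b i)
        rw [smul_smul, MonoidAlgebra.single_mul_single, coord_single, coord_single, one_mul,
          QuotientGroup.mk_mul, (QuotientGroup.eq_one_iff _).2 δ.2, one_mul])) x
    rw [hx, map_zero] at h
    exact h.symm

theorem coord_surjective (b : Module.Basis I (MonoidAlgebra ℤ Γ) X) :
    Function.Surjective (coord Δ b) := by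
  classical
  have := Fintype.ofFinite (Γ ⧸ Δ)
  intro v
  refine ⟨∑ i, MonoidAlgebra.single i.2.out (v i) • b i.1, ?_⟩
  simp only [map_sum, coord_single, QuotientGroup.out_eq']
  exact Finset.univ_sum_single v

end Projection

end Restriction

end

end PadicTorsion

namespace PadicTorsion

open scoped Topology

noncomputable section

/-! ### Group homology from a free resolution -/

section Coinvariants

variable {Γ : Type} [Group Γ] (Δ : Subgroup Γ) {A B C : Type} [AddCommGroup A]
  [Module (MonoidAlgebra ℤ Γ) A] [AddCommGroup B] [Module (MonoidAlgebra ℤ Γ) B] [AddCommGroup C]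
  [Module (MonoidAlgebra ℤ Γ) C]

theorem mk_coinvariants_map (f : A →ₗ[MonoidAlgebra ℤ Γ] B) {x : A}
    (hx : Representation.Coinvariants.mk (resRep Δ A).ρ x = 0) :
    Representation.Coinvariants.mk (resRep Δ B).ρ (f x) = 0 := by
  have h := Representation.Coinvariants.map_mk (resHom Δ f).hom x
  rw [hx, map_zero] at h
  exact h.symm

/-- Right exactness of the coinvariants. -/
theorem mk_coinvariants_eq_zero_iff {d : A →ₗ[MonoidAlgebra ℤ Γ] B}
    {θ : B →ₗ[MonoidAlgebra ℤ Γ] C} (hex : Function.Exact d θ) (hθ : Function.Surjective θ) (x : B) :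
    Representation.Coinvariants.mk (resRep Δ C).ρ (θ x) = 0 ↔
      ∃ w, Representation.Coinvariants.mk (resRep Δ B).ρ (x - d w) = 0 := by
  constructor
  · intro h
    rw [Representation.Coinvariants.mk_eq_zero] at h
    have hle : Representation.Coinvariants.ker (resRep Δ C).ρ ≤
        (Representation.Coinvariants.ker (resRep Δ B).ρ).map θ.toAddMonoidHom.toIntLinearMap := by
      refine Submodule.span_le.2 ?_
      rintro _ ⟨⟨δ, c⟩, rfl⟩
      obtain ⟨b, rfl⟩ := hθ c
      refine ⟨_, Representation.Coinvariants.sub_mem_ker δ b, ?_⟩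
      exact (map_sub θ _ _).trans (congrArg (· - θ b)
        (θ.map_smul (MonoidAlgebra.single (δ : Γ) (1 : ℤ)) b))
    obtain ⟨y, hy, hyx⟩ := hle h
    obtain ⟨w, hw⟩ := (hex (x - y)).1 (by rw [map_sub, sub_eq_zero]; exact hyx.symm)
    refine ⟨w, ?_⟩
    rw [hw, sub_sub_cancel]
    exact (Representation.Coinvariants.mk_eq_zero _).2 hy
  · rintro ⟨w, hw⟩
    have := mk_coinvariants_map Δ θ hw
    rwa [map_sub, hex.apply_apply_eq_zero, sub_zero] at this

end Coinvariants

/-- Two quotients of one set with the same fibres. A bare bijection is enough, since only finiteness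
and cardinalities of homology enter the Euler characteristic. -/
theorem nonempty_equiv_of_surjective {P A B : Type*} {f : P → A} {g : P → B}
    (hf : Function.Surjective f) (hg : Function.Surjective g)
    (h : ∀ x y, f x = f y ↔ g x = g y) : Nonempty (A ≃ B) := by
  have hfs := Function.surjInv_eq hf
  refine ⟨Equiv.ofBijective (fun a => g (Function.surjInv hf a)) ⟨fun a b hab => ?_, fun b => ?_⟩⟩
  · have := (h _ _).2 hab
    rwa [hfs, hfs] at this
  · obtain ⟨x, rfl⟩ := hg b
    exact ⟨f x, (h _ _).1 (hfs _)⟩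

namespace BasedResolution

variable {Γ : Type} [Group Γ] {M : Type} [AddCommGroup M] [Module (MonoidAlgebra ℤ Γ) M]
  (F : BasedResolution (MonoidAlgebra ℤ Γ) M)

/-- The syzygies of a resolution. -/
def syzygy : ∀ n, Submodule (MonoidAlgebra ℤ Γ) (F.complex.X n)
  | 0 => LinearMap.ker F.aug
  | n + 1 => LinearMap.ker (F.complex.d (n + 1) n).hom

/-- The differential onto the syzygies. -/
def toSyzygy (n : ℕ) : F.complex.X (n + 1) →ₗ[MonoidAlgebra ℤ Γ] F.syzygy n :=
  (F.complex.d (n + 1) n).hom.codRestrict (F.syzygy n) fun x => by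
    cases n with
    | zero => exact F.exact_aug.apply_apply_eq_zero x
    | succ n => exact (F.exact_succ n).apply_apply_eq_zero x

theorem coe_toSyzygy (n : ℕ) (x : F.complex.X (n + 1)) :
    (F.toSyzygy n x : F.complex.X n) = (F.complex.d (n + 1) n).hom x := rfl

theorem toSyzygy_surjective (n : ℕ) : Function.Surjective (F.toSyzygy n) := by
  rintro ⟨y, hy⟩
  cases n with
  | zero =>
    obtain ⟨x, hx⟩ := (F.exact_aug y).1 hy
    exact ⟨x, Subtype.ext hx⟩
  | succ n =>
    obtain ⟨x, hx⟩ := (F.exact_succ n y).1 hy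
    exact ⟨x, Subtype.ext hx⟩

theorem toSyzygy_eq_zero_iff (n : ℕ) (x : F.complex.X (n + 1)) :
    F.toSyzygy n x = 0 ↔ (F.complex.d (n + 1) n).hom x = 0 := by
  rw [← F.coe_toSyzygy, Submodule.coe_eq_zero]

theorem exact_toSyzygy (n : ℕ) :
    Function.Exact (F.complex.d (n + 2) (n + 1)).hom (F.toSyzygy n) := fun x => by
  rw [toSyzygy_eq_zero_iff]
  exact F.exact_succ n x

theorem exact_subtype_toSyzygy (n : ℕ) :
    Function.Exact (F.syzygy (n + 1)).subtype (F.toSyzygy n) := fun x => by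
  rw [toSyzygy_eq_zero_iff]
  exact ⟨fun hx => ⟨⟨x, hx⟩, rfl⟩, by rintro ⟨y, rfl⟩; exact y.2⟩

theorem exact_subtype_aug : Function.Exact (F.syzygy 0).subtype F.aug := fun x =>
  ⟨fun hx => ⟨⟨x, hx⟩, rfl⟩, by rintro ⟨y, rfl⟩; exact y.2⟩

variable (Δ : Subgroup Γ) [Δ.Normal]

/-- Repeated dimension shifting along the resolution, each free term having no positive homology. -/
theorem nonempty_homologyGroup_syzygy (n : ℕ) : ∀ i, Nonempty
    (homologyGroup Δ M (n + i + 2) ≃+ homologyGroup Δ (F.syzygy n) (i + 1)) := by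
  induction n with
  | zero =>
    intro i
    rw [zero_add]
    exact nonempty_homologyGroup_equiv (F.syzygy 0).subtype_injective F.exact_subtype_aug
      F.aug_surjective (isZero_homologyGroup_of_basis (F.basis 0)) i
  | succ n ih =>
    intro i
    obtain ⟨e⟩ := nonempty_homologyGroup_equiv (Δ := Δ) (F.syzygy (n + 1)).subtype_injective
      (F.exact_subtype_toSyzygy n) (F.toSyzygy_surjective n)
      (isZero_homologyGroup_of_basis (F.basis (n + 1))) i
    obtain ⟨e'⟩ := ih (i + 1)
    rw [show n + 1 + i + 2 = n + (i + 1) + 2 by omega]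
    exact ⟨e'.trans e⟩

/-- After shifting, `H_{n+1}(Δ, M)` is an `H₁` whose connecting map embeds it into the coinvariants
of a syzygy, as the kernel of the map to the coinvariants of `F_n`. -/
theorem exists_homologyGroup_succ (n : ℕ) :
    ∃ ψ : homologyGroup Δ M (n + 1) → (resRep Δ (F.syzygy n)).ρ.Coinvariants,
      Function.Injective ψ ∧ ∀ x : F.syzygy n,
        (∃ c, ψ c = Representation.Coinvariants.mk (resRep Δ (F.syzygy n)).ρ x) ↔
          Representation.Coinvariants.mk (resRep Δ (F.complex.X n)).ρ (x : F.complex.X n) = 0 := by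
  cases n with
  | zero =>
    exact exists_homologyGroup_one (F.syzygy 0).subtype_injective F.exact_subtype_aug
      F.aug_surjective (isZero_homologyGroup_of_basis (F.basis 0) 0)
  | succ n =>
    obtain ⟨e⟩ := F.nonempty_homologyGroup_syzygy Δ n 0
    obtain ⟨ψ, hψ, h⟩ := exists_homologyGroup_one (Δ := Δ) (F.syzygy (n + 1)).subtype_injective
      (F.exact_subtype_toSyzygy n) (F.toSyzygy_surjective n)
      (isZero_homologyGroup_of_basis (F.basis (n + 1)) 0)
    refine ⟨ψ ∘ e, hψ.comp e.injective, fun x => ?_⟩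
    refine Iff.trans ?_ (h x)
    exact ⟨fun ⟨c, hc⟩ => ⟨e c, hc⟩, fun ⟨c, hc⟩ => ⟨e.symm c, by simpa using hc⟩⟩

variable [Fintype (Γ ⧸ Δ)] [DecidableEq (Γ ⧸ Δ)]

/-- The action of the integral group ring of `Γ` on the group ring of a finite quotient. -/
def quotMat : MonoidAlgebra ℤ Γ →+* Matrix (Γ ⧸ Δ) (Γ ⧸ Δ) ℤ :=
  (regMat ℤ (Γ ⧸ Δ)).comp (MonoidAlgebra.mapDomainRingHom ℤ (QuotientGroup.mk' Δ))

/-- The differentials of the coinvariants of a based resolution. -/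
def quotD (i j : ℕ) : Matrix (Fin (F.rank i) × (Γ ⧸ Δ)) (Fin (F.rank j) × (Γ ⧸ Δ)) ℤ :=
  blockMap (quotMat Δ) (F.dMat i j)

theorem quotD_eq_zero (i j : ℕ) (h : j + 1 ≠ i) : F.quotD Δ i j = 0 := by
  rw [quotD, F.dMat_eq_zero i j h, blockMap_zero]

theorem quotD_sq (n : ℕ) : F.quotD Δ (n + 2) (n + 1) * F.quotD Δ (n + 1) n = 0 := by
  rw [quotD, quotD, ← blockMap_mul, F.dMat_sq, blockMap_zero]

theorem coord_d (i j : ℕ) (x : F.complex.X i) :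
    coord Δ (F.basis j) ((F.complex.d i j).hom x) =
      Matrix.vecMul (coord Δ (F.basis i) x) (F.quotD Δ i j) := by
  ext ⟨t, g⟩
  have h : ∀ (a : MonoidAlgebra ℤ Γ) (g : Γ ⧸ Δ),
      (MonoidAlgebra.mapDomainRingHom ℤ (QuotientGroup.mk' Δ) a).coeff g = quotMat Δ a 1 g := by
    intro a g
    rw [quotMat, RingHom.comp_apply, regMat_apply, inv_one, one_mul]
  rw [coord_apply, h, F.repr_d]
  simp only [Matrix.vecMul, dotProduct, map_sum, map_mul, Matrix.sum_apply, Matrix.mul_apply,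
    Fintype.sum_prod_type, coord_apply, h]
  rfl

/-- The class in the homology of the coinvariants of an element whose coordinates are a cycle. -/
def homologyMk (n : ℕ) (x : {x : F.complex.X n // coord Δ (F.basis n) x ∈ cycles (F.quotD Δ) n}) :
    matHomology (F.quotD Δ) n :=
  Submodule.Quotient.mk ⟨coord Δ (F.basis n) x, x.2⟩

theorem homologyMk_surjective (n : ℕ) : Function.Surjective (F.homologyMk Δ n) := by
  intro y
  obtain ⟨⟨z, hz⟩, rfl⟩ := Submodule.Quotient.mk_surjective _ y
  obtain ⟨x, rfl⟩ := coord_surjective Δ (F.basis n) z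
  exact ⟨⟨x, hz⟩, rfl⟩

theorem homologyMk_eq_iff (n : ℕ) (x y) : F.homologyMk Δ n x = F.homologyMk Δ n y ↔
    ∃ w, Representation.Coinvariants.mk (resRep Δ (F.complex.X n)).ρ
      (x.1 - y.1 - (F.complex.d (n + 1) n).hom w) = 0 := by
  rw [homologyMk, homologyMk, Submodule.Quotient.eq]
  change coord Δ (F.basis n) x.1 - coord Δ (F.basis n) y.1 ∈ boundaries (F.quotD Δ) n ↔ _
  rw [← map_sub, mem_boundaries, (coord_surjective Δ (F.basis (n + 1))).exists]
  refine exists_congr fun w => ?_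
  rw [← coord_eq_zero_iff Δ (F.basis n), map_sub, map_sub, map_sub, coord_d, sub_eq_zero, eq_comm]

theorem nonempty_homology_zero : Nonempty (homologyGroup Δ M 0 ≃ matHomology (F.quotD Δ) 0) := by
  refine nonempty_equiv_of_surjective (f := fun x : {x : F.complex.X 0 //
      coord Δ (F.basis 0) x ∈ cycles (F.quotD Δ) 0} =>
    (groupHomology.H0Iso (resRep Δ M)).toLinearEquiv.symm
      (Representation.Coinvariants.mk (resRep Δ M).ρ (F.aug x.1)))
    ?_ (F.homologyMk_surjective Δ 0) fun x y => ?_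
  · intro y
    obtain ⟨m, hm⟩ := Representation.Coinvariants.mk_surjective (resRep Δ M).ρ
      ((groupHomology.H0Iso (resRep Δ M)).toLinearEquiv y)
    obtain ⟨x, rfl⟩ := F.aug_surjective m
    refine ⟨⟨x, ?_⟩, ?_⟩
    · rw [mem_cycles, F.quotD_eq_zero Δ 0 (0 - 1) (by omega), Matrix.vecMul_zero]
    · exact (LinearEquiv.symm_apply_eq _).2 hm
  · rw [homologyMk_eq_iff, EmbeddingLike.apply_eq_iff_eq, ← sub_eq_zero, ← map_sub]
    exact (congrArg (fun z => Representation.Coinvariants.mk (resRep Δ M).ρ z = 0)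
      (map_sub F.aug x.1 y.1)).symm.to_iff.trans
      (mk_coinvariants_eq_zero_iff Δ F.exact_aug F.aug_surjective (x.1 - y.1))

theorem nonempty_homology_succ (n : ℕ) :
    Nonempty (homologyGroup Δ M (n + 1) ≃ matHomology (F.quotD Δ) (n + 1)) := by
  obtain ⟨ψ, hψ, h⟩ := F.exists_homologyGroup_succ Δ n
  -- Cycles of the coinvariant complex are the chains whose class in the coinvariants of the syzygy
  -- comes from homology; right exactness then accounts for the boundaries.
  have hcyc : ∀ x : F.complex.X (n + 1), coord Δ (F.basis (n + 1)) x ∈ cycles (F.quotD Δ) (n + 1) ↔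
      ∃ c, ψ c = Representation.Coinvariants.mk (resRep Δ (F.syzygy n)).ρ (F.toSyzygy n x) := by
    intro x
    rw [h, coe_toSyzygy, mem_cycles, ← coord_eq_zero_iff Δ (F.basis n), coord_d]
    rfl
  choose f hf using fun x : {x : F.complex.X (n + 1) //
    coord Δ (F.basis (n + 1)) x ∈ cycles (F.quotD Δ) (n + 1)} => (hcyc x.1).1 x.2
  refine nonempty_equiv_of_surjective (f := f) ?_ (F.homologyMk_surjective Δ (n + 1)) fun x y => ?_
  · intro c
    obtain ⟨y, hy⟩ := Representation.Coinvariants.mk_surjective (resRep Δ (F.syzygy n)).ρ (ψ c)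
    obtain ⟨x, rfl⟩ := F.toSyzygy_surjective n y
    exact ⟨⟨x, (hcyc x).2 ⟨c, hy.symm⟩⟩, hψ ((hf _).trans hy)⟩
  · rw [homologyMk_eq_iff, ← hψ.eq_iff, hf, hf, ← sub_eq_zero, ← map_sub]
    exact (congrArg (fun z => Representation.Coinvariants.mk (resRep Δ (F.syzygy n)).ρ z = 0)
      (map_sub (F.toSyzygy n) x.1 y.1)).symm.to_iff.trans
      (mk_coinvariants_eq_zero_iff Δ (F.exact_toSyzygy n) (F.toSyzygy_surjective n) (x.1 - y.1))

theorem nonempty_homology (n : ℕ) :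
    Nonempty (homologyGroup Δ M n ≃ matHomology (F.quotD Δ) n) := by
  cases n with
  | zero => exact F.nonempty_homology_zero Δ
  | succ n => exact F.nonempty_homology_succ Δ n

/-- If `p` is bijective on `M`, then the homology of the coinvariants is finite. -/
theorem finite_matHomology {p : ℕ} [Fact p.Prime] (h : ExactMod p F.dMat) (n : ℕ) :
    Finite (matHomology (F.quotD Δ) n) := by
  obtain ⟨S, E, h0, hs, hc⟩ := h.exists_homotopy fun x hx => MonoidAlgebra.eq_zero_of_nsmul_eq_zero
    (Fact.out : p.Prime).ne_zero hx
  let S' := fun n => blockMap (quotMat Δ) (S n)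
  let E' := fun n => blockMap (quotMat Δ) (E n)
  have hE : ∀ n, blockMap (quotMat Δ) (1 - p • E n) = 1 - (p : ℤ) • E' n := fun n => by
    rw [blockMap_sub, blockMap_one, ← Nat.cast_smul_eq_nsmul (MonoidAlgebra ℤ Γ),
      blockMap_natCast_smul]
  -- The homotopy pushed to the quotient writes a cycle as `pEz` plus a boundary, and `Ez` is again
  -- a cycle because `E` commutes with the differential.
  have key : ∀ z ∈ cycles (F.quotD Δ) n, ∃ w ∈ cycles (F.quotD Δ) n,
      z - (p : ℤ) • w ∈ boundaries (F.quotD Δ) n := by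
    intro z hz
    cases n with
    | zero =>
      refine ⟨Matrix.vecMul z (E' 0), ?_, Matrix.vecMul z (S' 0), ?_⟩
      · rw [mem_cycles, F.quotD_eq_zero Δ 0 (0 - 1) (by omega), Matrix.vecMul_zero]
      · have h1 : S' 0 * F.quotD Δ 1 0 = 1 - (p : ℤ) • E' 0 := by
          rw [← hE, ← h0, blockMap_mul]; rfl
        rw [Matrix.vecMulLinear_apply, Matrix.vecMul_vecMul, h1, Matrix.vecMul_sub,
          Matrix.vecMul_one, Matrix.vecMul_smul]
    | succ n =>
      have hz' : Matrix.vecMul z (F.quotD Δ (n + 1) n) = 0 := mem_cycles.1 hz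
      refine ⟨Matrix.vecMul z (E' (n + 1)), ?_, Matrix.vecMul z (S' (n + 1)), ?_⟩
      · have h1 : E' (n + 1) * F.quotD Δ (n + 1) n = F.quotD Δ (n + 1) n * E' n := by
          change blockMap _ _ * blockMap _ _ = blockMap _ _ * blockMap _ _
          rw [← blockMap_mul, hc, blockMap_mul]
        rw [mem_cycles]
        change Matrix.vecMul _ (F.quotD Δ (n + 1) n) = 0
        rw [Matrix.vecMul_vecMul, h1, ← Matrix.vecMul_vecMul, hz', Matrix.zero_vecMul]
      · have h1 : F.quotD Δ (n + 1) n * S' n + S' (n + 1) * F.quotD Δ (n + 2) (n + 1) =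
            1 - (p : ℤ) • E' (n + 1) := by
          rw [← hE, ← hs, blockMap_add, blockMap_mul, blockMap_mul]; rfl
        have h2 := congrArg (Matrix.vecMul z) h1
        rw [Matrix.vecMul_add, ← Matrix.vecMul_vecMul, hz', Matrix.zero_vecMul, zero_add,
          Matrix.vecMul_sub, Matrix.vecMul_one, Matrix.vecMul_smul, ← Matrix.vecMul_vecMul] at h2
        exact h2
  have hle : (⊤ : Submodule ℤ (matHomology (F.quotD Δ) n)) ≤ Ideal.span {(p : ℤ)} • ⊤ := by
    rintro y -
    obtain ⟨⟨z, hz⟩, rfl⟩ := Submodule.Quotient.mk_surjective _ y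
    obtain ⟨w, hw, hb⟩ := key z hz
    have : (Submodule.Quotient.mk ⟨z, hz⟩ : matHomology (F.quotD Δ) n) =
        (p : ℤ) • Submodule.Quotient.mk ⟨w, hw⟩ := by
      rw [← Submodule.Quotient.mk_smul, Submodule.Quotient.eq]
      exact hb
    rw [this]
    exact Submodule.smul_mem_smul (Ideal.mem_span_singleton_self _) trivial
  -- Nakayama: some `r ≡ 1` modulo `p` annihilates the homology. It is nonzero, so this finitely
  -- generated group is torsion and therefore finite.
  obtain ⟨r, hr, hr'⟩ := Submodule.exists_sub_one_mem_and_smul_eq_zero_of_fg_of_le_smul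
    (Ideal.span {(p : ℤ)}) ⊤ (Module.Finite.fg_top) hle
  have hr0 : r ≠ 0 := by
    rintro rfl
    rw [Ideal.mem_span_singleton, zero_sub, dvd_neg] at hr
    exact (Nat.prime_iff_prime_int.1 (Fact.out : p.Prime)).not_isUnit (isUnit_of_dvd_one hr)
  exact Module.finite_of_fg_torsion _ fun x => ⟨⟨r, mem_nonZeroDivisors_of_ne_zero hr0⟩,
    hr' x trivial⟩

theorem subsingleton_matHomology {n : ℕ} (hn : F.length < n) :
    Subsingleton (matHomology (F.quotD Δ) n) := by
  have : IsEmpty (Fin (F.rank n)) := by rw [F.rank_eq_zero n hn]; infer_instance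
  exact (Submodule.Quotient.mk_surjective _).subsingleton

end BasedResolution

end

end PadicTorsion

namespace PadicTorsion

open scoped Topology

noncomputable section

/-! ### The logarithmic determinant and the Euler characteristic -/

namespace BasedResolution

variable {Γ : Type} [Group Γ] {M : Type} [AddCommGroup M] [Module (MonoidAlgebra ℤ Γ) M]
  (F : BasedResolution (MonoidAlgebra ℤ Γ) M) (Δ : Subgroup Γ) [Δ.Normal] [Fintype (Γ ⧸ Δ)]
  [DecidableEq (Γ ⧸ Δ)]

theorem subsingleton_homologyGroup {n : ℕ} (hn : F.length < n) :
    Subsingleton (homologyGroup Δ M n) := by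
  obtain ⟨e⟩ := F.nonempty_homology Δ n
  have := F.subsingleton_matHomology Δ hn
  exact e.subsingleton

theorem eulerChar_eq {N : ℕ} (hN : F.length < N) :
    eulerChar Δ M =
      ∏ n ∈ Finset.range N, (Nat.card (matHomology (F.quotD Δ) n) : ℚ) ^ ((-1 : ℤ) ^ n) := by
  have h : ∀ n, Nat.card (homologyGroup Δ M n) = Nat.card (matHomology (F.quotD Δ) n) := fun n => by
    obtain ⟨e⟩ := F.nonempty_homology Δ n
    exact Nat.card_congr e
  simp only [eulerChar, h]
  refine finprod_eq_prod_of_mulSupport_subset _ fun n hn => ?_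
  by_contra hn'
  have := F.subsingleton_matHomology Δ (n := n) (by
    simp only [Finset.coe_range, Set.mem_Iio] at hn'; omega)
  exact hn (by simp)

variable {p : ℕ} [Fact p.Prime]

/-- This lets the contraction over the completion serve as a rational contraction of the integral
complex of coinvariants. -/
theorem map_quotD (i j : ℕ) : (F.quotD Δ i j).map (Int.castRingHom ℚ_[p]) =
    (blockMap (rhoHat p (QuotientGroup.mk' Δ)) (F.dHat p i j)).map
      (PadicInt.Coe.ringHom (p := p)) := by
  ext ⟨s, g⟩ ⟨t, h⟩
  simp only [Matrix.map_apply, blockMap_apply]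
  rw [F.dHat_eq, Matrix.map_apply, rhoHat_toHat, Matrix.map_apply]
  simp [quotD, blockMap_apply, quotMat]

theorem matContraction_quotD
    {S : ∀ i j, Matrix (Fin (F.rank i)) (Fin (F.rank j)) (GroupRingHat p Γ)}
    (hS : F.IsContraction p S) :
    MatContraction (fun i j => (F.quotD Δ i j).map (Int.castRingHom ℚ_[p])) fun i j =>
      (blockMap (rhoHat p (QuotientGroup.mk' Δ)) (S i j)).map (PadicInt.Coe.ringHom (p := p)) := by
  set f := rhoHat p (QuotientGroup.mk' Δ)
  set c := PadicInt.Coe.ringHom (p := p)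
  have hD : ∀ i j, (F.quotD Δ i j).map (Int.castRingHom ℚ_[p]) =
      (blockMap f (F.dHat p i j)).map c := F.map_quotD Δ
  have hS' := F.matContraction_iff.2 hS
  have hmul : ∀ {l m n : ℕ} (A : Matrix (Fin l) (Fin m) (GroupRingHat p Γ))
      (B : Matrix (Fin m) (Fin n) (GroupRingHat p Γ)),
      (blockMap f A).map c * (blockMap f B).map c = (blockMap f (A * B)).map c := fun A B => by
    rw [blockMap_mul, Matrix.map_mul]
  have hone : ∀ n : ℕ, (blockMap f (1 : Matrix (Fin n) (Fin n) (GroupRingHat p Γ))).map c = 1 :=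
    fun n => by rw [blockMap_one, Matrix.map_one _ (map_zero c) (map_one c)]
  have hzero : ∀ m n : ℕ, (blockMap f (0 : Matrix (Fin m) (Fin n) (GroupRingHat p Γ))).map c = 0 :=
    fun m n => by rw [blockMap_zero, Matrix.map_zero _ (map_zero c)]
  refine ⟨fun i j h => ?_, fun i j h => ?_, fun n => ?_, ?_, fun n => ?_⟩
  · simp only [hD, hS'.degree_neg i j h, hzero]
  · simp only [hS'.degree_one i j h, hzero]
  · simp only [hD, hmul, hS'.sq, hzero]
  · simp only [hD, hmul, hS'.zero, hone]
  · simp only [hD, hmul]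
    rw [← Matrix.map_add _ (map_add c), ← blockMap_add, hS'.succ, hone]

/-- The `p`-adic logarithm of the determinant of the torsion in a finite quotient is the `p`-adic
logarithm of the multiplicative Euler characteristic. -/
theorem logDet_isTorsion (h : ExactMod p F.dMat) {t : KTHat p Γ} (ht : F.IsTorsion p t) :
    (logDet (QuotientGroup.mk' Δ) t).toAdd = padicLog p ((eulerChar Δ M : ℚ) : ℚ_[p]) := by
  obtain ⟨S, r, e, e', u, hS, hu, rfl⟩ := ht
  have hfin : ∀ n, F.length + 1 ≤ n → IsEmpty (Fin (F.rank n) × (Γ ⧸ Δ)) := fun n hn => by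
    rw [F.rank_eq_zero n hn]; infer_instance
  have f1 : Finite (Σ k, Fin (F.rank (2 * k + 1)) × (Γ ⧸ Δ)) :=
    finite_sigma (ι := fun k => Fin (F.rank (2 * k + 1)) × (Γ ⧸ Δ)) (d := F.length)
      fun n hn => hfin _ (by omega)
  have f2 : Finite (Σ k, Fin (F.rank (2 * k)) × (Γ ⧸ Δ)) :=
    finite_sigma (ι := fun k => Fin (F.rank (2 * k)) × (Γ ⧸ Δ)) (d := F.length)
      fun n hn => hfin _ (by omega)
  have := Fintype.ofFinite (Σ k, Fin (F.rank (2 * k + 1)) × (Γ ⧸ Δ))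
  have := Fintype.ofFinite (Σ k, Fin (F.rank (2 * k)) × (Γ ⧸ Δ))
  -- These orderings extend `e` and `e'` blockwise, so the reindexed odd part is exactly the image
  -- of `u` under the regular representation.
  let E : (Σ k, Fin (F.rank (2 * k + 1)) × (Γ ⧸ Δ)) ≃ Fin r × (Γ ⧸ Δ) :=
    (Equiv.sigmaProdDistrib _ _).symm.trans (e.prodCongr (Equiv.refl _))
  let E' : (Σ k, Fin (F.rank (2 * k)) × (Γ ⧸ Δ)) ≃ Fin r × (Γ ⧸ Δ) :=
    (Equiv.sigmaProdDistrib _ _).symm.trans (e'.prodCongr (Equiv.refl _))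
  have hdet := det_oddPart_eq (D := F.quotD Δ) ℚ_[p] (F.matContraction_quotD Δ hS)
    (F.quotD_eq_zero Δ) (F.quotD_sq Δ) (F.finite_matHomology Δ h) hfin E E'
  have hmat : Matrix.reindex E E' (oddPart (fun i j => (F.quotD Δ i j).map (Int.castRingHom ℚ_[p]))
      fun i j => (blockMap (rhoHat p (QuotientGroup.mk' Δ)) (S i j)).map
        (PadicInt.Coe.ringHom (p := p))) =
      (blockMap (rhoHat p (QuotientGroup.mk' Δ)) u.val).map (PadicInt.Coe.ringHom (p := p)) := by
    ext ⟨i, g⟩ ⟨j, h⟩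
    obtain ⟨x, rfl⟩ := e.surjective i
    obtain ⟨y, rfl⟩ := e'.surjective j
    have hx : E.symm (e x, g) = ⟨x.1, (x.2, g)⟩ := by
      simp [E, Equiv.sigmaProdDistrib]
    have hy : E'.symm (e' y, h) = ⟨y.1, (y.2, h)⟩ := by
      simp [E', Equiv.sigmaProdDistrib]
    have hxy : u.val (e x) (e' y) = F.oddMatrix p S x y := by
      rw [hu, Matrix.reindex_apply, Matrix.submatrix_apply, Equiv.symm_apply_apply,
        Equiv.symm_apply_apply]
    rw [Matrix.reindex_apply, Matrix.submatrix_apply, hx, hy, Matrix.map_apply, blockMap_apply,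
      hxy]
    simp only [oddPart, map_quotD, oddMatrix, Matrix.add_apply, Matrix.map_apply, blockMap_apply,
      map_add]
  have hχ : ((eulerChar Δ M : ℚ) : ℚ_[p]) = ∏ n ∈ Finset.range (2 * (F.length + 1)),
      (Nat.card (matHomology (F.quotD Δ) n) : ℚ_[p]) ^ ((-1 : ℤ) ^ n) := by
    rw [F.eulerChar_eq Δ (N := 2 * (F.length + 1)) (by omega), Rat.cast_prod]
    refine Finset.prod_congr rfl fun n _ => ?_
    rw [Rat.cast_zpow, Rat.cast_natCast]
  have hdet' : ((blockMap (rhoHat p (QuotientGroup.mk' Δ)) u.val).map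
      (PadicInt.Coe.ringHom (p := p))).det =
      (((blockMap (rhoHat p (QuotientGroup.mk' Δ)) u.val).det : ℤ_[p]) : ℚ_[p]) :=
    (RingHom.map_det (PadicInt.Coe.ringHom (p := p)) _).symm
  rw [logDet_mk, toAdd_ofAdd, ← hdet', hχ, ← hmat]
  -- The sign ambiguity is harmless because `log_p (-1) = 0`.
  rcases hdet with hd | hd
  · exact congrArg (padicLog p) hd
  · exact (congrArg (padicLog p) hd).trans (padicLog_neg _)

end BasedResolution

/-! ### Convergence -/

section Limit

/-- Choose for each element of an enumeration of `Γ` a normal subgroup of finite index avoiding it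
(when it is nontrivial) and take finite intersections. -/
theorem exists_seq_finiteIndex (Γ : Type*) [Group Γ] [Countable Γ] [Group.ResiduallyFinite Γ] :
    ∃ Δ : ℕ → Subgroup Γ, (∀ n, (Δ n).Normal ∧ (Δ n).FiniteIndex) ∧
      ∀ γ : Γ, γ ≠ 1 → ∀ᶠ n in Filter.atTop, γ ∉ Δ n := by
  obtain ⟨f, hf⟩ := exists_surjective_nat Γ
  have h : ∀ γ : Γ, ∃ H : Subgroup Γ, (H.Normal ∧ H.FiniteIndex) ∧ (γ ≠ 1 → γ ∉ H) := by
    intro γ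
    by_cases hγ : γ = 1
    · exact ⟨⊤, ⟨inferInstance, inferInstance⟩, fun h => absurd hγ h⟩
    · obtain ⟨H, hH⟩ := Group.exists_finiteIndexNormalSubgroup_notMem γ hγ
      exact ⟨H.toSubgroup, ⟨inferInstance, inferInstance⟩, fun _ => hH⟩
  choose H hH hγH using h
  refine ⟨fun n => ⨅ i : Fin (n + 1), H (f i), fun n => ⟨?_, ?_⟩, fun γ hγ => ?_⟩
  · exact Subgroup.normal_iInf_normal fun i => (hH _).1
  · exact Subgroup.finiteIndex_iInf fun i => (hH _).2
  · obtain ⟨k, rfl⟩ := hf γ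
    filter_upwards [Filter.eventually_ge_atTop k] with n hn hmem
    exact hγH _ hγ (Subgroup.mem_iInf.1 hmem ⟨k, by omega⟩)

variable {p : ℕ} [Fact p.Prime] {Γ : Type} [Group Γ] {M : Type} [AddCommGroup M]
  [Module (MonoidAlgebra ℤ Γ) M]

/-- The sequence involves neither the resolution nor the torsion class, so uniqueness of limits
yields the invariance of the torsion. -/
theorem tendsto_padicLog_eulerChar (hWh : IsMulTorsion (WhMod p Γ))
    {φ : KTHat p Γ →* Multiplicative ℚ_[p]} (hφ : IsLogDet φ)
    {F : BasedResolution (MonoidAlgebra ℤ Γ) M} (hF : ExactMod p F.dMat) {t : KTHat p Γ}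
    (ht : F.IsTorsion p t) {Δ : ℕ → Subgroup Γ} (hΔ : ∀ n, (Δ n).Normal ∧ (Δ n).FiniteIndex)
    (hΔ' : ∀ γ : Γ, γ ≠ 1 → ∀ᶠ n in Filter.atTop, γ ∉ Δ n) :
    Filter.Tendsto
      (fun n : ℕ => ((Δ n).index : ℚ_[p])⁻¹ * padicLog p ((eulerChar (Δ n) M : ℚ) : ℚ_[p]))
      Filter.atTop (𝓝 (φ t).toAdd) := by
  classical
  have := fun n => (hΔ n).1
  have := fun n => (hΔ n).2
  have := fun n => Fintype.ofFinite (Γ ⧸ Δ n)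
  refine (tendsto_logDet hWh hφ (fun n => QuotientGroup.mk' (Δ n)) (fun γ hγ => ?_) t).congr
    fun n => ?_
  · filter_upwards [hΔ' γ hγ] with n hn h
    exact hn ((QuotientGroup.eq_one_iff γ).1 h)
  · rw [F.logDet_isTorsion (Δ n) hF ht, Subgroup.index_eq_card, Nat.card_eq_fintype_card]

theorem existsUnique_isLogDet_of_residuallyFinite [Countable Γ] [Group.ResiduallyFinite Γ]
    (hWh : IsMulTorsion (WhMod p Γ)) : ∃! φ : KTHat p Γ →* Multiplicative ℚ_[p], IsLogDet φ := by
  classical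
  obtain ⟨Δ, hΔ, hΔ'⟩ := exists_seq_finiteIndex Γ
  have := fun n => (hΔ n).1
  have := fun n => (hΔ n).2
  have := fun n => Fintype.ofFinite (Γ ⧸ Δ n)
  refine existsUnique_isLogDet hWh (fun n => QuotientGroup.mk' (Δ n)) fun γ hγ => ?_
  filter_upwards [hΔ' γ hγ] with n hn h
  exact hn ((QuotientGroup.eq_one_iff γ).1 h)

end Limit

end

end PadicTorsion

/-! ### The main theorem -/

open PadicTorsion in
theorem theorem4p1 (p : ℕ) [Fact p.Prime]
    (Γ : Type) [Group Γ] [Countable Γ] [Group.ResiduallyFinite Γ]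
    (hWh : IsMulTorsion (WhMod p Γ))
    (M : Type) [AddCommGroup M] [Module (MonoidAlgebra ℤ Γ) M]
    (hFL : IsTypeFL (MonoidAlgebra ℤ Γ) M)
    (hpM : ∀ m : M, ∃ m' : M, p • m' = m)
    (hlim : limTorsion p M = ⊥) :
    -- `log_p det_Γ` on `K_T(\widehat{ℤΓ})` exists and is unique
    (∃! φ : KTHat p Γ →* Multiplicative ℚ_[p], IsLogDet φ) ∧
    ∀ φ : KTHat p Γ →* Multiplicative ℚ_[p], IsLogDet φ →
      ∃ τ : ℚ_[p],
        -- `τ` is the value of `log_p det_Γ` at the torsion of every based resolution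
        (∀ F : BasedResolution (MonoidAlgebra ℤ Γ) M,
          F.IsAcyclicHat p ∧ (∃ t : KTHat p Γ, F.IsTorsion p t) ∧
            ∀ t : KTHat p Γ, F.IsTorsion p t → φ t = Multiplicative.ofAdd τ) ∧
        -- and it is the limit of the renormalized logarithmic Euler characteristics
        ∀ Δ : ℕ → Subgroup Γ, TendsToTrivial Δ →
          (∀ n i : ℕ, Finite (homologyGroup (Δ n) M i)) ∧
          (∀ n : ℕ, ∃ d : ℕ, ∀ i : ℕ, d < i → Subsingleton (homologyGroup (Δ n) M i)) ∧
          Filter.Tendsto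
            (fun n : ℕ => ((Δ n).index : ℚ_[p])⁻¹ * padicLog p ((eulerChar (Δ n) M : ℚ) : ℚ_[p]))
            Filter.atTop (nhds τ) := by
  have hp : p ≠ 0 := (Fact.out : p.Prime).ne_zero
  have hex : ∀ F : BasedResolution (MonoidAlgebra ℤ Γ) M, ExactMod p F.dMat := fun F =>
    F.exactMod hpM hp (BasedResolution.mul_injective hpM hlim)
  have hcontr : ∀ F : BasedResolution (MonoidAlgebra ℤ Γ) M, ∃ S, F.IsContraction p S := fun F => by
    obtain ⟨S, hS⟩ := (hex F).exists_contraction F.dMat_eq_zero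
    exact ⟨S, F.matContraction_iff.1 hS⟩
  have htors : ∀ F : BasedResolution (MonoidAlgebra ℤ Γ) M, ∃ t, F.IsTorsion p t := fun F =>
    (hcontr F).elim fun _ hS => F.exists_isTorsion hS
  refine ⟨existsUnique_isLogDet_of_residuallyFinite hWh, fun φ hφ => ?_⟩
  obtain ⟨F₀⟩ := hFL
  obtain ⟨t₀, ht₀⟩ := htors F₀
  refine ⟨(φ t₀).toAdd, fun F => ⟨(hcontr F).elim fun _ hS => F.isAcyclicHat hS, htors F,
    fun t ht => ?_⟩, fun Δ hΔ => ⟨fun n i => ?_, fun n => ⟨F₀.length, fun i hi => ?_⟩, ?_⟩⟩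
  -- Independence of the resolution needs one sequence of subgroups, provided by residual
  -- finiteness: both torsions are limits of the same Euler characteristics.
  · obtain ⟨Δ, hΔ, hΔ'⟩ := exists_seq_finiteIndex Γ
    exact Multiplicative.toAdd.injective (tendsto_nhds_unique
      (tendsto_padicLog_eulerChar hWh hφ (hex F) ht hΔ hΔ')
      (tendsto_padicLog_eulerChar hWh hφ (hex F₀) ht₀ hΔ hΔ'))
  · classical
    have := (hΔ.1 n).1
    have := (hΔ.1 n).2
    have := Fintype.ofFinite (Γ ⧸ Δ n)
    obtain ⟨e⟩ := F₀.nonempty_homology (Δ n) i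
    have := F₀.finite_matHomology (Δ n) (hex F₀) i
    exact Finite.of_equiv _ e.symm
  · classical
    have := (hΔ.1 n).1
    have := (hΔ.1 n).2
    have := Fintype.ofFinite (Γ ⧸ Δ n)
    exact F₀.subsingleton_homologyGroup (Δ n) hi
  · exact tendsto_padicLog_eulerChar hWh hφ (hex F₀) ht₀ hΔ.1 fun γ hγ => hΔ.eventually_notMem hγ
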